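/- Let $\sigma,\beta,c>0$. Let $(n,K,N)$ run through a sequence of triples of positive integers with $n\to\infty$, $n/K=\beta+o(n^{-2})$ and $N/K=c+o(n^{-2})$. Let $H^n\in\mathbb C^{N\times K}$ and $W^n\in\mathbb C^{N\times n}$ be independent random matrices with i.i.d. circularly symmetric complex Gaussian $\mathcal{CN}(0,1)$ entries. For $\mathbf X^n\in\mathbb C^{K\times n}$ put $\mathbf A^n=\mathbf I_K-\frac1n\mathbf X^n(\mathbf X^n)^{\mathsf H}$ and, with $\mathbf Y^n=\frac1{\sqrt K}H^n\mathbf X^n+\sigma W^n$, $$I_{N,K}^{\mathbf X^n}=\frac1K\log\det\Big(\mathbf I_N+\frac1{\sigma^2}\frac{H^n(H^n)^{\mathsf H}}K\Big)+\frac1{nK}\operatorname{tr}\Big[\Big(\frac{H^n(H^n)^{\mathsf H}}K+\sigma^2\mathbf I_N\Big)^{-1}\mathbf Y^n(\mathbf Y^n)^{\mathsf H}-W^n(W^n)^{\mathsf H}\Big].$$ Let $\mathcal S^n=\{\mathbf X\in\mathbb C^{K\times n}:\frac1{nK}\operatorname{tr}\mathbf X\mathbf X^{\mathsf H}\le1\}$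 and put $$\delta_0=\frac{c-1}{2\sigma^2}-\frac12+\frac{\sqrt{(1-c+\sigma^2)^2+4c\sigma^2}}{2\sigma^2},\qquad \zeta_0=\frac{\delta_0}{1+\delta_0},$$ $$C=\log(1+\delta_0)+c\log\Big(1+\frac1{\sigma^2(1+\delta_0)}\Big)-\frac{\delta_0}{1+\delta_0}.$$ Then $$\mathbb E\Big[\Big|\sqrt{nK}\Big(I_{N,K}^{\mathbf X^n}-C+\zeta_0\frac1K\operatorname{tr}\mathbf A^n\Big)\Big|^2\Big]=\mathcal O\Big(1+\frac1K\operatorname{tr}(\mathbf A^n)^2\Big),$$ that is, there is a constant $M$, independent of $n$ and of the deterministic inputs $\mathbf X^n\in\mathcal S^n$, such that the left-hand side is finite and at most $M\big(1+\frac1K\operatorname{tr}((\mathbf A^n)^2)\big)$ for every triple $(n,K,N)$ of the sequence and every $\mathbf X^n\in\mathcal S^n$. -/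

import Mathlib

open MeasureTheory ProbabilityTheory Filter Asymptotics Matrix

namespace MIMO

noncomputable section

/-- The circularly symmetric complex normal law `CN(0,1)`: the real and imaginary parts are
independent real Gaussians of mean `0` and variance `1/2`. -/
def complexNormal : Measure ℂ :=
  ((gaussianReal 0 (1 / 2)).prod (gaussianReal 0 (1 / 2))).map
    (fun p : ℝ × ℝ => (p.1 : ℂ) + (p.2 : ℂ) * Complex.I)

/-- The law of the entries of an `a × b` random matrix with i.i.d. `CN(0,1)` entries. -/
def gaussianEntries (a b : ℕ) : Measure (Fin a → Fin b → ℂ) :=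
  Measure.pi fun _ => Measure.pi fun _ => complexNormal

/-- The joint law of the independent channel matrix `H` (of size `N × K`) and noise matrix `W`
(of size `N × n`), both with i.i.d. `CN(0,1)` entries. -/
def channelLaw (n K N : ℕ) : Measure ((Fin N → Fin K → ℂ) × (Fin N → Fin n → ℂ)) :=
  (gaussianEntries N K).prod (gaussianEntries N n)

/-- The input set `S^n`: the matrices `X` of size `K × n` with `(1/(nK)) tr (X Xᴴ) ≤ 1`. -/
def inputSet (n K : ℕ) : Set (Matrix (Fin K) (Fin n) ℂ) :=
  {X | 1 / ((n : ℝ) * K) * (trace (X * Xᴴ)).re ≤ 1}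

/-- `A = I_K - (1/n) X Xᴴ`. -/
def deviation {n K : ℕ} (X : Matrix (Fin K) (Fin n) ℂ) : Matrix (Fin K) (Fin K) ℂ :=
  1 - (1 / (n : ℂ)) • (X * Xᴴ)

/-- The normalized Gram matrix `(1/K) H Hᴴ`. -/
def gram {N K : ℕ} (H : Matrix (Fin N) (Fin K) ℂ) : Matrix (Fin N) (Fin N) ℂ :=
  (1 / (K : ℂ)) • (H * Hᴴ)

/-- The channel output `Y = (1/√K) H X + σ W`. -/
def output {n K N : ℕ} (σ : ℝ) (X : Matrix (Fin K) (Fin n) ℂ) (H : Matrix (Fin N) (Fin K) ℂ)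
    (W : Matrix (Fin N) (Fin n) ℂ) : Matrix (Fin N) (Fin n) ℂ :=
  (1 / (Real.sqrt K : ℂ)) • (H * X) + (σ : ℂ) • W

/-- The information density
`(1/K) log det (I + σ⁻² H Hᴴ / K) + (1/(nK)) tr [(H Hᴴ / K + σ² I)⁻¹ Y Yᴴ - W Wᴴ]`.
The determinant and the trace are real numbers, whence the real parts. -/
def infoDensity {n K N : ℕ} (σ : ℝ) (X : Matrix (Fin K) (Fin n) ℂ)
    (H : Matrix (Fin N) (Fin K) ℂ) (W : Matrix (Fin N) (Fin n) ℂ) : ℝ :=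
  1 / (K : ℝ) * Real.log (det (1 + (1 / (σ : ℂ) ^ 2) • gram H)).re
    + 1 / ((n : ℝ) * K) *
      (trace ((gram H + ((σ : ℂ) ^ 2) • (1 : Matrix (Fin N) (Fin N) ℂ))⁻¹
          * (output σ X H W * (output σ X H W)ᴴ) - W * Wᴴ)).re

/-- `δ₀(x)`. -/
def delta0 (c x : ℝ) : ℝ :=
  (c - 1) / (2 * x) - 1 / 2 + Real.sqrt ((1 - c + x) ^ 2 + 4 * c * x) / (2 * x)

/-- `γ₀(x) = δ₀(x) / (1 + δ₀(x))`. -/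
def gamma0 (c x : ℝ) : ℝ := delta0 c x / (1 + delta0 c x)

/-- The centering constant `ζ₀`. -/
def zeta0 (c σ : ℝ) : ℝ := gamma0 c (σ ^ 2)

/-- The asymptotic per-antenna capacity `C`. -/
def capacity (c σ : ℝ) : ℝ :=
  Real.log (1 + delta0 c (σ ^ 2))
    + c * Real.log (1 + 1 / (σ ^ 2 * (1 + delta0 c (σ ^ 2))))
    - delta0 c (σ ^ 2) / (1 + delta0 c (σ ^ 2))

/-- The centred and scaled information density `√(nK) (I - C + ζ₀ (1/K) tr A)`, as a function of
the pair `(H, W)`. -/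
def centredDensity {n K N : ℕ} (c σ : ℝ) (X : Matrix (Fin K) (Fin n) ℂ)
    (p : (Fin N → Fin K → ℂ) × (Fin N → Fin n → ℂ)) : ℝ :=
  Real.sqrt ((n : ℝ) * K) *
    (infoDensity σ X (Matrix.of p.1) (Matrix.of p.2) - capacity c σ
      + zeta0 c σ * (1 / (K : ℝ) * (trace (deviation X)).re))

/-- The regime `n → ∞`, `n / K = β + o(n⁻²)`, `N / K = c + o(n⁻²)`, along a sequence
`(n j, K j, N j)` of triples of positive integers. -/
structure GrowthRegime (β c : ℝ) (n K N : ℕ → ℕ) : Prop where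
  n_pos : ∀ j, 0 < n j
  K_pos : ∀ j, 0 < K j
  N_pos : ∀ j, 0 < N j
  tendsto_n : Tendsto n atTop atTop
  ratio_n : (fun j => (n j : ℝ) / K j - β) =o[atTop] fun j => ((n j : ℝ) ^ 2)⁻¹
  ratio_N : (fun j => (N j : ℝ) / K j - c) =o[atTop] fun j => ((n j : ℝ) ^ 2)⁻¹

end

end MIMO

/-!
The information density is split into three parts that are treated separately. Write
`P = H Hᴴ / K + σ²` and `B = Hᴴ P⁻¹ H / K`. Expanding the square of the output gives
(`centredDensity_eq`)

`√(nK) (I - C + ζ₀ tr A / K) = √(nK) [(log det - K C) / K + noise / (nK) - tr A (B - ζ₀) / K]`,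

where `noise` is, for a fixed channel, a sum over the columns of `W` of independent centred terms.
As `n / K` is bounded, it suffices that the mean squares of the three quantities
`log det - K C`, `noise` and `tr A (B - ζ₀)` are `O(1)`, `O(nK)` and `O(tr A² / K)`.

*Noise.* By independence the second moments of the columns add up. The linear terms contribute at
most `8 tr (X Xᴴ B)`, which is `O(nK)` by the power constraint and `B ≤ 1`, and the quadratic forms
in the noise contribute a constant for each entry of `W` (`integral_noiseSum_sq_le`).

*Resolvent trace.* The channel is treated as a family of `K` independent columns. Let `P_k` be `P`
without the contribution of column `h_k`. By the Sherman–Morrison formula, `tr P⁻¹`, `log det P` and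
the diagonal entry `B_kk = φ(h_kᴴ P_k⁻¹ h_k / K)`, with `φ(t) = t / (1 + t)`, are explicit functions
of `P_k` and of quadratic forms in `h_k`, which concentrate about traces
(`integral_norm_quad_sub_trace_sq_le`). With the Efron–Stein inequality (`efronStein`) this bounds
the variance of `t = tr P⁻¹ / K` by `O(K⁻²)` and the variance of `log det` by `O(1)`. Taking
expectations in `tr B / K = N / K - σ² t` shows that the mean `τ` of `t` satisfies
`σ² τ + φ(τ) = N / K + O(1 / K)` (`abs_meanNtr_equation_le`). Since `δ₀` solves
`σ² δ₀ + φ(δ₀) = c` and the left side is strongly monotone, `τ - δ₀ = O(1 / K)`.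

*Log-determinant.* It remains to bound the bias. All estimates hold with `x ≥ σ²` in place of `σ²`.
The derivative in `x` of the mean log-determinant is `-E tr B / x`, that of the capacity is
`-γ₀ / x` because `δ₀` is a stationary point of the defining expression (`hasDerivAt_capFun`), so
the derivative of the bias is `O(x⁻²)`; the bias vanishes as `x → ∞`, hence is bounded
(`abs_meanLogDet_sub_le`).

*Bilinear part.* The entries of `B - ζ₀` change sign with the columns of `H`, so that entries at
different positions are uncorrelated, apart from transposed positions and from pairs on the diagonal
(`integral_norm_sq_array_le`). Each entry has mean square `O(1 / K)`: on the diagonal by the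
concentration above, off the diagonal because the rows of `B` have norm at most one and the columns
are exchangeable. By exchangeability the correlation of two diagonal entries can be read off from
the mean square of `tr (B - ζ₀)`, which is `O(1)`; so it is `O(K⁻²)` (`abs_integral_bDiag_mul_le`).
Together these give the bound for `tr A (B - ζ₀)` (`integral_norm_trace_mul_bDev_sq_le`).

The growth regime enters only through the boundedness of `n / K`, `N / K` and `K |N / K - c|`.
-/


namespace MIMO

noncomputable section

open ComplexConjugate
open scoped ComplexOrder

/-! ### Variance and independent resampling on finite product spaces -/

section ProductSpaces

variable {Ω : Type*} [MeasurableSpace Ω]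

/-- The decomposition of a second moment about `a` into the variance and the squared bias. -/
lemma integral_sub_sq {μ : Measure Ω} [IsProbabilityMeasure μ] {f : Ω → ℝ} (hf : MemLp f 2 μ)
    (a : ℝ) :
    ∫ x, (f x - a) ^ 2 ∂μ = ∫ x, (f x - ∫ y, f y ∂μ) ^ 2 ∂μ + (∫ y, f y ∂μ - a) ^ 2 := by
  set m := ∫ y, f y ∂μ with hm
  have h1 : Integrable f μ := hf.integrable (by norm_num)
  have h2 : Integrable (fun x => (f x - m) ^ 2) μ := (hf.sub (memLp_const m)).integrable_sq
  have h3 : Integrable (fun x => 2 * (m - a) * (f x - m)) μ :=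
    (h1.sub (integrable_const m)).const_mul _
  have h5 : Integrable (fun x => 2 * (m - a) * (f x - m) + (m - a) ^ 2) μ :=
    h3.add (integrable_const _)
  have h4 : ∫ x, (f x - m) ∂μ = 0 := by
    rw [integral_sub h1 (integrable_const m)]; simp [hm]
  calc ∫ x, (f x - a) ^ 2 ∂μ
      = ∫ x, ((f x - m) ^ 2 + (2 * (m - a) * (f x - m) + (m - a) ^ 2)) ∂μ := by
        congr 1; ext x; ring
    _ = _ := by
        rw [integral_add h2 h5,
          integral_add h3 (integrable_const _), integral_const_mul, h4]
        simp

lemma sq_integral_le {μ : Measure Ω} [IsProbabilityMeasure μ] {f : Ω → ℝ} (hf : MemLp f 2 μ) :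
    (∫ x, f x ∂μ) ^ 2 ≤ ∫ x, f x ^ 2 ∂μ := by
  have h := integral_sub_sq hf 0
  simp only [sub_zero] at h
  rw [h]
  have : 0 ≤ ∫ x, (f x - ∫ y, f y ∂μ) ^ 2 ∂μ := integral_nonneg fun x => sq_nonneg _
  linarith

/-- Replacing one coordinate of an i.i.d. family by an independent copy does not change the law. -/
lemma measurePreserving_resample {ι : Type*} [Fintype ι] [DecidableEq ι] (γ : Measure Ω)
    [IsProbabilityMeasure γ] (k : ι) :
    MeasurePreserving (fun p : (ι → Ω) × Ω => Function.update p.1 k p.2)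
      ((Measure.pi fun _ : ι => γ).prod γ) (Measure.pi fun _ : ι => γ) := by
  have hmeas : Measurable (fun p : (ι → Ω) × Ω => Function.update p.1 k p.2) := by
    refine measurable_pi_iff.mpr fun i => ?_
    by_cases h : i = k
    · subst h; simpa using measurable_snd
    · simp only [Function.update_of_ne h]; fun_prop
  refine ⟨hmeas, (Measure.pi_eq fun s hs => ?_).symm⟩
  rw [Measure.map_apply hmeas (MeasurableSet.univ_pi hs)]
  have : (fun p : (ι → Ω) × Ω => Function.update p.1 k p.2) ⁻¹' (Set.univ.pi s)
      = (Set.univ.pi (Function.update s k Set.univ)) ×ˢ s k := by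
    ext ⟨h, y⟩
    simp only [Set.mem_preimage, Set.mem_pi, Set.mem_univ, true_implies, Set.mem_prod]
    constructor
    · intro H
      refine ⟨fun i => ?_, by simpa using H k⟩
      by_cases hi : i = k
      · subst hi; simp
      · simpa [hi] using H i
    · rintro ⟨H1, H2⟩ i
      by_cases hi : i = k
      · subst hi; simpa using H2
      · simpa [hi] using H1 i
  rw [this, Measure.prod_prod, Measure.pi_pi,
    ← Finset.mul_prod_erase Finset.univ (fun i => γ (s i)) (Finset.mem_univ k),
    ← Finset.mul_prod_erase Finset.univ _ (Finset.mem_univ k), mul_comm]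
  simp only [Function.update_self, measure_univ, one_mul]
  congr 1
  refine Finset.prod_congr rfl fun i hi => ?_
  rw [Function.update_of_ne (Finset.ne_of_mem_erase hi)]

/-- A bound on the conditional mean given all coordinates but one is a bound on the mean. -/
lemma integral_le_of_resample {ι : Type*} [Fintype ι] [DecidableEq ι] {γ : Measure Ω}
    [IsProbabilityMeasure γ] (k : ι) {F : (ι → Ω) → ℝ}
    (hF : Integrable F (Measure.pi fun _ : ι => γ)) {b : ℝ}
    (hb : ∀ h : ι → Ω, ∫ y, F (Function.update h k y) ∂γ ≤ b) :
    ∫ h, F h ∂(Measure.pi fun _ : ι => γ) ≤ b := by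
  have hmp := measurePreserving_resample γ k
  have hF' : Integrable (fun p : (ι → Ω) × Ω => F (Function.update p.1 k p.2))
      ((Measure.pi fun _ : ι => γ).prod γ) := hmp.integrable_comp_of_integrable hF
  have : ∫ h, F h ∂(Measure.pi fun _ : ι => γ)
      = ∫ p : (ι → Ω) × Ω, F (Function.update p.1 k p.2)
        ∂((Measure.pi fun _ : ι => γ).prod γ) := by
    have h := integral_map (f := F) hmp.measurable.aemeasurable
      (by rw [hmp.map_eq]; exact hF.aestronglyMeasurable)
    rwa [hmp.map_eq] at h
  rw [this, integral_prod _ hF']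
  calc _ ≤ ∫ _ : ι → Ω, b ∂(Measure.pi fun _ : ι => γ) :=
        integral_mono hF'.integral_prod_left (integrable_const b) hb
    _ = b := by simp

lemma abs_integral_le_of_resample {ι : Type*} [Fintype ι] [DecidableEq ι] {γ : Measure Ω}
    [IsProbabilityMeasure γ] (k : ι) {F : (ι → Ω) → ℝ}
    (hF : Integrable F (Measure.pi fun _ : ι => γ)) {b : ℝ}
    (hb : ∀ h : ι → Ω, |∫ y, F (Function.update h k y) ∂γ| ≤ b) :
    |∫ h, F h ∂(Measure.pi fun _ : ι => γ)| ≤ b := by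
  refine abs_le'.2 ⟨integral_le_of_resample k hF fun h => (le_abs_self _).trans (hb h), ?_⟩
  rw [← integral_neg]
  refine integral_le_of_resample k hF.neg fun h => ?_
  simp only [Pi.neg_apply, integral_neg]
  exact (neg_le_abs _).trans (hb h)

/-- A nonnegative function whose conditional means given all coordinates but one are finite and
bounded is integrable. -/
lemma integrable_of_resample {ι : Type*} [Fintype ι] [DecidableEq ι] {γ : Measure Ω}
    [IsProbabilityMeasure γ] (k : ι) {F : (ι → Ω) → ℝ} (hF : Measurable F) (h0 : ∀ h, 0 ≤ F h)
    (hi : ∀ h : ι → Ω, Integrable (fun y => F (Function.update h k y)) γ) {b : ℝ}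
    (hb : ∀ h : ι → Ω, ∫ y, F (Function.update h k y) ∂γ ≤ b) :
    Integrable F (Measure.pi fun _ : ι => γ) := by
  have hmp := measurePreserving_resample γ k
  rw [← hmp.integrable_comp hF.aestronglyMeasurable,
    integrable_prod_iff (hF.comp hmp.measurable).aestronglyMeasurable]
  refine ⟨Eventually.of_forall hi, ?_⟩
  refine Integrable.mono' (integrable_const b)
    (hF.comp hmp.measurable).norm.stronglyMeasurable.integral_prod_right.aestronglyMeasurable
    (Eventually.of_forall fun h => ?_)
  rw [Real.norm_of_nonneg (integral_nonneg fun y => norm_nonneg _)]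
  simp only [Function.comp, Real.norm_of_nonneg (h0 _)]
  exact hb h

/-- The **Efron–Stein inequality**: the variance of a function of independent variables is at most
the sum over the coordinates of the mean squared distances to functions that do not depend on that
coordinate. -/
theorem efronStein (γ : Measure Ω) [IsProbabilityMeasure γ] : ∀ (n : ℕ) (f : (Fin n → Ω) → ℝ)
    (g : Fin n → (Fin n → Ω) → ℝ), MemLp f 2 (Measure.pi fun _ : Fin n => γ) →
    (∀ k, MemLp (fun h => f h - g k h) 2 (Measure.pi fun _ : Fin n => γ)) →
    (∀ k h y, g k (Function.update h k y) = g k h) →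
    ∫ h, (f h - ∫ h', f h' ∂(Measure.pi fun _ : Fin n => γ)) ^ 2 ∂(Measure.pi fun _ : Fin n => γ)
      ≤ ∑ k, ∫ h, (f h - g k h) ^ 2 ∂(Measure.pi fun _ : Fin n => γ) := by
  intro n
  induction n with
  | zero =>
    intro f g hf hg hk
    have : ∀ h : Fin 0 → Ω, f h = f default := fun h => by rw [Subsingleton.elim h default]
    simp only [Finset.univ_eq_empty, Finset.sum_empty]
    rw [integral_congr_ae (Eventually.of_forall this)]
    refine le_of_eq ?_
    rw [show (fun h => (f h - ∫ _ : Fin 0 → Ω, f default ∂(Measure.pi fun _ : Fin 0 => γ)) ^ 2)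
      = fun _ => 0 from ?_]
    · simp
    · ext h; simp [this h]
  | succ n ih =>
    intro f g hf hg hk
    set ν : Measure (Fin n → Ω) := Measure.pi fun _ => γ with hν
    have hmp : MeasurePreserving (fun p : Ω × (Fin n → Ω) => (Fin.cons p.1 p.2 : Fin (n + 1) → Ω))
        (γ.prod ν) (Measure.pi fun _ : Fin (n + 1) => γ) := by
      have h := (measurePreserving_piFinSuccAbove (fun _ : Fin (n + 1) => γ) 0).symm
      convert h using 1
      ext p : 1
      simp [MeasurableEquiv.piFinSuccAbove, Fin.insertNthEquiv]
    have hemb : MeasurableEmbedding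
        (fun p : Ω × (Fin n → Ω) => (Fin.cons p.1 p.2 : Fin (n + 1) → Ω)) := by
      have h :=
        (MeasurableEquiv.piFinSuccAbove (fun _ : Fin (n + 1) => Ω) 0).symm.measurableEmbedding
      convert h using 1
      ext p : 1
      simp [MeasurableEquiv.piFinSuccAbove, Fin.insertNthEquiv]
    set F : Ω × (Fin n → Ω) → ℝ := fun p => f (Fin.cons p.1 p.2) with hF
    set D : Fin (n + 1) → Ω × (Fin n → Ω) → ℝ :=
      fun k p => f (Fin.cons p.1 p.2) - g k (Fin.cons p.1 p.2) with hD
    have hF2 : MemLp F 2 (γ.prod ν) := hf.comp_measurePreserving hmp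
    have hD2 : ∀ k, MemLp (D k) 2 (γ.prod ν) := fun k => (hg k).comp_measurePreserving hmp
    obtain ⟨x₀⟩ : Nonempty Ω := nonempty_of_isProbabilityMeasure γ
    -- the comparison function for the first coordinate depends on the others only
    set G : (Fin n → Ω) → ℝ := fun y => g 0 (Fin.cons x₀ y) with hG
    have hg0 : ∀ x y, g 0 (Fin.cons x y) = G y := by
      intro x y
      have := hk 0 (Fin.cons x₀ y) x
      rw [Fin.update_cons_zero] at this
      exact this
    set a := ∫ y, G y ∂ν with ha
    have hsec : ∀ u : Ω × (Fin n → Ω) → ℝ, MemLp u 2 (γ.prod ν) →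
        ∀ᵐ x ∂γ, MemLp (fun y => u (x, y)) 2 ν := by
      intro u hu
      filter_upwards [hu.integrable_sq.prod_right_ae, hu.aestronglyMeasurable.prodMk_left]
        with x h1 h2
      exact (memLp_two_iff_integrable_sq h2).2 h1
    -- for a fixed first coordinate, the variance in the others is bounded by induction and the
    -- squared bias about `a` by the distance to the comparison function `g 0`
    have hpt : ∀ᵐ x ∂γ, ∫ y, (F (x, y) - a) ^ 2 ∂ν ≤ ∑ k, ∫ y, (D k (x, y)) ^ 2 ∂ν := by
      filter_upwards [hsec F hF2, ae_all_iff.2 fun k => hsec (D k) (hD2 k)] with x hx hDx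
      have h1 := ih (fun y => F (x, y)) (fun k y => g k.succ (Fin.cons x y)) hx
        (fun k => hDx k.succ) (fun k y z => by
          rw [← hk k.succ (Fin.cons x y) z, Fin.cons_update])
      rw [integral_sub_sq hx, Fin.sum_univ_succ, add_comm]
      refine add_le_add ?_ h1
      have h2 : ∫ y, F (x, y) ∂ν - a = ∫ y, D 0 (x, y) ∂ν := by
        have hGi : Integrable G ν := by
          have := (hx.sub (hDx 0)).integrable (by norm_num)
          refine this.congr (Eventually.of_forall fun y => ?_)
          simp only [Pi.sub_apply, hF, hD, hg0]; ring
        rw [ha, ← integral_sub (hx.integrable (by norm_num)) hGi]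
        simp only [hF, hD, hg0]
      rw [h2]
      exact sq_integral_le (hDx 0)
    have hint : ∀ u : (Fin (n + 1) → Ω) → ℝ, ∫ h, u h ∂(Measure.pi fun _ : Fin (n + 1) => γ)
        = ∫ p : Ω × (Fin n → Ω), u (Fin.cons p.1 p.2) ∂(γ.prod ν) := fun u =>
      (hmp.integral_comp hemb u).symm
    have hFa : Integrable (fun p => (F p - a) ^ 2) (γ.prod ν) :=
      (hF2.sub (memLp_const a)).integrable_sq
    calc _ ≤ ∫ h, (f h - a) ^ 2 ∂(Measure.pi fun _ : Fin (n + 1) => γ) := by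
          rw [integral_sub_sq hf a]; linarith [sq_nonneg
            (∫ h', f h' ∂(Measure.pi fun _ : Fin (n + 1) => γ) - a)]
      _ = ∫ x, ∫ y, (F (x, y) - a) ^ 2 ∂ν ∂γ := by
          rw [hint, integral_prod _ hFa]
      _ ≤ ∫ x, ∑ k, ∫ y, (D k (x, y)) ^ 2 ∂ν ∂γ :=
          integral_mono_ae hFa.integral_prod_left
            (integrable_finsetSum _ fun k _ => (hD2 k).integrable_sq.integral_prod_left) hpt
      _ = _ := by
          rw [integral_finsetSum _ fun k _ => (hD2 k).integrable_sq.integral_prod_left]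
          refine Finset.sum_congr rfl fun k _ => ?_
          rw [hint, integral_prod _ (hD2 k).integrable_sq]

/-- The form of the Efron–Stein inequality used below: the squared distances are bounded after
averaging over the resampled coordinate alone. -/
theorem efronStein_of_resample (γ : Measure Ω) [IsProbabilityMeasure γ] {n : ℕ}
    {f : (Fin n → Ω) → ℝ} {g : Fin n → (Fin n → Ω) → ℝ} (hf : Measurable f)
    (hf2 : MemLp f 2 (Measure.pi fun _ : Fin n => γ)) (hgm : ∀ k, Measurable (g k))
    (hg : ∀ k h y, g k (Function.update h k y) = g k h) {b : ℝ}
    (hi : ∀ k h, Integrable (fun y => (f (Function.update h k y) - g k h) ^ 2) γ)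
    (hb : ∀ k h, ∫ y, (f (Function.update h k y) - g k h) ^ 2 ∂γ ≤ b) :
    ∫ h, (f h - ∫ h', f h' ∂(Measure.pi fun _ : Fin n => γ)) ^ 2 ∂(Measure.pi fun _ : Fin n => γ)
      ≤ n * b := by
  have hI : ∀ k, Integrable (fun h => (f h - g k h) ^ 2) (Measure.pi fun _ : Fin n => γ) := by
    intro k
    refine integrable_of_resample k ((hf.sub (hgm k)).pow_const 2) (fun h => sq_nonneg _)
      (fun h => ?_) (b := b) (fun h => ?_)
    · simpa only [hg] using hi k h
    · simpa only [hg] using hb k h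
  refine (efronStein γ n f g hf2 (fun k => ?_) hg).trans ?_
  · exact (memLp_two_iff_integrable_sq (hf.sub (hgm k)).aestronglyMeasurable).2 (hI k)
  · calc _ ≤ ∑ _k : Fin n, b := Finset.sum_le_sum fun k _ =>
          integral_le_of_resample k (hI k) fun h => by simpa only [hg] using hb k h
      _ = n * b := by simp

/-- The law of an i.i.d. family with a symmetric marginal is invariant under a change of sign of
one coordinate. -/
lemma measurePreserving_flip {ι : Type*} [Fintype ι] [DecidableEq ι] [Neg Ω] [MeasurableNeg Ω]
    {γ : Measure Ω} [IsProbabilityMeasure γ] (hγ : γ.map (fun y => -y) = γ) (k : ι) :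
    MeasurePreserving (fun h : ι → Ω => fun i => if i = k then -h i else h i)
      (Measure.pi fun _ : ι => γ) (Measure.pi fun _ : ι => γ) := by
  refine measurePreserving_pi (fun _ => γ) (fun _ => γ)
    (f := fun i y => if i = k then -y else y) fun i => ?_
  by_cases hi : i = k
  · simpa [hi] using (⟨measurable_neg, hγ⟩ : MeasurePreserving (fun y : Ω => -y) γ γ)
  · simp only [hi, if_false]; exact MeasurePreserving.id γ

/-- A function that is odd in one coordinate has mean zero under a symmetric i.i.d. law. -/
lemma integral_eq_zero_of_flip {E : Type*} [NormedAddCommGroup E] [NormedSpace ℝ E]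
    {ι : Type*} [Fintype ι] [DecidableEq ι] [InvolutiveNeg Ω]
    [MeasurableNeg Ω] {γ : Measure Ω} [IsProbabilityMeasure γ] (hγ : γ.map (fun y => -y) = γ)
    (k : ι) {F : (ι → Ω) → E}
    (hF : ∀ h, F (fun i => if i = k then -h i else h i) = -F h) :
    ∫ h, F h ∂(Measure.pi fun _ : ι => γ) = 0 := by
  have hmp := measurePreserving_flip hγ k
  have hinv : Function.Involutive (fun h : ι → Ω => fun i => if i = k then -h i else h i) := by
    intro h; ext i; by_cases hi : i = k <;> simp [hi]
  have hemb : MeasurableEmbedding (fun h : ι → Ω => fun i => if i = k then -h i else h i) :=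
    (MeasurableEquiv.mk hinv.toPerm hmp.measurable hmp.measurable).measurableEmbedding
  have h := hmp.integral_comp hemb F
  simp only [hF, integral_neg] at h
  set I := ∫ h, F h ∂(Measure.pi fun _ : ι => γ)
  have h2 : (2 : ℝ) • I = 0 := by
    rw [two_smul]
    nth_rewrite 1 [← h]
    exact neg_add_cancel I
  exact (smul_eq_zero.1 h2).resolve_left two_ne_zero

lemma integral_comp_perm {E : Type*} [NormedAddCommGroup E] [NormedSpace ℝ E]
    {ι : Type*} [Fintype ι] (γ : Measure Ω) [IsProbabilityMeasure γ] (e : ι ≃ ι)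
    (F : (ι → Ω) → E) :
    ∫ h, F (fun i => h (e i)) ∂(Measure.pi fun _ : ι => γ)
      = ∫ h, F h ∂(Measure.pi fun _ : ι => γ) := by
  have h := (measurePreserving_piCongrLeft (fun _ : ι => γ) e.symm)
  have h2 := h.integral_comp (MeasurableEquiv.measurableEmbedding _) F
  rw [← h2]
  congr 1; ext g; congr 1; ext i
  have := MeasurableEquiv.piCongrLeft_apply_apply (β := fun _ => Ω) e.symm g (e i)
  simpa using this.symm

/-- Exchanging rows and columns preserves the law of an array with i.i.d. entries. -/
lemma measurePreserving_swap_pi {ι κ : Type*} [Fintype ι] [Fintype κ] (γ : Measure Ω)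
    [IsProbabilityMeasure γ] :
    MeasurePreserving (fun (h : ι → κ → Ω) k i => h i k)
      (Measure.pi fun _ : ι => Measure.pi fun _ : κ => γ)
      (Measure.pi fun _ : κ => Measure.pi fun _ : ι => γ) := by
  have hmeas : Measurable (fun (h : ι → κ → Ω) k i => h i k) := by fun_prop
  refine ⟨hmeas, (Measure.pi_eq_generateFrom
    (C := fun _ : κ =>
      Set.pi Set.univ '' Set.pi Set.univ fun _ : ι => {s : Set Ω | MeasurableSet s})
    (fun _ => generateFrom_pi) (fun _ => isPiSystem_pi)
    (fun _ => ?_) fun s hs => ?_).symm⟩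
  · refine ⟨fun _ => Set.univ, fun _ => ⟨fun _ => Set.univ, by simp, by simp⟩, fun _ => by simp,
      by simp [Set.iUnion_const]⟩
  · choose t ht hts using hs
    have hts' : ∀ k, s k = Set.univ.pi (t k) := fun k => (hts k).symm
    rw [Measure.map_apply hmeas (MeasurableSet.univ_pi fun k => by
      rw [hts' k]; exact MeasurableSet.univ_pi fun i => ht k i (Set.mem_univ _))]
    have : (fun (h : ι → κ → Ω) k i => h i k) ⁻¹' (Set.univ.pi s)
        = Set.univ.pi fun i => Set.univ.pi fun k => t k i := by
      ext h
      simp only [Set.mem_preimage, Set.mem_pi, Set.mem_univ, true_implies, hts']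
      exact forall_comm
    rw [this, Measure.pi_pi]
    simp only [Measure.pi_pi, hts']
    exact Finset.prod_comm

end ProductSpaces

/-! ### Second moments of sign-equivariant arrays -/

section Arrays

variable {Ω : Type*} [MeasurableSpace Ω]

/-- If the array `ξ i j` changes sign exactly like `x i * x j` when one input is negated, then
`𝔼 ξᵢⱼ conj ξₖₗ` vanishes unless every index value occurs an even number of times among
`i, j, k, l`. -/
lemma integral_mul_conj_eq_zero_of_equivariant {ι : Type*} [Fintype ι] [DecidableEq ι]
    [InvolutiveNeg Ω] [MeasurableNeg Ω] {γ : Measure Ω} [IsProbabilityMeasure γ]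
    (hγ : γ.map (fun y => -y) = γ) {ξ : ι → ι → (ι → Ω) → ℂ}
    (hflip : ∀ m h i j, ξ i j (fun i => if i = m then -h i else h i)
      = (if i = m then -1 else 1) * (if j = m then -1 else 1) * ξ i j h)
    {i j k l : ι} (h1 : ¬ (i = k ∧ j = l)) (h2 : ¬ (i = l ∧ j = k)) (h3 : ¬ (i = j ∧ k = l)) :
    ∫ h, ξ i j h * conj (ξ k l h) ∂(Measure.pi fun _ : ι => γ) = 0 := by
  -- a coordinate that occurs an odd number of times among the four indices
  obtain ⟨m, hm⟩ : ∃ m : ι, ((if i = m then -1 else 1) * (if j = m then -1 else 1) *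
      ((if k = m then -1 else 1) * (if l = m then -1 else 1)) : ℂ) = -1 := by
    by_cases hij : i = j
    · subst hij
      by_cases hki : k = i
      · subst hki
        have hl : l ≠ k := fun e => h3 ⟨rfl, e.symm⟩
        exact ⟨l, by simp [hl.symm]⟩
      · have hkl : k ≠ l := fun e => h3 ⟨rfl, e⟩
        exact ⟨k, by simp [Ne.symm hki, hkl.symm]⟩
    · by_cases hik : i = k
      · subst hik
        have hjl : j ≠ l := fun e => h1 ⟨rfl, e⟩
        exact ⟨j, by simp [hij, hjl.symm]⟩
      · by_cases hil : i = l
        · subst hil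
          have hjk : j ≠ k := fun e => h2 ⟨rfl, e⟩
          exact ⟨j, by simp [hij, hjk.symm]⟩
        · exact ⟨i, by simp [Ne.symm hij, Ne.symm hik, Ne.symm hil]⟩
  refine integral_eq_zero_of_flip hγ m fun h => ?_
  rw [hflip, hflip, map_mul, map_mul]
  have e : ∀ a : ι, conj (if a = m then -1 else 1 : ℂ) = if a = m then -1 else 1 := by
    intro a; split_ifs <;> simp
  rw [e, e]
  linear_combination (ξ i j h * conj (ξ k l h)) * hm

/-- The mean square of a linear combination of random variables is controlled by the matrix of
their mixed second moments. -/
lemma integral_norm_sq_sum_le {μ : Measure Ω} {α : Type*} [Fintype α] {ξ : α → Ω → ℂ}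
    (hξ : ∀ p, MemLp (ξ p) 2 μ) (A : α → ℂ) :
    ∫ ω, ‖∑ p, A p * ξ p ω‖ ^ 2 ∂μ
      ≤ ∑ p, ∑ q, ‖A p‖ * ‖A q‖ * ‖∫ ω, ξ p ω * conj (ξ q ω) ∂μ‖ := by
  have hI : ∀ p q, Integrable (fun ω => ξ p ω * conj (ξ q ω)) μ := fun p q =>
    (hξ p).integrable_mul (hξ q).star
  have key : ((∫ ω, ‖∑ p, A p * ξ p ω‖ ^ 2 ∂μ : ℝ) : ℂ)
      = ∑ p, ∑ q, (A p * conj (A q)) * ∫ ω, ξ p ω * conj (ξ q ω) ∂μ := by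
    rw [← integral_complex_ofReal]
    have : ∀ ω, ((‖∑ p, A p * ξ p ω‖ ^ 2 : ℝ) : ℂ)
        = ∑ p, ∑ q, (A p * conj (A q)) * (ξ p ω * conj (ξ q ω)) := by
      intro ω
      rw [Complex.ofReal_pow, ← Complex.mul_conj', map_sum, Finset.sum_mul_sum]
      refine Finset.sum_congr rfl fun p _ => Finset.sum_congr rfl fun q _ => ?_
      rw [map_mul]; ring
    rw [integral_congr_ae (Eventually.of_forall this), integral_finsetSum _ fun p _ =>
      integrable_finsetSum _ fun q _ => (hI p q).const_mul _]
    refine Finset.sum_congr rfl fun p _ => ?_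
    rw [integral_finsetSum _ fun q _ => (hI p q).const_mul _]
    exact Finset.sum_congr rfl fun q _ => integral_const_mul _ _
  have h0 : 0 ≤ ∫ ω, ‖∑ p, A p * ξ p ω‖ ^ 2 ∂μ := integral_nonneg fun ω => by positivity
  rw [← Complex.norm_of_nonneg h0, key]
  refine (norm_sum_le _ _).trans (Finset.sum_le_sum fun p _ => (norm_sum_le _ _).trans
    (Finset.sum_le_sum fun q _ => ?_))
  simp

/-- Sign-equivariance makes an array nearly orthogonal, so that a linear combination of its entries
has a mean square of the order of the squared Frobenius norm of the coefficients. Only the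
correlation `θ` of distinct diagonal entries is left to be estimated separately. -/
lemma integral_norm_sq_array_le {ι : Type*} [Fintype ι] [DecidableEq ι]
    [InvolutiveNeg Ω] [MeasurableNeg Ω] {γ : Measure Ω} [IsProbabilityMeasure γ]
    (hγ : γ.map (fun y => -y) = γ) {ξ : ι → ι → (ι → Ω) → ℂ}
    (hflip : ∀ m h i j, ξ i j (fun i => if i = m then -h i else h i)
      = (if i = m then -1 else 1) * (if j = m then -1 else 1) * ξ i j h)
    (hξ : ∀ i j, MemLp (ξ i j) 2 (Measure.pi fun _ : ι => γ)) {ρ θ : ℝ} (hθ : 0 ≤ θ)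
    (hρ : ∀ i j, ∫ h, ‖ξ i j h‖ ^ 2 ∂(Measure.pi fun _ : ι => γ) ≤ ρ)
    (hd : ∀ i k, i ≠ k → ‖∫ h, ξ i i h * conj (ξ k k h) ∂(Measure.pi fun _ : ι => γ)‖ ≤ θ)
    (A : ι → ι → ℂ) :
    ∫ h, ‖∑ i, ∑ j, A i j * ξ i j h‖ ^ 2 ∂(Measure.pi fun _ : ι => γ)
      ≤ 2 * ρ * (∑ i, ∑ j, ‖A i j‖ ^ 2) + θ * (∑ i, ‖A i i‖) ^ 2 := by
  set μ := Measure.pi fun _ : ι => γ with hμ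
  have hsq : ∀ i j, Integrable (fun h => ‖ξ i j h‖ ^ 2) μ :=
    fun i j => (hξ i j).norm.integrable_sq
  have hcs : ∀ i j k l, ‖∫ h, ξ i j h * conj (ξ k l h) ∂μ‖ ≤ ρ := by
    intro i j k l
    calc ‖∫ h, ξ i j h * conj (ξ k l h) ∂μ‖
        ≤ ∫ h, ‖ξ i j h * conj (ξ k l h)‖ ∂μ := norm_integral_le_integral_norm _
      _ ≤ ∫ h, (1 / 2 * ‖ξ i j h‖ ^ 2 + 1 / 2 * ‖ξ k l h‖ ^ 2) ∂μ := by
          refine integral_mono ((hξ i j).integrable_mul (hξ k l).star).norm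
            (((hsq i j).const_mul _).add ((hsq k l).const_mul _)) fun h => ?_
          simp only [norm_mul, RCLike.norm_conj]
          nlinarith [sq_nonneg (‖ξ i j h‖ - ‖ξ k l h‖)]
      _ ≤ ρ := by
          rw [integral_add ((hsq i j).const_mul _) ((hsq k l).const_mul _), integral_const_mul,
            integral_const_mul]
          linarith [hρ i j, hρ k l]
  -- a pair is correlated only with itself, with the swapped pair, or diagonal with diagonal
  have hb : ∀ p q : ι × ι, ‖∫ h, ξ p.1 p.2 h * conj (ξ q.1 q.2 h) ∂μ‖
      ≤ (if p = q then ρ else 0) + (if p = q.swap then ρ else 0)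
        + (if p.1 = p.2 then 1 else 0) * (if q.1 = q.2 then 1 else 0) * θ := by
    rintro ⟨i, j⟩ ⟨k, l⟩
    have hρ0 : 0 ≤ ρ := (integral_nonneg fun h => by positivity).trans (hρ i j)
    have hn1 : (0 : ℝ) ≤ if (i, j) = (k, l) then ρ else 0 := by split_ifs <;> simp [hρ0]
    have hn2 : (0 : ℝ) ≤ if (i, j) = (k, l).swap then ρ else 0 := by split_ifs <;> simp [hρ0]
    have hn3 : (0 : ℝ) ≤ (if i = j then 1 else 0) * (if k = l then 1 else 0) * θ := by
      split_ifs <;> simp [hθ]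
    by_cases h1 : i = k ∧ j = l
    · have := hcs i j k l
      rw [if_pos (by simp [h1] : (i, j) = (k, l))]
      simp only at *; linarith
    · by_cases h2 : i = l ∧ j = k
      · have := hcs i j k l
        rw [if_pos (by simp [h2] : (i, j) = (k, l).swap)]
        simp only at *; linarith
      · by_cases h3 : i = j ∧ k = l
        · obtain ⟨rfl, rfl⟩ := h3
          have := hd i k (fun e => h1 ⟨e, e⟩)
          simp only [if_true, one_mul] at *; linarith
        · have := integral_mul_conj_eq_zero_of_equivariant hγ hflip h1 h2 h3
          simp only at *
          rw [this, norm_zero]; linarith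
  have hsum : ∀ h, ∑ i, ∑ j, A i j * ξ i j h = ∑ p : ι × ι, A p.1 p.2 * ξ p.1 p.2 h := fun h =>
    (Fintype.sum_prod_type' (fun i j => A i j * ξ i j h)).symm
  simp only [hsum]
  refine (integral_norm_sq_sum_le (fun p : ι × ι => hξ p.1 p.2) fun p => A p.1 p.2).trans ?_
  have hρ0 : Nonempty (ι × ι) → 0 ≤ ρ := fun ⟨p⟩ =>
    (integral_nonneg fun h => by positivity).trans (hρ p.1 p.2)
  calc _ ≤ ∑ p : ι × ι, ∑ q : ι × ι, ‖A p.1 p.2‖ * ‖A q.1 q.2‖ *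
        ((if p = q then ρ else 0) + (if p = q.swap then ρ else 0)
        + (if p.1 = p.2 then 1 else 0) * (if q.1 = q.2 then 1 else 0) * θ) := by
        gcongr with p _ q _
        exact hb p q
    _ = ρ * ∑ p : ι × ι, ‖A p.1 p.2‖ ^ 2 + ρ * ∑ p : ι × ι, ‖A p.1 p.2‖ * ‖A p.2 p.1‖
        + θ * (∑ i, ‖A i i‖) ^ 2 := by
        simp only [mul_add, Finset.sum_add_distrib]
        congr 1
        · congr 1
          · rw [Finset.mul_sum]
            refine Finset.sum_congr rfl fun p _ => ?_
            simp only [mul_ite, mul_zero, Finset.sum_ite_eq, Finset.mem_univ, if_true]; ring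
          · rw [Finset.mul_sum]
            refine Finset.sum_congr rfl fun p _ => ?_
            have : ∀ q : ι × ι, (p = q.swap) = (p.swap = q) := fun q => by
              rw [eq_iff_iff]; constructor <;> (rintro rfl; simp)
            simp only [this, mul_ite, mul_zero, Finset.sum_ite_eq, Finset.mem_univ, if_true,
              Prod.fst_swap, Prod.snd_swap]; ring
        · have hdiag : ∑ i, ‖A i i‖ = ∑ p : ι × ι, if p.1 = p.2 then ‖A p.1 p.2‖ else 0 := by
            rw [Fintype.sum_prod_type]
            exact Finset.sum_congr rfl fun i _ => by simp
          rw [hdiag, sq, Finset.sum_mul_sum, Finset.mul_sum]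
          refine Finset.sum_congr rfl fun p _ => ?_
          rw [Finset.mul_sum]
          refine Finset.sum_congr rfl fun q _ => ?_
          split_ifs <;> simp; ring
    _ ≤ _ := by
        rcases isEmpty_or_nonempty (ι × ι) with he | hne
        · have : IsEmpty ι := by
            by_contra hc; rw [not_isEmpty_iff] at hc; obtain ⟨i⟩ := hc; exact he.elim (i, i)
          simp
        have h5 : ∑ p : ι × ι, ‖A p.1 p.2‖ * ‖A p.2 p.1‖ ≤ ∑ p : ι × ι, ‖A p.1 p.2‖ ^ 2 := by
          have hsw : ∑ p : ι × ι, ‖A p.2 p.1‖ ^ 2 = ∑ p : ι × ι, ‖A p.1 p.2‖ ^ 2 :=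
            Fintype.sum_equiv (Equiv.prodComm ι ι) _ _ fun p => rfl
          calc _ ≤ ∑ p : ι × ι, (1 / 2 * ‖A p.1 p.2‖ ^ 2 + 1 / 2 * ‖A p.2 p.1‖ ^ 2) :=
                Finset.sum_le_sum fun p _ => by
                  nlinarith [sq_nonneg (‖A p.1 p.2‖ - ‖A p.2 p.1‖)]
            _ = _ := by rw [Finset.sum_add_distrib, ← Finset.mul_sum, ← Finset.mul_sum, hsw]; ring
        rw [← Fintype.sum_prod_type' (fun i j => ‖A i j‖ ^ 2)]
        nlinarith [mul_le_mul_of_nonneg_left h5 (hρ0 hne)]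

end Arrays

/-! ### Moments of the complex normal law and of quadratic forms -/

instance : IsProbabilityMeasure complexNormal := by
  unfold complexNormal
  exact Measure.isProbabilityMeasure_map (by fun_prop)

lemma complexNormal_map_neg : complexNormal.map (fun y => -y) = complexNormal := by
  have hmp : MeasurePreserving (fun x : ℝ => -x) (gaussianReal 0 (1 / 2))
      (gaussianReal 0 (1 / 2)) :=
    ⟨measurable_neg, by rw [gaussianReal_map_neg, neg_zero]⟩
  unfold complexNormal
  rw [Measure.map_map (by fun_prop) (by fun_prop)]
  conv_rhs => rw [← (hmp.prod hmp).map_eq]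
  rw [Measure.map_map (by fun_prop) (by fun_prop)]
  congr 1
  ext p
  simp [Prod.map]
  ring

lemma memLp_complexNormal : MemLp (fun z : ℂ => z) 4 complexNormal := by
  have h : MemLp (fun x : ℝ => (x : ℂ)) 4 (gaussianReal 0 (1 / 2)) :=
    (memLp_id_gaussianReal' 4 (by norm_num)).ofReal
  unfold complexNormal
  refine (memLp_map_measure_iff (by fun_prop) (by fun_prop)).2 ?_
  refine MemLp.add (f := fun p : ℝ × ℝ => (p.1 : ℂ)) (g := fun p : ℝ × ℝ => (p.2 : ℂ) * Complex.I)
    (h.comp_measurePreserving measurePreserving_fst) ?_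
  have := (h.comp_measurePreserving
    (measurePreserving_snd (μ := gaussianReal 0 (1 / 2)) (ν := gaussianReal 0 (1 / 2)))).mul_const
    Complex.I
  exact this

lemma integral_norm_sq_complexNormal : ∫ z, ‖z‖ ^ 2 ∂complexNormal = 1 := by
  have hm : MemLp (fun x : ℝ => x) 2 (gaussianReal 0 (1 / 2)) :=
    memLp_id_gaussianReal' 2 (by norm_num)
  have hv : ∫ x, x ^ 2 ∂(gaussianReal 0 (1 / 2)) = 1 / 2 := by
    have h := integral_sub_sq hm 0
    have h2 := variance_fun_id_gaussianReal (μ := 0) (v := 1 / 2)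
    rw [variance_eq_integral (by fun_prop)] at h2
    simp only [integral_id_gaussianReal] at h h2
    simpa using h2
  unfold complexNormal
  rw [integral_map (by fun_prop) (by fun_prop)]
  have : ∀ p : ℝ × ℝ, ‖(p.1 : ℂ) + (p.2 : ℂ) * Complex.I‖ ^ 2 = p.1 ^ 2 + p.2 ^ 2 := fun p => by
    rw [← Complex.normSq_eq_norm_sq, Complex.normSq_add_mul_I]
  simp only [this]
  have i1 : Integrable (fun p : ℝ × ℝ => p.1 ^ 2)
      ((gaussianReal 0 (1 / 2)).prod (gaussianReal 0 (1 / 2))) := hm.integrable_sq.comp_fst _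
  have i2 : Integrable (fun p : ℝ × ℝ => p.2 ^ 2)
      ((gaussianReal 0 (1 / 2)).prod (gaussianReal 0 (1 / 2))) := hm.integrable_sq.comp_snd _
  rw [integral_add i1 i2, integral_fun_fst (fun x : ℝ => x ^ 2),
    integral_fun_snd (fun x : ℝ => x ^ 2), hv]
  simp; norm_num

/-- The fourth absolute moment of the complex normal law. -/
def fourthMoment : ℝ := ∫ z, ‖z‖ ^ 4 ∂complexNormal

lemma integrable_norm_pow_four_complexNormal : Integrable (fun z : ℂ => ‖z‖ ^ 4) complexNormal := by
  have := memLp_complexNormal.integrable_norm_rpow (by norm_num) (by norm_num)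
  refine this.congr (Eventually.of_forall fun z => ?_)
  simp only
  rw [show ENNReal.toReal 4 = ((4 : ℕ) : ℝ) by simp, Real.rpow_natCast]

lemma fourthMoment_nonneg : 0 ≤ fourthMoment := integral_nonneg fun z => by positivity

/-- The law of a column of `N` i.i.d. complex normal entries. -/
def columnLaw (N : ℕ) : Measure (Fin N → ℂ) := Measure.pi fun _ => complexNormal

instance (N : ℕ) : IsProbabilityMeasure (columnLaw N) := by unfold columnLaw; infer_instance

lemma columnLaw_map_neg (N : ℕ) : (columnLaw N).map (fun y => -y) = columnLaw N := by
  have : MeasurePreserving (fun z : ℂ => -z) complexNormal complexNormal :=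
    ⟨measurable_neg, complexNormal_map_neg⟩
  exact (measurePreserving_pi (fun _ : Fin N => complexNormal) (fun _ => complexNormal)
    fun _ => this).map_eq

lemma integral_coord (N : ℕ) {E : Type*} [NormedAddCommGroup E] [NormedSpace ℝ E] (i : Fin N)
    {F : ℂ → E} (hF : StronglyMeasurable F) :
    ∫ h, F (h i) ∂(columnLaw N) = ∫ z, F z ∂complexNormal := by
  have hmp := measurePreserving_eval (fun _ : Fin N => complexNormal) i
  have h := integral_map (f := F) (hmp.measurable.aemeasurable (μ := columnLaw N))
    hF.aestronglyMeasurable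
  rw [← h]
  congr 1
  exact hmp.map_eq.symm ▸ rfl

lemma memLp_coord (N : ℕ) (i : Fin N) : MemLp (fun h : Fin N → ℂ => h i) 4 (columnLaw N) :=
  memLp_complexNormal.comp_measurePreserving
    (measurePreserving_eval (fun _ : Fin N => complexNormal) i)

lemma integrable_coord {N : ℕ} (i : Fin N) {F : ℂ → ℝ} (hF : Integrable F complexNormal) :
    Integrable (fun h => F (h i)) (columnLaw N) :=
  (measurePreserving_eval (fun _ : Fin N => complexNormal) i).integrable_comp_of_integrable hF

/-- The sesquilinear quadratic form `v ↦ vᴴ D v`. -/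
def quad {m : Type*} [Fintype m] (D : Matrix m m ℂ) (v : m → ℂ) : ℂ := star v ⬝ᵥ D *ᵥ v

/-- The squared Frobenius norm. -/
def frobSq {m n : Type*} [Fintype m] [Fintype n] (D : Matrix m n ℂ) : ℝ := ∑ i, ∑ j, ‖D i j‖ ^ 2

lemma frobSq_nonneg {m n : Type*} [Fintype m] [Fintype n] (D : Matrix m n ℂ) : 0 ≤ frobSq D :=
  Finset.sum_nonneg fun _ _ => Finset.sum_nonneg fun _ _ => by positivity

lemma quad_eq_sum {m : Type*} [Fintype m] (D : Matrix m m ℂ) (v : m → ℂ) :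
    quad D v = ∑ i, ∑ j, D i j * (conj (v i) * v j) := by
  simp only [quad, dotProduct, mulVec, Finset.mul_sum, Pi.star_apply, RCLike.star_def]
  exact Finset.sum_congr rfl fun i _ => Finset.sum_congr rfl fun j _ => by ring

/-- The array `h̄ᵢ hⱼ - δᵢⱼ` of centred products of the entries of `h`. -/
def centredProd {N : ℕ} (i j : Fin N) (h : Fin N → ℂ) : ℂ :=
  conj (h i) * h j - if i = j then 1 else 0

lemma quad_sub_trace {N : ℕ} (D : Matrix (Fin N) (Fin N) ℂ) (h : Fin N → ℂ) :
    quad D h - trace D = ∑ i, ∑ j, D i j * centredProd i j h := by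
  simp only [quad_eq_sum, centredProd, mul_sub, Finset.sum_sub_distrib, trace, diag_apply]
  simp

lemma centredProd_flip {N : ℕ} (m : Fin N) (h : Fin N → ℂ) (i j : Fin N) :
    centredProd i j (fun i => if i = m then -h i else h i)
      = (if i = m then -1 else 1) * (if j = m then -1 else 1) * centredProd i j h := by
  unfold centredProd
  by_cases hij : i = j
  · subst hij
    by_cases hi : i = m <;> simp [hi]
  · by_cases hi : i = m
    · subst hi
      simp [hij, Ne.symm hij]
    · by_cases hj : j = m
      · subst hj
        simp [hij]
      · simp [hij, hi, hj]

lemma memLp_conj_mul {N : ℕ} (i j : Fin N) :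
    MemLp (fun h : Fin N → ℂ => conj (h i) * h j) 2 (columnLaw N) := by
  have : ENNReal.HolderTriple 4 4 2 := ⟨by
    rw [← two_mul, show (4 : ENNReal) = 2 * 2 by norm_num,
      ENNReal.mul_inv (by norm_num) (by norm_num), ← mul_assoc,
      ENNReal.mul_inv_cancel (by norm_num) (by norm_num), one_mul]⟩
  exact (memLp_coord N j).mul (memLp_coord N i).star

lemma memLp_centredProd {N : ℕ} (i j : Fin N) :
    MemLp (centredProd i j) 2 (columnLaw N) :=
  (memLp_conj_mul i j).sub (memLp_const _)

lemma memLp_quad {N : ℕ} (D : Matrix (Fin N) (Fin N) ℂ) :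
    MemLp (quad D) 2 (columnLaw N) := by
  have : quad D = fun h => ∑ i, ∑ j, D i j * (conj (h i) * h j) := by ext h; exact quad_eq_sum D h
  rw [this]
  exact memLp_finsetSum _ fun i _ => memLp_finsetSum _ fun j _ => (memLp_conj_mul i j).const_mul _

lemma integral_centredProd {N : ℕ} (i j : Fin N) : ∫ h, centredProd i j h ∂(columnLaw N) = 0 := by
  by_cases hij : i = j
  · subst hij
    have h1 : ∀ h : Fin N → ℂ, centredProd i i h = ((‖h i‖ ^ 2 : ℝ) : ℂ) - 1 := by
      intro h
      simp [centredProd, Complex.conj_mul']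
    have hI : Integrable (fun h : Fin N → ℂ => ‖h i‖ ^ 2) (columnLaw N) :=
      ((memLp_coord N i).mono_exponent (by norm_num : (2 : ENNReal) ≤ 4)).norm.integrable_sq
    simp only [h1]
    rw [integral_sub hI.ofReal (integrable_const _), integral_complex_ofReal,
      integral_coord N i (F := fun z => ‖z‖ ^ 2) (by fun_prop), integral_norm_sq_complexNormal]
    simp
  · refine integral_eq_zero_of_flip complexNormal_map_neg i fun h => ?_
    rw [centredProd_flip]
    simp [Ne.symm hij]

lemma integral_quad {N : ℕ} (D : Matrix (Fin N) (Fin N) ℂ) :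
    ∫ h, quad D h ∂(columnLaw N) = trace D := by
  have h1 : ∫ h, (quad D h - trace D) ∂(columnLaw N) = 0 := by
    simp only [quad_sub_trace]
    have hI : ∀ i j : Fin N, Integrable (fun h => D i j * centredProd i j h) (columnLaw N) :=
      fun i j => ((memLp_centredProd i j).integrable (by norm_num)).const_mul _
    rw [integral_finsetSum _ fun i _ => integrable_finsetSum _ fun j _ => hI i j]
    refine Finset.sum_eq_zero fun i _ => ?_
    rw [integral_finsetSum _ fun j _ => hI i j]
    refine Finset.sum_eq_zero fun j _ => ?_
    rw [integral_const_mul, integral_centredProd, mul_zero]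
  rw [integral_sub ((memLp_quad D).integrable (by norm_num)) (integrable_const _)] at h1
  simpa [sub_eq_zero] using h1

/-- The concentration of quadratic forms in i.i.d. complex normal variables about the trace. -/
lemma integral_norm_quad_sub_trace_sq_le {N : ℕ} (D : Matrix (Fin N) (Fin N) ℂ) :
    ∫ h, ‖quad D h - trace D‖ ^ 2 ∂(columnLaw N) ≤ 2 * fourthMoment * frobSq D := by
  simp only [quad_sub_trace]
  have hI4 : ∀ i : Fin N, Integrable (fun h : Fin N → ℂ => ‖h i‖ ^ 4) (columnLaw N) := fun i =>
    integrable_coord i integrable_norm_pow_four_complexNormal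
  have hI2 : ∀ i : Fin N, Integrable (fun h : Fin N → ℂ => ‖h i‖ ^ 2) (columnLaw N) := fun i =>
    ((memLp_coord N i).mono_exponent (by norm_num : (2 : ENNReal) ≤ 4)).norm.integrable_sq
  have h4 : ∀ i : Fin N, ∫ h : Fin N → ℂ, ‖h i‖ ^ 4 ∂(columnLaw N) = fourthMoment := fun i =>
    integral_coord N i (F := fun z => ‖z‖ ^ 4) (by fun_prop)
  have h2 : ∀ i : Fin N, ∫ h : Fin N → ℂ, ‖h i‖ ^ 2 ∂(columnLaw N) = 1 := fun i => by
    rw [integral_coord N i (F := fun z => ‖z‖ ^ 2) (by fun_prop), integral_norm_sq_complexNormal]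
  have hmain := integral_norm_sq_array_le (γ := complexNormal) complexNormal_map_neg
    (ξ := centredProd (N := N)) centredProd_flip memLp_centredProd (ρ := fourthMoment) (θ := 0)
    le_rfl ?_ ?_ D
  · rw [zero_mul, add_zero] at hmain
    exact hmain
  · intro i j
    change ∫ h, ‖centredProd i j h‖ ^ 2 ∂(columnLaw N) ≤ _
    by_cases hij : i = j
    · subst hij
      have : ∀ h : Fin N → ℂ, ‖centredProd i i h‖ ^ 2 = ‖h i‖ ^ 4 - 2 * ‖h i‖ ^ 2 + 1 := by
        intro h
        have : centredProd i i h = ((‖h i‖ ^ 2 - 1 : ℝ) : ℂ) := by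
          simp [centredProd, Complex.conj_mul']
        rw [this, Complex.norm_real, Real.norm_eq_abs, sq_abs]; ring
      simp only [this]
      have hI : Integrable (fun h : Fin N → ℂ => ‖h i‖ ^ 4 - 2 * ‖h i‖ ^ 2) (columnLaw N) :=
        (hI4 i).sub ((hI2 i).const_mul 2)
      rw [integral_add hI (integrable_const _),
        integral_sub (hI4 i) ((hI2 i).const_mul 2), integral_const_mul, h4, h2]
      simp; linarith
    · have : ∀ h : Fin N → ℂ, ‖centredProd i j h‖ ^ 2 = ‖h i‖ ^ 2 * ‖h j‖ ^ 2 := by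
        intro h; simp [centredProd, hij, mul_pow]
      have hle : ∀ h : Fin N → ℂ, ‖h i‖ ^ 2 * ‖h j‖ ^ 2 ≤ 1 / 2 * ‖h i‖ ^ 4 + 1 / 2 * ‖h j‖ ^ 4 :=
        fun h => by nlinarith [sq_nonneg (‖h i‖ ^ 2 - ‖h j‖ ^ 2)]
      calc _ ≤ ∫ h : Fin N → ℂ, (1 / 2 * ‖h i‖ ^ 4 + 1 / 2 * ‖h j‖ ^ 4) ∂(columnLaw N) := by
            refine integral_mono (memLp_centredProd i j).norm.integrable_sq
              (((hI4 i).const_mul _).add ((hI4 j).const_mul _)) fun h => ?_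
            simp only [this]; exact hle h
        _ = fourthMoment := by
            rw [integral_add ((hI4 i).const_mul _) ((hI4 j).const_mul _), integral_const_mul,
              integral_const_mul, h4, h4]; ring
  -- distinct diagonal entries are independent and centred, hence uncorrelated
  · intro i k hik
    have hreal : ∀ h : Fin N → ℂ, centredProd i i h * conj (centredProd k k h)
        = (((‖h i‖ ^ 2 - 1) * (‖h k‖ ^ 2 - 1) : ℝ) : ℂ) := by
      intro h
      simp [centredProd, Complex.conj_mul']
    have hI : Integrable (fun h : Fin N → ℂ => (‖h i‖ ^ 2 - 1) * (‖h k‖ ^ 2 - 1))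
        (columnLaw N) := by
      have h1 := ((memLp_centredProd i i).integrable_mul (memLp_centredProd k k).star).re
      refine h1.congr (Eventually.of_forall fun h => ?_)
      simp only [Pi.mul_apply, Pi.star_apply, RCLike.star_def]
      rw [hreal, RCLike.re_to_complex, Complex.ofReal_re]
    simp only [hreal]
    rw [integral_complex_ofReal, Complex.norm_real, Real.norm_eq_abs]
    refine abs_integral_le_of_resample i hI fun h => le_of_eq ?_
    have e : ∀ y, (‖Function.update h i y i‖ ^ 2 - 1) * (‖Function.update h i y k‖ ^ 2 - 1)
        = (‖y‖ ^ 2 - 1) * (‖h k‖ ^ 2 - 1) := fun y => by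
      simp [Function.update_of_ne hik.symm]
    simp only [e]
    have hz : Integrable (fun z : ℂ => ‖z‖ ^ 2) complexNormal :=
      (memLp_complexNormal.mono_exponent (by norm_num : (2 : ENNReal) ≤ 4)).norm.integrable_sq
    rw [integral_mul_const, integral_sub hz (integrable_const _), integral_norm_sq_complexNormal]
    simp

/-- The mean square of a linear form. -/
lemma integral_norm_dotProduct_sq {N : ℕ} (v : Fin N → ℂ) :
    ∫ h, ‖star h ⬝ᵥ v‖ ^ 2 ∂(columnLaw N) = ∑ i, ‖v i‖ ^ 2 := by
  have h1 : ∀ h : Fin N → ℂ, ((‖star h ⬝ᵥ v‖ ^ 2 : ℝ) : ℂ) = quad (vecMulVec v (star v)) h := by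
    intro h
    rw [Complex.ofReal_pow, ← Complex.mul_conj', quad, vecMulVec_mulVec, dotProduct_smul,
      ← RCLike.star_def, star_dotProduct]
    simp [dotProduct_comm]
  have h2 := integral_quad (vecMulVec v (star v))
  simp only [← h1] at h2
  rw [integral_complex_ofReal] at h2
  have h3 : trace (vecMulVec v (star v)) = ((∑ i, ‖v i‖ ^ 2 : ℝ) : ℂ) := by
    simp [trace, vecMulVec_apply, Complex.mul_conj']
  rw [h3] at h2
  exact_mod_cast h2

lemma memLp_dotProduct {N : ℕ} (v : Fin N → ℂ) :
    MemLp (fun h : Fin N → ℂ => star h ⬝ᵥ v) 2 (columnLaw N) := by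
  simp only [dotProduct, Pi.star_apply]
  refine memLp_finsetSum _ fun i _ => ?_
  exact (((memLp_coord N i).mono_exponent (by norm_num : (2 : ENNReal) ≤ 4)).star).mul_const (v i)

lemma integral_dotProduct {N : ℕ} (v : Fin N → ℂ) :
    ∫ h : Fin N → ℂ, star h ⬝ᵥ v ∂(columnLaw N) = 0 := by
  simp only [dotProduct, Pi.star_apply]
  have hI : ∀ i, Integrable (fun h : Fin N → ℂ => star (h i) * v i) (columnLaw N) := fun i =>
    ((memLp_coord N i).star.integrable (by norm_num)).mul_const (v i)
  rw [integral_finsetSum _ fun i _ => hI i]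
  refine Finset.sum_eq_zero fun i _ => ?_
  exact integral_eq_zero_of_flip complexNormal_map_neg i fun h => by simp

lemma integral_re_quad {N : ℕ} (D : Matrix (Fin N) (Fin N) ℂ) :
    ∫ h, (quad D h).re ∂(columnLaw N) = (trace D).re := by
  have := integral_re ((memLp_quad D).integrable (by norm_num))
  simp only [RCLike.re_to_complex] at this
  rw [this, integral_quad]

lemma memLp_re_quad {N : ℕ} (D : Matrix (Fin N) (Fin N) ℂ) :
    MemLp (fun h => (quad D h).re) 2 (columnLaw N) := (memLp_quad D).re

lemma integral_re_quad_sub_trace_sq_le {N : ℕ} (D : Matrix (Fin N) (Fin N) ℂ) :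
    ∫ h, ((quad D h).re - (trace D).re) ^ 2 ∂(columnLaw N) ≤ 2 * fourthMoment * frobSq D := by
  refine le_trans (integral_mono ((memLp_re_quad D).sub (memLp_const _)).integrable_sq
    ((memLp_quad D).sub (memLp_const _)).norm.integrable_sq fun h => ?_)
    (integral_norm_quad_sub_trace_sq_le D)
  simp only [Pi.sub_apply]
  rw [← Complex.sub_re, ← sq_abs]
  exact pow_le_pow_left₀ (abs_nonneg _) (Complex.abs_re_le_norm _) 2

/-! ### Resolvents of positive matrices and rank-one perturbations -/

section Resolvent

variable {m : Type*} [Fintype m]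

lemma quad_eq_ofReal_re {D : Matrix m m ℂ} (hD : D.IsHermitian) (v : m → ℂ) :
    quad D v = ((quad D v).re : ℂ) := by
  have : conj (quad D v) = quad D v := by
    conv_rhs => rw [quad, star_dotProduct, star_mulVec, hD.eq, ← dotProduct_mulVec]
    rfl
  exact (Complex.conj_eq_iff_re.1 this).symm

lemma quad_re_nonneg {D : Matrix m m ℂ} (hD : D.PosSemidef) (v : m → ℂ) : 0 ≤ (quad D v).re :=
  hD.re_dotProduct_nonneg v

lemma quad_sub (C D : Matrix m m ℂ) (v : m → ℂ) : quad (C - D) v = quad C v - quad D v := by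
  simp [quad, sub_mulVec, dotProduct_sub]

lemma quad_smul (a : ℂ) (D : Matrix m m ℂ) (v : m → ℂ) : quad (a • D) v = a * quad D v := by
  simp [quad, smul_mulVec]

lemma quad_smul_vec (a : ℝ) (D : Matrix m m ℂ) (v : m → ℂ) :
    quad D ((a : ℂ) • v) = (a : ℂ) ^ 2 * quad D v := by
  simp [quad, mulVec_smul, Pi.star_def]
  ring

lemma trace_re_nonneg {D : Matrix m m ℂ} (hD : D.PosSemidef) : 0 ≤ (trace D).re :=
  (Complex.nonneg_iff.1 hD.trace_nonneg).1

lemma frobSq_eq_trace {D : Matrix m m ℂ} (hD : D.IsHermitian) : frobSq D = (trace (D * D)).re := by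
  have : D * D = D * Dᴴ := by rw [hD.eq]
  rw [this, frobSq, trace, Complex.re_sum]
  refine Finset.sum_congr rfl fun i _ => ?_
  rw [diag_apply, mul_apply, Complex.re_sum]
  refine Finset.sum_congr rfl fun j _ => ?_
  rw [conjTranspose_apply, RCLike.star_def, Complex.mul_conj']
  norm_cast

variable [DecidableEq m]

/-- `P ≥ x` in the Loewner order, with `x > 0`. The inverse `P⁻¹` then satisfies
`0 < P⁻¹ ≤ x⁻¹`, whence the estimates of this section. -/
structure BoundedBelow (x : ℝ) (P : Matrix m m ℂ) : Prop where
  pos : 0 < x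
  le : (P - (x : ℂ) • (1 : Matrix m m ℂ)).PosSemidef

namespace BoundedBelow

variable {x : ℝ} {P : Matrix m m ℂ}

omit [Fintype m] in
lemma posDef (h : BoundedBelow x P) : P.PosDef := by
  have h1 : ((x : ℂ) • (1 : Matrix m m ℂ)).PosDef :=
    PosDef.smul PosDef.one (by exact_mod_cast h.pos)
  have := PosDef.posSemidef_add h.le h1
  simpa using this

lemma isUnit_det (h : BoundedBelow x P) : IsUnit P.det :=
  (isUnit_iff_isUnit_det _).1 h.posDef.isUnit

lemma inv_posSemidef (h : BoundedBelow x P) : (P⁻¹).PosSemidef := h.posDef.inv.posSemidef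

lemma inv_isHermitian (h : BoundedBelow x P) : (P⁻¹).IsHermitian := h.posDef.inv.isHermitian

lemma inv_sub_sq (h : BoundedBelow x P) : (P⁻¹ - (x : ℂ) • (P⁻¹ * P⁻¹)).PosSemidef := by
  have := h.le.conjTranspose_mul_mul_same P⁻¹
  rw [h.inv_isHermitian.eq, Matrix.mul_sub, Matrix.sub_mul, nonsing_inv_mul _ h.isUnit_det,
    Matrix.one_mul, Matrix.mul_smul, Matrix.smul_mul, Matrix.mul_one] at this
  exact this

lemma one_sub_inv (h : BoundedBelow x P) : (1 - (x : ℂ) • P⁻¹).PosSemidef := by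
  have hH : (1 - (x : ℂ) • P⁻¹).IsHermitian := by
    refine isHermitian_one.sub ?_
    rw [IsHermitian, conjTranspose_smul, h.inv_isHermitian.eq]; simp
  have h1 : ((1 - (x : ℂ) • P⁻¹) * (1 - (x : ℂ) • P⁻¹)).PosSemidef := by
    have := posSemidef_conjTranspose_mul_self (1 - (x : ℂ) • P⁻¹)
    rwa [hH.eq] at this
  have h2 : ((x : ℂ) • (P⁻¹ - (x : ℂ) • (P⁻¹ * P⁻¹))).PosSemidef :=
    h.inv_sub_sq.smul (by exact_mod_cast h.pos.le)
  convert h1.add h2 using 1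
  simp only [Matrix.sub_mul, Matrix.mul_sub, Matrix.one_mul, Matrix.mul_one, Matrix.smul_mul,
    Matrix.mul_smul, smul_sub, smul_smul]
  abel

lemma inv_sq_sub_pow_four (h : BoundedBelow x P) :
    (P⁻¹ * P⁻¹ - ((x : ℂ) ^ 2) • ((P⁻¹ * P⁻¹) * (P⁻¹ * P⁻¹))).PosSemidef := by
  have h2 : ((x : ℂ) • (P⁻¹ - (x : ℂ) • (P⁻¹ * P⁻¹))).PosSemidef :=
    h.inv_sub_sq.smul (by exact_mod_cast h.pos.le)
  have := (h.one_sub_inv.add h2).conjTranspose_mul_mul_same P⁻¹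
  rw [h.inv_isHermitian.eq] at this
  convert this using 1
  simp only [Matrix.add_mul, Matrix.mul_add, Matrix.sub_mul, Matrix.mul_sub,
    Matrix.mul_one, Matrix.smul_mul, Matrix.mul_smul, smul_sub, smul_smul, Matrix.mul_assoc, sq]
  abel

lemma inv_sq_isHermitian (h : BoundedBelow x P) : (P⁻¹ * P⁻¹).IsHermitian := by
  rw [IsHermitian, conjTranspose_mul, h.inv_isHermitian.eq]

lemma inv_sq_posSemidef (h : BoundedBelow x P) : (P⁻¹ * P⁻¹).PosSemidef := by
  have := posSemidef_conjTranspose_mul_self P⁻¹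
  rwa [h.inv_isHermitian.eq] at this

lemma trace_inv_le (h : BoundedBelow x P) : (trace P⁻¹).re ≤ Fintype.card m / x := by
  have := trace_re_nonneg h.one_sub_inv
  rw [trace_sub, trace_smul, trace_one] at this
  simp at this
  rw [le_div_iff₀ h.pos]; linarith

lemma trace_inv_sq_le (h : BoundedBelow x P) :
    (trace (P⁻¹ * P⁻¹)).re ≤ (trace P⁻¹).re / x := by
  have := trace_re_nonneg h.inv_sub_sq
  rw [trace_sub, trace_smul] at this
  simp at this
  rw [le_div_iff₀ h.pos]; linarith

lemma frobSq_inv_le (h : BoundedBelow x P) : frobSq P⁻¹ ≤ Fintype.card m / x ^ 2 := by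
  rw [frobSq_eq_trace h.inv_isHermitian]
  calc _ ≤ (trace P⁻¹).re / x := h.trace_inv_sq_le
    _ ≤ (Fintype.card m / x) / x := by
        have := h.pos
        gcongr; exact h.trace_inv_le
    _ = _ := by rw [div_div, sq]

lemma frobSq_inv_sq_le (h : BoundedBelow x P) :
    frobSq (P⁻¹ * P⁻¹) ≤ Fintype.card m / x ^ 4 := by
  have h1 := trace_re_nonneg h.inv_sq_sub_pow_four
  rw [trace_sub, trace_smul, ← Complex.ofReal_pow] at h1
  simp only [smul_eq_mul, Complex.sub_re, Complex.re_ofReal_mul] at h1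
  rw [frobSq_eq_trace h.inv_sq_isHermitian]
  have h2 := h.frobSq_inv_le
  rw [frobSq_eq_trace h.inv_isHermitian] at h2
  have hx := h.pos
  rw [le_div_iff₀ (by positivity)] at h2 ⊢
  nlinarith [mul_le_mul_of_nonneg_right h1 (sq_nonneg x)]

lemma frobSq_one_sub_le (h : BoundedBelow x P) :
    frobSq ((x : ℂ) • P⁻¹ - 1) ≤ Fintype.card m := by
  have hH : ((x : ℂ) • P⁻¹ - 1).IsHermitian := by
    refine IsHermitian.sub ?_ isHermitian_one
    rw [IsHermitian, conjTranspose_smul, h.inv_isHermitian.eq]; simp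
  have h1 := trace_re_nonneg h.inv_sub_sq
  have h2 := trace_re_nonneg h.inv_posSemidef
  rw [trace_sub, trace_smul] at h1
  simp only [smul_eq_mul, Complex.sub_re, Complex.re_ofReal_mul] at h1
  rw [frobSq_eq_trace hH]
  simp only [Matrix.sub_mul, Matrix.mul_sub, Matrix.one_mul, Matrix.mul_one, Matrix.smul_mul,
    Matrix.mul_smul, trace_sub, trace_smul, trace_one, smul_eq_mul, Complex.sub_re,
    Complex.re_ofReal_mul, Complex.natCast_re]
  have hx := h.pos
  nlinarith [mul_nonneg hx.le h1, mul_nonneg hx.le h2]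

lemma quad_inv_sq_le (h : BoundedBelow x P) (u : m → ℂ) :
    (quad (P⁻¹ * P⁻¹) u).re ≤ (quad P⁻¹ u).re / x := by
  have := quad_re_nonneg h.inv_sub_sq u
  rw [quad_sub, quad_smul] at this
  simp only [Complex.sub_re, Complex.re_ofReal_mul] at this
  rw [le_div_iff₀ h.pos]; linarith

lemma one_add_quad_ne_zero (h : BoundedBelow x P) (u : m → ℂ) : 1 + quad P⁻¹ u ≠ 0 := by
  have := quad_re_nonneg h.inv_posSemidef u
  intro h0
  have := congrArg Complex.re h0
  simp at this; linarith

/-- The **Sherman–Morrison formula**. -/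
lemma inv_add_rankOne (h : BoundedBelow x P) (u : m → ℂ) :
    (P + vecMulVec u (star u))⁻¹
      = P⁻¹ - (1 + quad P⁻¹ u)⁻¹ • vecMulVec (P⁻¹ *ᵥ u) (star (P⁻¹ *ᵥ u)) := by
  refine inv_eq_right_inv ?_
  have h1 : star (P⁻¹ *ᵥ u) = star u ᵥ* P⁻¹ := by rw [star_mulVec, h.inv_isHermitian.eq]
  have h2 : P *ᵥ P⁻¹ *ᵥ u = u := by
    rw [mulVec_mulVec, mul_nonsing_inv _ h.isUnit_det, one_mulVec]
  have h3 := h.one_add_quad_ne_zero u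
  rw [Matrix.add_mul, Matrix.mul_sub, Matrix.mul_sub, mul_nonsing_inv _ h.isUnit_det,
    Matrix.mul_smul, Matrix.mul_smul, mul_vecMulVec, h2, vecMulVec_mul, vecMulVec_mul_vecMulVec, h1,
    ← quad, vecMulVec_smul]
  have : vecMulVec u (star u ᵥ* P⁻¹) = (1 + quad P⁻¹ u)⁻¹ • vecMulVec u (star u ᵥ* P⁻¹)
      + (1 + quad P⁻¹ u)⁻¹ • quad P⁻¹ u • vecMulVec u (star u ᵥ* P⁻¹) := by
    rw [smul_smul, ← add_smul]
    have : (1 + quad P⁻¹ u)⁻¹ + (1 + quad P⁻¹ u)⁻¹ * quad P⁻¹ u = 1 := by field_simp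
    rw [this, one_smul]
  nth_rewrite 2 [this]
  abel

/-- The quadratic form of the perturbed resolvent at the perturbing vector is the image of the
unperturbed one under `t ↦ t / (1 + t)`. -/
lemma quad_inv_add_rankOne (h : BoundedBelow x P) (u : m → ℂ) :
    (quad (P + vecMulVec u (star u))⁻¹ u).re
      = (quad P⁻¹ u).re / (1 + (quad P⁻¹ u).re) := by
  have h3 := h.one_add_quad_ne_zero u
  have h1 : star (P⁻¹ *ᵥ u) ⬝ᵥ u = quad P⁻¹ u := by
    rw [star_mulVec, h.inv_isHermitian.eq, ← dotProduct_mulVec, quad]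
  have h4 : quad (P + vecMulVec u (star u))⁻¹ u = quad P⁻¹ u / (1 + quad P⁻¹ u) := by
    rw [h.inv_add_rankOne u, quad_sub, quad_smul, quad, quad, vecMulVec_mulVec, h1]
    simp only [dotProduct_smul, MulOpposite.smul_eq_mul_unop, MulOpposite.unop_op]
    rw [← quad]
    field_simp
    ring
  rw [h4, quad_eq_ofReal_re h.inv_isHermitian u]
  norm_cast

lemma trace_inv_add_rankOne (h : BoundedBelow x P) (u : m → ℂ) :
    (trace (P + vecMulVec u (star u))⁻¹).re
      = (trace P⁻¹).re - (quad (P⁻¹ * P⁻¹) u).re / (1 + (quad P⁻¹ u).re) := by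
  have h1 : trace (vecMulVec (P⁻¹ *ᵥ u) (star (P⁻¹ *ᵥ u))) = quad (P⁻¹ * P⁻¹) u := by
    rw [trace_vecMulVec, dotProduct_comm, star_mulVec, h.inv_isHermitian.eq, ← dotProduct_mulVec,
      mulVec_mulVec, quad]
  rw [h.inv_add_rankOne u, trace_sub, trace_smul, h1, quad_eq_ofReal_re h.inv_isHermitian u,
    quad_eq_ofReal_re h.inv_sq_isHermitian u, smul_eq_mul]
  norm_cast
  rw [Complex.sub_re, Complex.ofReal_re, div_eq_inv_mul]

lemma det_re_pos (h : BoundedBelow x P) : 0 < P.det.re := (Complex.pos_iff.1 h.posDef.det_pos).1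

lemma det_add_rankOne (h : BoundedBelow x P) (u : m → ℂ) :
    (det (P + vecMulVec u (star u))).re = (det P).re * (1 + (quad P⁻¹ u).re) := by
  have h1 : (1 + replicateRow Unit (star u) * P⁻¹ * replicateCol Unit u).det = 1 + quad P⁻¹ u := by
    rw [det_unique, Matrix.mul_assoc]
    simp [quad, mul_apply, dotProduct, mulVec]
  rw [vecMulVec_eq Unit, det_add_replicateCol_mul_replicateRow h.isUnit_det, h1,
    quad_eq_ofReal_re h.inv_isHermitian u]
  norm_cast
  rw [Complex.re_mul_ofReal]

end BoundedBelow

end Resolvent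

/-! ### The map `t ↦ t / (1 + t)` -/

/-- The map `t ↦ t / (1 + t)`, which turns the quadratic form of the resolvent without a given
column into the quadratic form of the full resolvent. -/
def phi (t : ℝ) : ℝ := t / (1 + t)

lemma phi_nonneg {a : ℝ} (ha : 0 ≤ a) : 0 ≤ phi a := by unfold phi; positivity

lemma phi_le_one {a : ℝ} (ha : 0 ≤ a) : phi a ≤ 1 := by
  unfold phi; rw [div_le_one (by positivity)]; linarith

lemma phi_sub_phi {a b : ℝ} (ha : 0 ≤ a) (hb : 0 ≤ b) :
    phi a - phi b = (a - b) / ((1 + a) * (1 + b)) := by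
  unfold phi; field_simp; ring

lemma abs_phi_sub_phi_le {a b : ℝ} (ha : 0 ≤ a) (hb : 0 ≤ b) : |phi a - phi b| ≤ |a - b| := by
  rw [phi_sub_phi ha hb, abs_div, abs_of_pos (by positivity : 0 < (1 + a) * (1 + b))]
  exact div_le_self (abs_nonneg _) (by nlinarith [mul_nonneg ha hb])

lemma measurable_phi : Measurable phi := by unfold phi; fun_prop

/-- The Jensen gap of `phi` is at most the variance. -/
lemma abs_integral_phi_sub_le {Ω : Type*} [MeasurableSpace Ω] {μ : Measure Ω}
    [IsProbabilityMeasure μ] {f : Ω → ℝ} (hf : MemLp f 2 μ) (h0 : ∀ ω, 0 ≤ f ω) {b : ℝ}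
    (hb : ∫ ω, f ω ∂μ = b) :
    |∫ ω, phi (f ω) ∂μ - phi b| ≤ ∫ ω, (f ω - b) ^ 2 ∂μ := by
  have hb0 : 0 ≤ b := hb ▸ integral_nonneg h0
  have h1 : Integrable f μ := hf.integrable (by norm_num)
  have h2 : Integrable (fun ω => (f ω - b) ^ 2) μ := (hf.sub (memLp_const b)).integrable_sq
  have hphi : Integrable (fun ω => phi (f ω)) μ := by
    refine Integrable.mono' (integrable_const 1)
      (measurable_phi.comp_aemeasurable hf.aemeasurable).aestronglyMeasurable
      (Eventually.of_forall fun ω => ?_)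
    rw [Real.norm_of_nonneg (phi_nonneg (h0 ω))]
    exact phi_le_one (h0 ω)
  have hd : Integrable (fun ω => (f ω - b) / (1 + b) ^ 2) μ :=
    (h1.sub (integrable_const b)).div_const _
  have hl : Integrable (fun ω => phi b + (f ω - b) / (1 + b) ^ 2) μ :=
    (integrable_const _).add hd
  -- the tangent of `phi` at the mean `b` integrates to `phi b`
  have hlin : ∫ ω, (phi b + (f ω - b) / (1 + b) ^ 2) ∂μ = phi b := by
    rw [integral_add (integrable_const _) hd,
      integral_div, integral_sub h1 (integrable_const b), hb]
    simp
  have hpt : ∀ ω, |phi (f ω) - (phi b + (f ω - b) / (1 + b) ^ 2)| ≤ (f ω - b) ^ 2 := by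
    intro ω
    have hfω := h0 ω
    have : phi (f ω) - (phi b + (f ω - b) / (1 + b) ^ 2)
        = -((f ω - b) ^ 2 / ((1 + f ω) * (1 + b) ^ 2)) := by
      unfold phi; field_simp; ring
    rw [this, abs_neg, abs_of_nonneg (by positivity)]
    refine div_le_self (sq_nonneg _) ?_
    have h3 : 1 ≤ (1 + b) ^ 2 := by nlinarith
    nlinarith
  calc |∫ ω, phi (f ω) ∂μ - phi b|
      = |∫ ω, (phi (f ω) - (phi b + (f ω - b) / (1 + b) ^ 2)) ∂μ| := by
        rw [integral_sub hphi hl, hlin]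
    _ ≤ ∫ ω, |phi (f ω) - (phi b + (f ω - b) / (1 + b) ^ 2)| ∂μ := abs_integral_le_integral_abs
    _ ≤ _ := integral_mono (hphi.sub hl).abs h2 hpt

/-! ### Concentration over one column -/

section Column

variable {N : ℕ} {x : ℝ} {P : Matrix (Fin N) (Fin N) ℂ}

/-- The normalized quadratic form `yᴴ P⁻¹ y / K`. -/
def colForm (K : ℕ) (P : Matrix (Fin N) (Fin N) ℂ) (y : Fin N → ℂ) : ℝ := (quad P⁻¹ y).re / K

/-- The normalized quadratic form `yᴴ P⁻² y / K`. -/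
def colForm₂ (K : ℕ) (P : Matrix (Fin N) (Fin N) ℂ) (y : Fin N → ℂ) : ℝ :=
  (quad (P⁻¹ * P⁻¹) y).re / K

/-- The normalized trace `tr P⁻¹ / K`. -/
def ntr (K : ℕ) (P : Matrix (Fin N) (Fin N) ℂ) : ℝ := (trace P⁻¹).re / K

/-- The normalized trace `tr P⁻² / K`. -/
def ntr₂ (K : ℕ) (P : Matrix (Fin N) (Fin N) ℂ) : ℝ := (trace (P⁻¹ * P⁻¹)).re / K

variable (K : ℕ)

lemma colForm_nonneg (h : BoundedBelow x P) (y : Fin N → ℂ) : 0 ≤ colForm K P y :=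
  div_nonneg (quad_re_nonneg h.inv_posSemidef y) (Nat.cast_nonneg _)

lemma colForm₂_nonneg (h : BoundedBelow x P) (y : Fin N → ℂ) : 0 ≤ colForm₂ K P y :=
  div_nonneg (quad_re_nonneg h.inv_sq_posSemidef y) (Nat.cast_nonneg _)

lemma ntr_nonneg (h : BoundedBelow x P) : 0 ≤ ntr K P :=
  div_nonneg (trace_re_nonneg h.inv_posSemidef) (Nat.cast_nonneg _)

lemma ntr₂_nonneg (h : BoundedBelow x P) : 0 ≤ ntr₂ K P :=
  div_nonneg (trace_re_nonneg h.inv_sq_posSemidef) (Nat.cast_nonneg _)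

lemma ntr_le (h : BoundedBelow x P) : ntr K P ≤ N / K / x := by
  have := h.trace_inv_le
  rw [Fintype.card_fin] at this
  unfold ntr
  rw [div_right_comm]
  gcongr

lemma ntr₂_le (h : BoundedBelow x P) : ntr₂ K P ≤ ntr K P / x := by
  have := h.trace_inv_sq_le
  unfold ntr₂ ntr
  rw [div_right_comm]
  gcongr

lemma colForm₂_le (h : BoundedBelow x P) (y : Fin N → ℂ) : colForm₂ K P y ≤ colForm K P y / x := by
  have := h.quad_inv_sq_le y
  unfold colForm₂ colForm
  rw [div_right_comm]
  gcongr

lemma memLp_colForm : MemLp (colForm K P) 2 (columnLaw N) := by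
  have := (memLp_re_quad P⁻¹).mul_const ((K : ℝ)⁻¹)
  exact this

lemma memLp_colForm₂ : MemLp (colForm₂ K P) 2 (columnLaw N) := by
  have := (memLp_re_quad (P⁻¹ * P⁻¹)).mul_const ((K : ℝ)⁻¹)
  exact this

lemma integral_colForm : ∫ y, colForm K P y ∂(columnLaw N) = ntr K P := by
  unfold colForm ntr
  rw [integral_div, integral_re_quad]

lemma integral_colForm_sub_sq_le (h : BoundedBelow x P) :
    ∫ y, (colForm K P y - ntr K P) ^ 2 ∂(columnLaw N)
      ≤ 2 * fourthMoment * N / (K ^ 2 * x ^ 2) := by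
  have e : ∀ y, (colForm K P y - ntr K P) ^ 2
      = ((quad P⁻¹ y).re - (trace P⁻¹).re) ^ 2 / (K : ℝ) ^ 2 := fun y => by
    unfold colForm ntr; rw [← sub_div, div_pow]
  simp only [e]
  rw [integral_div]
  have h1 := h.frobSq_inv_le
  rw [Fintype.card_fin] at h1
  calc _ ≤ (2 * fourthMoment * (N / x ^ 2)) / (K : ℝ) ^ 2 := by
        gcongr
        exact (integral_re_quad_sub_trace_sq_le _).trans
          (mul_le_mul_of_nonneg_left h1 (by linarith [fourthMoment_nonneg]))
    _ = _ := by rw [← mul_div_assoc, div_div, mul_comm ((K : ℝ) ^ 2)]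

lemma integral_colForm₂_sub_sq_le (h : BoundedBelow x P) :
    ∫ y, (colForm₂ K P y - ntr₂ K P) ^ 2 ∂(columnLaw N)
      ≤ 2 * fourthMoment * N / (K ^ 2 * x ^ 4) := by
  have e : ∀ y, (colForm₂ K P y - ntr₂ K P) ^ 2
      = ((quad (P⁻¹ * P⁻¹) y).re - (trace (P⁻¹ * P⁻¹)).re) ^ 2 / (K : ℝ) ^ 2 := fun y => by
    unfold colForm₂ ntr₂; rw [← sub_div, div_pow]
  simp only [e]
  rw [integral_div]
  have h1 := h.frobSq_inv_sq_le
  rw [Fintype.card_fin] at h1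
  calc _ ≤ (2 * fourthMoment * (N / x ^ 4)) / (K : ℝ) ^ 2 := by
        gcongr
        exact (integral_re_quad_sub_trace_sq_le _).trans
          (mul_le_mul_of_nonneg_left h1 (by linarith [fourthMoment_nonneg]))
    _ = _ := by rw [← mul_div_assoc, div_div, mul_comm ((K : ℝ) ^ 2)]

lemma integrable_colForm_sub_sq (P : Matrix (Fin N) (Fin N) ℂ) (a : ℝ) :
    Integrable (fun y => (colForm K P y - a) ^ 2) (columnLaw N) :=
  ((memLp_colForm K).sub (memLp_const a)).integrable_sq

lemma integrable_colForm₂_sub_sq (P : Matrix (Fin N) (Fin N) ℂ) (a : ℝ) :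
    Integrable (fun y => (colForm₂ K P y - a) ^ 2) (columnLaw N) :=
  ((memLp_colForm₂ K).sub (memLp_const a)).integrable_sq

lemma abs_integral_phi_colForm_sub_le (h : BoundedBelow x P) :
    |∫ y, phi (colForm K P y) ∂(columnLaw N) - phi (ntr K P)|
      ≤ 2 * fourthMoment * N / (K ^ 2 * x ^ 2) :=
  (abs_integral_phi_sub_le (memLp_colForm K) (colForm_nonneg K h) (integral_colForm K)).trans
    (integral_colForm_sub_sq_le K h)

/-- The change of `ntr` caused by a column `y` is `-colForm₂ / (1 + colForm) / K`; its fluctuation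
over `y` is of the order of the fluctuations of the two quadratic forms. -/
lemma sq_ratio_sub_le (h : BoundedBelow x P) (y : Fin N → ℂ) :
    (colForm₂ K P y / (1 + colForm K P y) - ntr₂ K P / (1 + ntr K P)) ^ 2
      ≤ 2 * (colForm₂ K P y - ntr₂ K P) ^ 2 + 2 / x ^ 2 * (colForm K P y - ntr K P) ^ 2 := by
  have hs := colForm_nonneg K h y
  have ht := ntr_nonneg K h
  have hq := ntr₂_nonneg K h
  have hqt := ntr₂_le K h
  have hx := h.pos
  set s := colForm K P y
  set t := ntr K P
  set q := colForm₂ K P y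
  set p := ntr₂ K P
  have e : q / (1 + s) - p / (1 + t)
      = (q - p) / (1 + s) + (p / (1 + t)) * ((t - s) / (1 + s)) := by field_simp; ring
  have h1 : ((q - p) / (1 + s)) ^ 2 ≤ (q - p) ^ 2 := by
    rw [div_pow]; exact div_le_self (sq_nonneg _) (by nlinarith)
  have h2 : ((t - s) / (1 + s)) ^ 2 ≤ (s - t) ^ 2 := by
    rw [div_pow, ← neg_sub, neg_sq]; exact div_le_self (sq_nonneg _) (by nlinarith)
  have h3 : p / (1 + t) ≤ 1 / x := by
    rw [div_le_div_iff₀ (by positivity) hx]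
    rw [le_div_iff₀ hx] at hqt; linarith
  have h4 : (p / (1 + t)) ^ 2 ≤ 1 / x ^ 2 := by
    rw [← _root_.one_div_pow]; exact pow_le_pow_left₀ (by positivity) h3 2
  have h5 : ((p / (1 + t)) * ((t - s) / (1 + s))) ^ 2 ≤ 1 / x ^ 2 * (s - t) ^ 2 := by
    rw [mul_pow]; exact mul_le_mul h4 h2 (sq_nonneg _) (by positivity)
  rw [e]
  have h6 : 2 / x ^ 2 * (s - t) ^ 2 = 2 * (1 / x ^ 2 * (s - t) ^ 2) := by ring
  rw [h6]
  nlinarith [sq_nonneg ((q - p) / (1 + s) - (p / (1 + t)) * ((t - s) / (1 + s)))]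

lemma measurable_quad (D : Matrix (Fin N) (Fin N) ℂ) : Measurable fun y => (quad D y).re := by
  have : Continuous fun y => (quad D y).re := by
    simp only [quad_eq_sum]; fun_prop
  exact this.measurable

lemma integrable_ratio_sub_sq (h : BoundedBelow x P) :
    Integrable (fun y => (colForm₂ K P y / (1 + colForm K P y) - ntr₂ K P / (1 + ntr K P)) ^ 2)
      (columnLaw N) := by
  refine Integrable.mono' (((integrable_colForm₂_sub_sq K P (ntr₂ K P)).const_mul 2).add
    ((integrable_colForm_sub_sq K P (ntr K P)).const_mul (2 / x ^ 2))) ?_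
    (Eventually.of_forall fun y => ?_)
  · have h1 := measurable_quad P⁻¹
    have h2 := measurable_quad (P⁻¹ * P⁻¹)
    unfold colForm₂ colForm
    exact Measurable.aestronglyMeasurable (by fun_prop)
  · rw [Real.norm_of_nonneg (sq_nonneg _)]
    exact sq_ratio_sub_le K h y

lemma integral_ratio_sub_sq_le (h : BoundedBelow x P) :
    ∫ y, (colForm₂ K P y / (1 + colForm K P y) - ntr₂ K P / (1 + ntr K P)) ^ 2 ∂(columnLaw N)
      ≤ 8 * fourthMoment * N / (K ^ 2 * x ^ 4) := by
  have hx := h.pos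
  refine (integral_mono (integrable_ratio_sub_sq K h)
    (((integrable_colForm₂_sub_sq K P (ntr₂ K P)).const_mul 2).add
    ((integrable_colForm_sub_sq K P (ntr K P)).const_mul (2 / x ^ 2)))
    (sq_ratio_sub_le K h)).trans ?_
  rw [integral_add' ((integrable_colForm₂_sub_sq K P (ntr₂ K P)).const_mul 2)
    ((integrable_colForm_sub_sq K P (ntr K P)).const_mul (2 / x ^ 2)), integral_const_mul,
    integral_const_mul]
  have h1 := integral_colForm₂_sub_sq_le K h
  have h2 := mul_le_mul_of_nonneg_left (integral_colForm_sub_sq_le K h)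
    (by positivity : 0 ≤ 2 / x ^ 2)
  have e : 8 * fourthMoment * N / (K ^ 2 * x ^ 4)
      = 2 * (2 * fourthMoment * N / (K ^ 2 * x ^ 4))
        + 2 / x ^ 2 * (2 * fourthMoment * N / (K ^ 2 * x ^ 2)) := by
    rcases Nat.eq_zero_or_pos K with rfl | hK
    · simp
    · have : (0 : ℝ) < K := by exact_mod_cast hK
      field_simp; ring
  linarith

lemma sq_log_sub_le (h : BoundedBelow x P) (y : Fin N → ℂ) :
    (Real.log (1 + colForm K P y) - Real.log (1 + ntr K P)) ^ 2
      ≤ (colForm K P y - ntr K P) ^ 2 := by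
  have hs := colForm_nonneg K h y
  have ht := ntr_nonneg K h
  have key : ∀ a b : ℝ, 0 ≤ a → 0 ≤ b → Real.log (1 + a) - Real.log (1 + b) ≤ |a - b| := by
    intro a b ha hb
    rw [← Real.log_div (by positivity) (by positivity)]
    refine (Real.log_le_sub_one_of_pos (by positivity)).trans ?_
    have : (1 + a) / (1 + b) - 1 = (a - b) / (1 + b) := by field_simp; ring
    rw [this]
    refine (le_abs_self _).trans ?_
    rw [abs_div, abs_of_pos (by positivity : 0 < 1 + b)]
    exact div_le_self (abs_nonneg _) (by linarith)
  rw [sq_le_sq]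
  refine abs_le'.2 ⟨key _ _ hs ht, ?_⟩
  rw [neg_sub, abs_sub_comm]
  exact key _ _ ht hs

lemma integrable_log_sub_sq (h : BoundedBelow x P) :
    Integrable (fun y => (Real.log (1 + colForm K P y) - Real.log (1 + ntr K P)) ^ 2)
      (columnLaw N) := by
  refine Integrable.mono' (integrable_colForm_sub_sq K P (ntr K P)) ?_
    (Eventually.of_forall fun y => ?_)
  · have h1 := measurable_quad P⁻¹
    unfold colForm
    exact Measurable.aestronglyMeasurable (by fun_prop)
  · rw [Real.norm_of_nonneg (sq_nonneg _)]
    exact sq_log_sub_le K h y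

lemma integral_log_sub_sq_le (h : BoundedBelow x P) :
    ∫ y, (Real.log (1 + colForm K P y) - Real.log (1 + ntr K P)) ^ 2 ∂(columnLaw N)
      ≤ 2 * fourthMoment * N / (K ^ 2 * x ^ 2) :=
  (integral_mono (integrable_log_sub_sq K h) (integrable_colForm_sub_sq K P _)
    (sq_log_sub_le K h)).trans (integral_colForm_sub_sq_le K h)

end Column

/-! ### The channel resolvent and its columns -/

section Channel

variable {N K : ℕ}

/-- The regularized Gram matrix `H Hᴴ / K + x`. -/
def regGram (x : ℝ) (H : Matrix (Fin N) (Fin K) ℂ) : Matrix (Fin N) (Fin N) ℂ :=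
  gram H + (x : ℂ) • (1 : Matrix (Fin N) (Fin N) ℂ)

lemma gram_posSemidef (H : Matrix (Fin N) (Fin K) ℂ) : (gram H).PosSemidef := by
  unfold gram
  refine (posSemidef_self_mul_conjTranspose H).smul ?_
  rw [show (1 / (K : ℂ)) = ((1 / (K : ℝ) : ℝ) : ℂ) by push_cast; rfl]
  exact_mod_cast (by positivity : (0 : ℝ) ≤ 1 / (K : ℝ))

lemma boundedBelow_regGram {x : ℝ} (hx : 0 < x) (H : Matrix (Fin N) (Fin K) ℂ) :
    BoundedBelow x (regGram x H) :=
  ⟨hx, by unfold regGram; simpa using gram_posSemidef H⟩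

/-- The channel matrix with columns `h k`. -/
def chan (h : Fin K → Fin N → ℂ) : Matrix (Fin N) (Fin K) ℂ := (Matrix.of h)ᵀ

lemma chan_apply (h : Fin K → Fin N → ℂ) (i : Fin N) (k : Fin K) : chan h i k = h k i := rfl

lemma gram_chan (h : Fin K → Fin N → ℂ) :
    gram (chan h) = ∑ k, vecMulVec (((√K)⁻¹ : ℝ) • h k) (star (((√K)⁻¹ : ℝ) • h k)) := by
  have hs : ((√K)⁻¹ : ℝ) * (√K)⁻¹ = (K : ℝ)⁻¹ := by
    rw [← mul_inv, Real.mul_self_sqrt (Nat.cast_nonneg _)]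
  ext i j
  simp only [gram, Matrix.smul_apply, mul_apply, conjTranspose_apply, chan_apply, Matrix.sum_apply,
    vecMulVec_apply, Pi.smul_apply, Pi.star_apply, smul_eq_mul, Finset.mul_sum, star_smul]
  refine Finset.sum_congr rfl fun k _ => ?_
  simp only [Complex.real_smul, star_trivial]
  have hs' : (((√K)⁻¹ : ℝ) : ℂ) * (((√K)⁻¹ : ℝ) : ℂ) = (K : ℂ)⁻¹ := by
    rw [← Complex.ofReal_mul, hs, Complex.ofReal_inv, Complex.ofReal_natCast]
  rw [one_div, ← hs']; ring

/-- The regularized Gram matrix without the contribution of column `k`. -/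
def cutGram (x : ℝ) (h : Fin K → Fin N → ℂ) (k : Fin K) : Matrix (Fin N) (Fin N) ℂ :=
  regGram x (chan (Function.update h k 0))

lemma cutGram_update (x : ℝ) (h : Fin K → Fin N → ℂ) (k : Fin K) (y : Fin N → ℂ) :
    cutGram x (Function.update h k y) k = cutGram x h k := by
  simp [cutGram]

lemma boundedBelow_cutGram {x : ℝ} (hx : 0 < x) (h : Fin K → Fin N → ℂ) (k : Fin K) :
    BoundedBelow x (cutGram x h k) := boundedBelow_regGram hx _

lemma regGram_chan_eq (x : ℝ) (h : Fin K → Fin N → ℂ) (k : Fin K) :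
    regGram x (chan h) = cutGram x h k
      + vecMulVec (((√K)⁻¹ : ℝ) • h k) (star (((√K)⁻¹ : ℝ) • h k)) := by
  unfold cutGram regGram
  rw [gram_chan, gram_chan, ← Finset.add_sum_erase _ _ (Finset.mem_univ k),
    ← Finset.add_sum_erase _ (fun i => vecMulVec (((√K)⁻¹ : ℝ) • Function.update h k 0 i) _)
      (Finset.mem_univ k)]
  have : ∀ i ∈ Finset.univ.erase k, vecMulVec (((√K)⁻¹ : ℝ) • Function.update h k 0 i)
      (star (((√K)⁻¹ : ℝ) • Function.update h k 0 i))
      = vecMulVec (((√K)⁻¹ : ℝ) • h i) (star (((√K)⁻¹ : ℝ) • h i)) := fun i hi => by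
    rw [Function.update_of_ne (Finset.ne_of_mem_erase hi)]
  rw [Finset.sum_congr rfl this]
  simp only [Function.update_self, smul_zero, zero_vecMulVec, zero_add]
  abel

lemma quad_scaled_re (D : Matrix (Fin N) (Fin N) ℂ) (y : Fin N → ℂ) :
    (quad D (((√K)⁻¹ : ℝ) • y)).re = (quad D y).re / K := by
  have hs : (((√K)⁻¹ : ℝ) : ℂ) ^ 2 = (((K : ℝ)⁻¹ : ℝ) : ℂ) := by
    rw [← Complex.ofReal_pow, inv_pow, Real.sq_sqrt (Nat.cast_nonneg _)]
  have := quad_smul_vec ((√K)⁻¹) D y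
  rw [hs] at this
  change (quad D ((((√K)⁻¹ : ℝ) : ℂ) • y)).re = _
  rw [this, Complex.re_ofReal_mul, div_eq_inv_mul]

lemma ntr_regGram {x : ℝ} (hx : 0 < x) (h : Fin K → Fin N → ℂ) (k : Fin K) :
    ntr K (regGram x (chan h)) = ntr K (cutGram x h k)
      - colForm₂ K (cutGram x h k) (h k) / (1 + colForm K (cutGram x h k) (h k)) / K := by
  unfold ntr
  rw [regGram_chan_eq x h k, (boundedBelow_cutGram hx h k).trace_inv_add_rankOne, quad_scaled_re,
    quad_scaled_re, sub_div]
  rfl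

lemma det_regGram {x : ℝ} (hx : 0 < x) (h : Fin K → Fin N → ℂ) (k : Fin K) :
    (det (regGram x (chan h))).re
      = (det (cutGram x h k)).re * (1 + colForm K (cutGram x h k) (h k)) := by
  rw [regGram_chan_eq x h k, (boundedBelow_cutGram hx h k).det_add_rankOne, quad_scaled_re]
  rfl

lemma colForm_regGram {x : ℝ} (hx : 0 < x) (h : Fin K → Fin N → ℂ) (k : Fin K) :
    colForm K (regGram x (chan h)) (h k) = phi (colForm K (cutGram x h k) (h k)) := by
  have := (boundedBelow_cutGram hx h k).quad_inv_add_rankOne (((√K)⁻¹ : ℝ) • h k)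
  rw [← regGram_chan_eq x h k, quad_scaled_re, quad_scaled_re] at this
  exact this

/-- The `K × K` matrix `Hᴴ (H Hᴴ / K + x)⁻¹ H / K`. -/
def bMat (x : ℝ) (H : Matrix (Fin N) (Fin K) ℂ) : Matrix (Fin K) (Fin K) ℂ :=
  (1 / (K : ℂ)) • (Hᴴ * (regGram x H)⁻¹ * H)

lemma bMat_isHermitian {x : ℝ} (hx : 0 < x) (H : Matrix (Fin N) (Fin K) ℂ) :
    (bMat x H).IsHermitian := by
  rw [IsHermitian, bMat, conjTranspose_smul, conjTranspose_mul, conjTranspose_mul,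
    (boundedBelow_regGram hx H).inv_isHermitian.eq, conjTranspose_conjTranspose, Matrix.mul_assoc]
  simp

/-- With `one_sub_bMat`, this says that the eigenvalues of `bMat` lie between `0` and `1`; the
difference is `x Hᴴ (H Hᴴ / K + x)⁻² H / K`. -/
lemma bMat_sub_sq {x : ℝ} (hx : 0 < x) (H : Matrix (Fin N) (Fin K) ℂ) :
    (bMat x H - bMat x H * bMat x H).PosSemidef := by
  have hP := boundedBelow_regGram hx H
  set Q := (regGram x H)⁻¹ with hQ
  have hg : gram H = regGram x H - (x : ℂ) • 1 := by unfold regGram; simp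
  have h1 : bMat x H * bMat x H = (1 / (K : ℂ)) • (Hᴴ * (Q * gram H * Q) * H) := by
    unfold bMat gram
    simp only [Matrix.smul_mul, Matrix.mul_smul, Matrix.mul_assoc]
    rfl
  have h2 : Q * gram H * Q = Q - (x : ℂ) • (Q * Q) := by
    rw [hg, Matrix.mul_sub, Matrix.sub_mul, nonsing_inv_mul _ hP.isUnit_det, Matrix.one_mul,
      Matrix.mul_smul, Matrix.mul_one, Matrix.smul_mul]
  have h3 : bMat x H - bMat x H * bMat x H
      = ((x : ℂ) * (1 / (K : ℂ))) • (Hᴴ * (Q * Q) * H) := by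
    rw [h1, h2, bMat, ← smul_sub, ← Matrix.sub_mul, ← Matrix.mul_sub, sub_sub_cancel,
      Matrix.mul_smul, Matrix.smul_mul, smul_smul, mul_comm (x : ℂ)]
  rw [h3]
  refine (hP.inv_sq_posSemidef.conjTranspose_mul_mul_same H).smul ?_
  rw [show (x : ℂ) * (1 / (K : ℂ)) = ((x * (1 / (K : ℝ)) : ℝ) : ℂ) by push_cast; rfl]
  exact_mod_cast (by positivity : (0 : ℝ) ≤ x * (1 / (K : ℝ)))

lemma one_sub_bMat {x : ℝ} (hx : 0 < x) (H : Matrix (Fin N) (Fin K) ℂ) :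
    (1 - bMat x H).PosSemidef := by
  have hH : (1 - bMat x H).IsHermitian := isHermitian_one.sub (bMat_isHermitian hx H)
  have h1 : ((1 - bMat x H) * (1 - bMat x H)).PosSemidef := by
    have := posSemidef_conjTranspose_mul_self (1 - bMat x H)
    rwa [hH.eq] at this
  convert h1.add (bMat_sub_sq hx H) using 1
  simp only [Matrix.sub_mul, Matrix.mul_sub, Matrix.one_mul, Matrix.mul_one]
  abel

lemma bMat_apply (x : ℝ) (h : Fin K → Fin N → ℂ) (i j : Fin K) :
    bMat x (chan h) i j = (1 / (K : ℂ)) * (star (h i) ⬝ᵥ (regGram x (chan h))⁻¹ *ᵥ h j) := by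
  rw [bMat, Matrix.smul_apply, smul_eq_mul, Matrix.mul_assoc]
  simp only [mul_apply, dotProduct, mulVec, conjTranspose_apply, chan_apply, Pi.star_apply]

/-- A diagonal entry of `bMat` is a function of one column and of the resolvent of the others. -/
lemma bMat_diag {x : ℝ} (hx : 0 < x) (h : Fin K → Fin N → ℂ) (k : Fin K) :
    bMat x (chan h) k k = (phi (colForm K (cutGram x h k) (h k)) : ℂ) := by
  rw [bMat_apply, ← colForm_regGram hx, ← quad,
    quad_eq_ofReal_re (boundedBelow_regGram hx _).inv_isHermitian, colForm]
  push_cast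
  ring

lemma trace_bMat {x : ℝ} (hx : 0 < x) (H : Matrix (Fin N) (Fin K) ℂ) :
    trace (bMat x H) = N - x * trace (regGram x H)⁻¹ := by
  have hP := boundedBelow_regGram hx H
  have h1 : trace (bMat x H) = trace ((regGram x H)⁻¹ * gram H) := by
    rw [bMat, gram, trace_smul, trace_mul_cycle, Matrix.mul_smul, trace_smul, trace_mul_comm]
  have hg : gram H = regGram x H - (x : ℂ) • 1 := by unfold regGram; simp
  rw [h1, hg, Matrix.mul_sub, nonsing_inv_mul _ hP.isUnit_det, trace_sub, trace_one,
    Matrix.mul_smul, Matrix.mul_one, trace_smul, Fintype.card_fin, smul_eq_mul]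

/-- The average of the diagonal entries of `bMat` in terms of the normalized trace. -/
lemma sum_phi_eq {x : ℝ} (hx : 0 < x) (h : Fin K → Fin N → ℂ) :
    (∑ k, phi (colForm K (cutGram x h k) (h k))) / K
      = N / K - x * ntr K (regGram x (chan h)) := by
  have h1 := congrArg Complex.re (trace_bMat hx (chan h))
  rw [trace, Complex.re_sum] at h1
  simp only [diag_apply, bMat_diag hx, Complex.ofReal_re] at h1
  rw [h1, Complex.sub_re, Complex.natCast_re, Complex.re_ofReal_mul, sub_div, ntr, mul_div_assoc]

/-- The squares in a row of `bMat` sum to a diagonal entry of `bMat * bMat`, which is at most the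
one of `bMat`. -/
lemma norm_bMat_row_le {x : ℝ} (hx : 0 < x) (H : Matrix (Fin N) (Fin K) ℂ) (i : Fin K) :
    ∑ j, ‖bMat x H i j‖ ^ 2 ≤ 1 := by
  have h1 := (Complex.nonneg_iff.1 ((bMat_sub_sq hx H).diag_nonneg (i := i))).1
  have h2 := (Complex.nonneg_iff.1 ((one_sub_bMat hx H).diag_nonneg (i := i))).1
  have h3 : ((bMat x H * bMat x H) i i).re = ∑ j, ‖bMat x H i j‖ ^ 2 := by
    nth_rewrite 2 [← (bMat_isHermitian hx H).eq]
    rw [mul_apply, Complex.re_sum]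
    refine Finset.sum_congr rfl fun j _ => ?_
    rw [conjTranspose_apply, RCLike.star_def, Complex.mul_conj']
    norm_cast
  simp only [Matrix.sub_apply, Complex.sub_re, one_apply_eq, Complex.one_re] at h1 h2
  linarith

lemma norm_bMat_le {x : ℝ} (hx : 0 < x) (H : Matrix (Fin N) (Fin K) ℂ) (i j : Fin K) :
    ‖bMat x H i j‖ ≤ 1 := by
  have h1 := norm_bMat_row_le hx H i
  have h2 : ‖bMat x H i j‖ ^ 2 ≤ ∑ j, ‖bMat x H i j‖ ^ 2 :=
    Finset.single_le_sum (f := fun j => ‖bMat x H i j‖ ^ 2) (fun _ _ => by positivity)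
      (Finset.mem_univ j)
  have h3 := norm_nonneg (bMat x H i j)
  nlinarith

/-! ### Continuity in the channel -/

lemma continuous_regGram (x : ℝ) :
    Continuous fun H : Matrix (Fin N) (Fin K) ℂ => regGram x H := by
  unfold regGram gram
  fun_prop

lemma continuous_regGram_inv {x : ℝ} (hx : 0 < x) :
    Continuous fun H : Matrix (Fin N) (Fin K) ℂ => (regGram x H)⁻¹ := by
  have hc := continuous_regGram (N := N) (K := K) x
  simp only [inv_def, Ring.inverse_eq_inv']
  exact (hc.matrix_det.inv₀ fun H => (boundedBelow_regGram hx H).isUnit_det.ne_zero).smul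
    hc.matrix_adjugate

lemma continuous_chan : Continuous (chan : (Fin K → Fin N → ℂ) → Matrix (Fin N) (Fin K) ℂ) := by
  unfold chan
  exact Continuous.matrix_transpose continuous_id

lemma continuous_bMat {x : ℝ} (hx : 0 < x) :
    Continuous fun H : Matrix (Fin N) (Fin K) ℂ => bMat x H := by
  have := continuous_regGram_inv (N := N) (K := K) hx
  unfold bMat
  fun_prop

lemma continuous_ntr {x : ℝ} (hx : 0 < x) :
    Continuous fun h : Fin K → Fin N → ℂ => ntr K (regGram x (chan h)) := by
  have := (continuous_regGram_inv (N := N) (K := K) hx).comp continuous_chan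
  unfold ntr
  exact (Complex.continuous_re.comp (Continuous.matrix_trace this)).div_const _

lemma continuous_cut (k : Fin K) :
    Continuous fun h : Fin K → Fin N → ℂ => Function.update h k (0 : Fin N → ℂ) :=
  continuous_id.update k continuous_const

lemma continuous_cutGram_inv {x : ℝ} (hx : 0 < x) (k : Fin K) :
    Continuous fun h : Fin K → Fin N → ℂ => (cutGram x h k)⁻¹ :=
  ((continuous_regGram_inv (N := N) (K := K) hx).comp continuous_chan).comp (continuous_cut k)

lemma continuous_ntr_cut {x : ℝ} (hx : 0 < x) (k : Fin K) :
    Continuous fun h : Fin K → Fin N → ℂ => ntr K (cutGram x h k) :=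
  (continuous_ntr hx).comp (continuous_cut k)

lemma continuous_ntr₂_cut {x : ℝ} (hx : 0 < x) (k : Fin K) :
    Continuous fun h : Fin K → Fin N → ℂ => ntr₂ K (cutGram x h k) := by
  have := continuous_cutGram_inv (N := N) hx k
  unfold ntr₂
  exact (Complex.continuous_re.comp (Continuous.matrix_trace (this.matrix_mul this))).div_const _

lemma continuous_colForm_cut {x : ℝ} (hx : 0 < x) (k : Fin K) :
    Continuous fun h : Fin K → Fin N → ℂ => colForm K (cutGram x h k) (h k) := by
  have := continuous_cutGram_inv (N := N) hx k
  unfold colForm quad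
  refine (Complex.continuous_re.comp (Continuous.dotProduct ?_ ?_)).div_const _
  · fun_prop
  · exact this.matrix_mulVec (continuous_apply k)

end Channel

/-! ### The log-determinant and its derivative -/

section LogDet

variable {m : Type*} [Fintype m] [DecidableEq m]

lemma det_one_add_smul_eq_prod {G : Matrix m m ℂ} (hG : G.IsHermitian) (a : ℝ) :
    det (1 + (a : ℂ) • G) = ((∏ i, (1 + a * hG.eigenvalues i) : ℝ) : ℂ) := by
  set Φ := Unitary.conjStarAlgAut ℂ (Matrix m m ℂ) hG.eigenvectorUnitary with hΦ
  have h1 : 1 + (a : ℂ) • G = Φ (diagonal fun i => ((1 + a * hG.eigenvalues i : ℝ) : ℂ)) := by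
    have : (diagonal fun i => ((1 + a * hG.eigenvalues i : ℝ) : ℂ))
        = 1 + (a : ℂ) • diagonal (RCLike.ofReal ∘ hG.eigenvalues) := by
      ext i j
      by_cases hij : i = j
      · subst hij; simp
      · simp [hij]
    rw [this, map_add, map_one, map_smul, ← hG.spectral_theorem]
  rw [h1, hΦ, Unitary.conjStarAlgAut_apply, det_mul_right_comm,
    (Unitary.mem_iff.1 hG.eigenvectorUnitary.2).2, Matrix.one_mul, det_diagonal]
  push_cast; rfl

lemma trace_inv_add_smul_eq_sum {G : Matrix m m ℂ} (hG : G.PosSemidef) {x : ℝ} (hx : 0 < x) :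
    trace (G + (x : ℂ) • (1 : Matrix m m ℂ))⁻¹
      = ((∑ i, (hG.1.eigenvalues i + x)⁻¹ : ℝ) : ℂ) := by
  set Φ := Unitary.conjStarAlgAut ℂ (Matrix m m ℂ) hG.1.eigenvectorUnitary with hΦ
  have hne : ∀ i, hG.1.eigenvalues i + x ≠ 0 := fun i => by
    have := hG.eigenvalues_nonneg i; positivity
  have h1 : G + (x : ℂ) • (1 : Matrix m m ℂ)
      = Φ (diagonal fun i => ((hG.1.eigenvalues i + x : ℝ) : ℂ)) := by
    have : (diagonal fun i => ((hG.1.eigenvalues i + x : ℝ) : ℂ))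
        = diagonal (RCLike.ofReal ∘ hG.1.eigenvalues) + (x : ℂ) • (1 : Matrix m m ℂ) := by
      ext i j
      by_cases hij : i = j
      · subst hij; simp
      · simp [hij]
    rw [this, map_add, map_smul, map_one, ← hG.1.spectral_theorem]
  have h2 : (G + (x : ℂ) • (1 : Matrix m m ℂ))⁻¹
      = Φ (diagonal fun i => (((hG.1.eigenvalues i + x)⁻¹ : ℝ) : ℂ)) := by
    refine inv_eq_right_inv ?_
    rw [h1, ← map_mul, diagonal_mul_diagonal]
    have : (fun i => ((hG.1.eigenvalues i + x : ℝ) : ℂ) * (((hG.1.eigenvalues i + x)⁻¹ : ℝ) : ℂ))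
        = fun _ => 1 := by
      ext i
      rw [← Complex.ofReal_mul, mul_inv_cancel₀ (hne i), Complex.ofReal_one]
    rw [this, diagonal_one, map_one]
  rw [h2, hΦ, Unitary.conjStarAlgAut_apply, trace_mul_cycle,
    (Unitary.mem_iff.1 hG.1.eigenvectorUnitary.2).1, Matrix.one_mul, trace_diagonal,
    Complex.ofReal_sum]

end LogDet

section LogDetChannel

variable {N K : ℕ}

/-- The log-determinant `log det (I + H Hᴴ / (K x))`. -/
def logDet (x : ℝ) (H : Matrix (Fin N) (Fin K) ℂ) : ℝ :=
  Real.log (det (1 + (1 / (x : ℂ)) • gram H)).re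

lemma logDet_eq_sum (x : ℝ) (hx : 0 < x) (H : Matrix (Fin N) (Fin K) ℂ) :
    logDet x H = ∑ i, Real.log (1 + (gram_posSemidef H).1.eigenvalues i / x) := by
  have := det_one_add_smul_eq_prod (gram_posSemidef H).1 (1 / x)
  rw [Complex.ofReal_div, Complex.ofReal_one] at this
  rw [logDet, this, Complex.ofReal_re, Real.log_prod fun i _ => ?_]
  · simp only [one_div_mul_eq_div]
  · have := (gram_posSemidef H).eigenvalues_nonneg i
    positivity

lemma logDet_eq {x : ℝ} (hx : 0 < x) (H : Matrix (Fin N) (Fin K) ℂ) :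
    logDet x H = Real.log (det (regGram x H)).re - N * Real.log x := by
  have hP := (boundedBelow_regGram hx H).det_re_pos
  have h1 : 1 + (1 / (x : ℂ)) • gram H = ((x⁻¹ : ℝ) : ℂ) • regGram x H := by
    have hx' : (x : ℂ) ≠ 0 := by exact_mod_cast hx.ne'
    rw [regGram, smul_add, smul_smul, Complex.ofReal_inv, inv_mul_cancel₀ hx', one_smul, one_div,
      add_comm]
  rw [logDet, h1, det_smul, Fintype.card_fin, ← Complex.ofReal_pow, Complex.re_ofReal_mul,
    Real.log_mul (by positivity) hP.ne', Real.log_pow, Real.log_inv]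
  ring

lemma logDet_nonneg {x : ℝ} (hx : 0 < x) (H : Matrix (Fin N) (Fin K) ℂ) : 0 ≤ logDet x H := by
  rw [logDet_eq_sum x hx]
  refine Finset.sum_nonneg fun i _ => Real.log_nonneg ?_
  have := (gram_posSemidef H).eigenvalues_nonneg i
  have : 0 ≤ (gram_posSemidef H).1.eigenvalues i / x := by positivity
  linarith

lemma logDet_le {x : ℝ} (hx : 0 < x) (H : Matrix (Fin N) (Fin K) ℂ) :
    logDet x H ≤ (trace (gram H)).re / x := by
  rw [logDet_eq_sum x hx, (gram_posSemidef H).1.trace_eq_sum_eigenvalues, Complex.re_sum,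
    Finset.sum_div]
  refine Finset.sum_le_sum fun i _ => ?_
  have := (gram_posSemidef H).eigenvalues_nonneg i
  refine (Real.log_le_sub_one_of_pos (by positivity)).trans ?_
  simp

/-- The derivative of the log-determinant in the regularization parameter. -/
lemma hasDerivAt_logDet {x : ℝ} (hx : 0 < x) (H : Matrix (Fin N) (Fin K) ℂ) :
    HasDerivAt (fun z => logDet z H) ((trace (regGram x H)⁻¹).re - N / x) x := by
  have hG := gram_posSemidef H
  have h1 : (trace (regGram x H)⁻¹).re - N / x
      = ∑ i, ((hG.1.eigenvalues i + x)⁻¹ - x⁻¹) := by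
    rw [regGram, trace_inv_add_smul_eq_sum hG hx, Complex.ofReal_re, Finset.sum_sub_distrib]
    simp [div_eq_mul_inv]
  rw [h1]
  have h2 : HasDerivAt (fun z => ∑ i, Real.log (1 + hG.1.eigenvalues i / z))
      (∑ i, ((hG.1.eigenvalues i + x)⁻¹ - x⁻¹)) x := by
    refine HasDerivAt.fun_sum fun i _ => ?_
    have hl := hG.eigenvalues_nonneg i
    set l := hG.1.eigenvalues i
    have h3 : HasDerivAt (fun z => 1 + l / z) (l * -(x ^ 2)⁻¹) x :=
      ((hasDerivAt_inv hx.ne').const_mul l).const_add 1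
    refine (h3.log (by positivity)).congr_deriv ?_
    have hlx : l + x ≠ 0 := by positivity
    have hlx' : 1 + l / x ≠ 0 := by positivity
    field_simp
    ring
  refine h2.congr_of_eventuallyEq ?_
  filter_upwards [lt_mem_nhds hx] with z hz using logDet_eq_sum z hz H

lemma trace_gram_chan (h : Fin K → Fin N → ℂ) :
    (trace (gram (chan h))).re = (∑ k, ∑ i, ‖h k i‖ ^ 2) / K := by
  rw [gram, trace_smul, smul_eq_mul, show (1 / (K : ℂ)) = ((1 / (K : ℝ) : ℝ) : ℂ) by push_cast; rfl,
    Complex.re_ofReal_mul, trace, Complex.re_sum, Finset.sum_comm, one_div_mul_eq_div]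
  congr 1
  refine Finset.sum_congr rfl fun i _ => ?_
  rw [diag_apply, mul_apply, Complex.re_sum]
  refine Finset.sum_congr rfl fun k _ => ?_
  rw [conjTranspose_apply, RCLike.star_def, Complex.mul_conj', chan_apply]
  norm_cast

lemma continuous_logDet {x : ℝ} (hx : 0 < x) :
    Continuous fun H : Matrix (Fin N) (Fin K) ℂ => logDet x H := by
  have : (fun H : Matrix (Fin N) (Fin K) ℂ => logDet x H)
      = fun H => Real.log (det (regGram x H)).re - N * Real.log x := by
    ext H; exact logDet_eq hx H
  rw [this]
  refine Continuous.sub (Continuous.log ?_ fun H => (boundedBelow_regGram hx H).det_re_pos.ne')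
    continuous_const
  exact Complex.continuous_re.comp (continuous_regGram x).matrix_det

end LogDetChannel

/-! ### Fluctuations of the resolvent trace and of the log-determinant -/

section Fluctuations

variable {N K : ℕ}

/-- The law of `K` independent columns of `N` i.i.d. complex normal entries. -/
abbrev colsLaw (N K : ℕ) : Measure (Fin K → Fin N → ℂ) := Measure.pi fun _ : Fin K => columnLaw N

/-- The mean of the normalized resolvent trace. -/
def meanNtr (N K : ℕ) (x : ℝ) : ℝ := ∫ h, ntr K (regGram x (chan h)) ∂(colsLaw N K)

lemma memLp_ntr {x : ℝ} (hx : 0 < x) :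
    MemLp (fun h : Fin K → Fin N → ℂ => ntr K (regGram x (chan h))) 2 (colsLaw N K) := by
  refine MemLp.of_bound (continuous_ntr hx).aestronglyMeasurable (N / K / x)
    (Eventually.of_forall fun h => ?_)
  rw [Real.norm_of_nonneg (ntr_nonneg K (boundedBelow_regGram hx _))]
  exact ntr_le K (boundedBelow_regGram hx _)

/-- The normalized resolvent trace fluctuates at the scale `1 / K`. -/
lemma variance_ntr_le {x : ℝ} (hx : 0 < x) (hK : 0 < K) :
    ∫ h, (ntr K (regGram x (chan h)) - meanNtr N K x) ^ 2 ∂(colsLaw N K)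
      ≤ 8 * fourthMoment * N / (K ^ 3 * x ^ 4) := by
  have hK' : (0 : ℝ) < K := by exact_mod_cast hK
  have hupd : ∀ (k : Fin K) (h : Fin K → Fin N → ℂ) (y : Fin N → ℂ),
      (ntr K (regGram x (chan (Function.update h k y)))
        - (ntr K (cutGram x h k) - ntr₂ K (cutGram x h k) / (1 + ntr K (cutGram x h k)) / K)) ^ 2
      = (colForm₂ K (cutGram x h k) y / (1 + colForm K (cutGram x h k) y)
          - ntr₂ K (cutGram x h k) / (1 + ntr K (cutGram x h k))) ^ 2 / (K : ℝ) ^ 2 := by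
    intro k h y
    rw [ntr_regGram hx (Function.update h k y) k, cutGram_update, Function.update_self,
      ← div_pow, ← neg_sq]
    congr 1
    ring
  -- the comparison function replaces both quadratic forms in the change caused by column `k` by
  -- their means over that column
  have hmain := efronStein_of_resample (columnLaw N) (n := K)
    (f := fun h => ntr K (regGram x (chan h)))
    (g := fun k h => ntr K (cutGram x h k)
      - ntr₂ K (cutGram x h k) / (1 + ntr K (cutGram x h k)) / K)
    (continuous_ntr hx).measurable (memLp_ntr hx) (fun k => by
      have h1 := (continuous_ntr_cut (N := N) hx k).measurable
      have h2 := (continuous_ntr₂_cut (N := N) hx k).measurable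
      fun_prop) (fun k h y => by simp only [cutGram_update])
    (b := 8 * fourthMoment * N / (K ^ 2 * x ^ 4) / K ^ 2)
    (fun k h => by
      simp only [hupd]
      exact (integrable_ratio_sub_sq K (boundedBelow_cutGram hx h k)).div_const _)
    (fun k h => by
      simp only [hupd]
      rw [integral_div]
      gcongr
      exact integral_ratio_sub_sq_le K (boundedBelow_cutGram hx h k))
  refine hmain.trans (le_of_eq ?_)
  field_simp

/-- Removing one column changes the normalized resolvent trace by `O(1 / K)`. -/
lemma abs_ntr_sub_ntr_cut_le {x : ℝ} (hx : 0 < x) (h : Fin K → Fin N → ℂ) (k : Fin K) :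
    |ntr K (cutGram x h k) - ntr K (regGram x (chan h))| ≤ 1 / (K * x) := by
  have hP := boundedBelow_cutGram hx h k
  have h1 := colForm_nonneg K hP (h k)
  have h2 := colForm₂_nonneg K hP (h k)
  have h3 := colForm₂_le K hP (h k)
  rw [ntr_regGram hx h k, sub_sub_cancel, abs_of_nonneg (by positivity), mul_comm (K : ℝ),
    ← div_div 1 x]
  refine div_le_div_of_nonneg_right ?_ (Nat.cast_nonneg _)
  rw [div_le_div_iff₀ (by positivity) hx]
  rw [le_div_iff₀ hx] at h3
  linarith

lemma integrable_phi_ntr {x : ℝ} (hx : 0 < x) :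
    Integrable (fun h : Fin K → Fin N → ℂ => phi (ntr K (regGram x (chan h)))) (colsLaw N K) := by
  refine Integrable.mono' (integrable_const 1)
    (measurable_phi.comp (continuous_ntr hx).measurable).aestronglyMeasurable
    (Eventually.of_forall fun h => ?_)
  have := ntr_nonneg K (boundedBelow_regGram hx (chan h))
  rw [Real.norm_of_nonneg (phi_nonneg this)]
  exact phi_le_one this

lemma integrable_phi_ntr_cut {x : ℝ} (hx : 0 < x) (k : Fin K) :
    Integrable (fun h : Fin K → Fin N → ℂ => phi (ntr K (cutGram x h k))) (colsLaw N K) := by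
  refine Integrable.mono' (integrable_const 1)
    (measurable_phi.comp (continuous_ntr_cut hx k).measurable).aestronglyMeasurable
    (Eventually.of_forall fun h => ?_)
  have := ntr_nonneg K (boundedBelow_cutGram hx h k)
  rw [Real.norm_of_nonneg (phi_nonneg this)]
  exact phi_le_one this

lemma integrable_phi_colForm_cut {x : ℝ} (hx : 0 < x) (k : Fin K) :
    Integrable (fun h : Fin K → Fin N → ℂ => phi (colForm K (cutGram x h k) (h k)))
      (colsLaw N K) := by
  refine Integrable.mono' (integrable_const 1)
    (measurable_phi.comp (continuous_colForm_cut hx k).measurable).aestronglyMeasurable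
    (Eventually.of_forall fun h => ?_)
  have := colForm_nonneg K (boundedBelow_cutGram hx h k) (h k)
  rw [Real.norm_of_nonneg (phi_nonneg this)]
  exact phi_le_one this

/-- The mean resolvent trace satisfies the equation `x τ + τ / (1 + τ) = N / K` up to `O(1 / K)`. -/
lemma abs_meanNtr_equation_le {x : ℝ} (hx : 0 < x) (hK : 0 < K) :
    |N / K - x * meanNtr N K x - phi (meanNtr N K x)|
      ≤ 2 * fourthMoment * N / (K ^ 2 * x ^ 2) + 1 / (K * x)
        + 8 * fourthMoment * N / (K ^ 3 * x ^ 4) := by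
  have hK' : (0 : ℝ) < K := by exact_mod_cast hK
  have hstep : ∀ k : Fin K,
      |∫ h, phi (colForm K (cutGram x h k) (h k)) ∂(colsLaw N K) - phi (meanNtr N K x)|
      ≤ 2 * fourthMoment * N / (K ^ 2 * x ^ 2) + 1 / (K * x)
        + 8 * fourthMoment * N / (K ^ 3 * x ^ 4) := by
    intro k
    -- average over column `k`
    have h1 : |∫ h, (phi (colForm K (cutGram x h k) (h k)) - phi (ntr K (cutGram x h k)))
        ∂(colsLaw N K)| ≤ 2 * fourthMoment * N / (K ^ 2 * x ^ 2) := by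
      refine abs_integral_le_of_resample k
        ((integrable_phi_colForm_cut hx k).sub (integrable_phi_ntr_cut hx k)) fun h => ?_
      simp only [Pi.sub_apply, cutGram_update, Function.update_self]
      have hP := boundedBelow_cutGram hx h k
      rw [integral_sub ?_ (integrable_const _)]
      · simpa using abs_integral_phi_colForm_sub_le K hP
      · refine Integrable.mono' (integrable_const 1)
          (measurable_phi.comp_aemeasurable (memLp_colForm K).aemeasurable).aestronglyMeasurable
          (Eventually.of_forall fun y => ?_)
        rw [Real.norm_of_nonneg (phi_nonneg (colForm_nonneg K hP y))]
        exact phi_le_one (colForm_nonneg K hP y)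
    -- restore column `k` in the resolvent
    have h2 : |∫ h, (phi (ntr K (cutGram x h k)) - phi (ntr K (regGram x (chan h))))
        ∂(colsLaw N K)| ≤ 1 / (K * x) := by
      refine abs_integral_le_integral_abs.trans ?_
      calc _ ≤ ∫ _ : Fin K → Fin N → ℂ, 1 / (K * x) ∂(colsLaw N K) := by
            refine integral_mono
              ((integrable_phi_ntr_cut hx k).sub (integrable_phi_ntr hx)).abs
              (integrable_const _) fun h => ?_
            exact (abs_phi_sub_phi_le (ntr_nonneg K (boundedBelow_cutGram hx h k))
              (ntr_nonneg K (boundedBelow_regGram hx _))).trans (abs_ntr_sub_ntr_cut_le hx h k)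
        _ = _ := by simp
    -- interchange the mean and `phi`
    have h3 : |∫ h, phi (ntr K (regGram x (chan h))) ∂(colsLaw N K) - phi (meanNtr N K x)|
        ≤ 8 * fourthMoment * N / (K ^ 3 * x ^ 4) :=
      (abs_integral_phi_sub_le (memLp_ntr hx)
        (fun h => ntr_nonneg K (boundedBelow_regGram hx (chan h))) rfl).trans
        (variance_ntr_le hx hK)
    rw [integral_sub (integrable_phi_colForm_cut hx k) (integrable_phi_ntr_cut hx k)] at h1
    rw [integral_sub (integrable_phi_ntr_cut hx k) (integrable_phi_ntr hx)] at h2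
    rw [abs_le] at *
    constructor <;> linarith [h1.1, h1.2, h2.1, h2.2, h3.1, h3.2]
  -- the mean of `tr B / K`, computed from the diagonal entries of `B = bMat`
  have hsum : N / K - x * meanNtr N K x
      = (∑ k, ∫ h, phi (colForm K (cutGram x h k) (h k)) ∂(colsLaw N K)) / K := by
    rw [← integral_finsetSum _ fun k _ => integrable_phi_colForm_cut hx k, ← integral_div]
    simp only [sum_phi_eq hx]
    rw [integral_sub (integrable_const _) (((memLp_ntr hx).integrable (by norm_num)).const_mul x),
      integral_const_mul]
    simp [meanNtr]
  have hphi : phi (meanNtr N K x) = (∑ _k : Fin K, phi (meanNtr N K x)) / K := by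
    simp only [Finset.sum_const, Finset.card_univ, Fintype.card_fin, nsmul_eq_mul]; field_simp
  rw [hsum, hphi, ← sub_div, ← Finset.sum_sub_distrib, abs_div, abs_of_pos hK', div_le_iff₀ hK']
  refine (Finset.abs_sum_le_sum_abs _ _).trans ((Finset.sum_le_sum fun k _ => hstep k).trans ?_)
  simp only [Finset.sum_const, Finset.card_univ, Fintype.card_fin, nsmul_eq_mul]
  rw [mul_comm]

lemma memLp_entry (k : Fin K) (i : Fin N) :
    MemLp (fun h : Fin K → Fin N → ℂ => h k i) 4 (colsLaw N K) :=
  (memLp_coord N i).comp_measurePreserving (measurePreserving_eval (fun _ : Fin K => columnLaw N) k)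

lemma memLp_trace_gram :
    MemLp (fun h : Fin K → Fin N → ℂ => (trace (gram (chan h))).re) 2 (colsLaw N K) := by
  simp only [trace_gram_chan]
  have : ∀ k i, MemLp (fun h : Fin K → Fin N → ℂ => ‖h k i‖ ^ 2) 2 (colsLaw N K) := by
    intro k i
    have := (memLp_entry (N := N) k i).norm_rpow_div 2
    have e : (4 : ENNReal) / 2 = 2 := by
      rw [show (4 : ENNReal) = 2 * 2 by norm_num,
        ENNReal.mul_div_cancel_right (by norm_num) (by norm_num)]
    rw [e] at this
    refine this.congr_norm ?_ ?_
    · exact (Continuous.pow (by fun_prop) 2).aestronglyMeasurable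
    · exact Eventually.of_forall fun h => by simp
  exact (memLp_finsetSum _ fun k _ => memLp_finsetSum _ fun i _ => this k i).mul_const ((K : ℝ)⁻¹)

lemma integral_trace_gram (hK : 0 < K) :
    ∫ h, (trace (gram (chan h))).re ∂(colsLaw N K) = N := by
  have hK' : (0 : ℝ) < K := by exact_mod_cast hK
  simp only [trace_gram_chan]
  have hI : ∀ k i, Integrable (fun h : Fin K → Fin N → ℂ => ‖h k i‖ ^ 2) (colsLaw N K) :=
    fun k i =>
      ((memLp_entry k i).mono_exponent (by norm_num : (2 : ENNReal) ≤ 4)).norm.integrable_sq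
  have h1 : ∀ k i, ∫ h : Fin K → Fin N → ℂ, ‖h k i‖ ^ 2 ∂(colsLaw N K) = 1 := by
    intro k i
    have hmp := measurePreserving_eval (fun _ : Fin K => columnLaw N) k
    have h := integral_map (f := fun v : Fin N → ℂ => ‖v i‖ ^ 2)
      (hmp.measurable.aemeasurable (μ := colsLaw N K))
      (Continuous.aestronglyMeasurable (by fun_prop))
    rw [hmp.map_eq, integral_coord N i (F := fun z => ‖z‖ ^ 2) (by fun_prop),
      integral_norm_sq_complexNormal] at h
    exact h.symm
  rw [integral_div, integral_finsetSum _ fun k _ => integrable_finsetSum _ fun i _ => hI k i]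
  simp only [integral_finsetSum _ fun i _ => hI _ i, h1]
  simp; field_simp

lemma memLp_logDet {x : ℝ} (hx : 0 < x) :
    MemLp (fun h : Fin K → Fin N → ℂ => logDet x (chan h)) 2 (colsLaw N K) := by
  refine (memLp_trace_gram.mul_const x⁻¹).mono
    ((continuous_logDet hx).comp continuous_chan).aestronglyMeasurable
    (Eventually.of_forall fun h => ?_)
  rw [Real.norm_of_nonneg (logDet_nonneg hx _)]
  exact (logDet_le hx _).trans (le_abs_self _)

/-- The mean of the log-determinant. -/
def meanLogDet (N K : ℕ) (x : ℝ) : ℝ := ∫ h, logDet x (chan h) ∂(colsLaw N K)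

/-- The log-determinant has bounded variance. -/
lemma variance_logDet_le {x : ℝ} (hx : 0 < x) (hK : 0 < K) :
    ∫ h, (logDet x (chan h) - meanLogDet N K x) ^ 2 ∂(colsLaw N K)
      ≤ 2 * fourthMoment * N / (K * x ^ 2) := by
  have hK' : (0 : ℝ) < K := by exact_mod_cast hK
  have hupd : ∀ (k : Fin K) (h : Fin K → Fin N → ℂ) (y : Fin N → ℂ),
      logDet x (chan (Function.update h k y))
        - (logDet x (chan (Function.update h k 0)) + Real.log (1 + ntr K (cutGram x h k)))
      = Real.log (1 + colForm K (cutGram x h k) y) - Real.log (1 + ntr K (cutGram x h k)) := by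
    intro k h y
    have hP := boundedBelow_cutGram hx h k
    have h1 := hP.det_re_pos
    have h2 := colForm_nonneg K hP y
    rw [logDet_eq hx, logDet_eq hx, det_regGram hx (Function.update h k y) k, cutGram_update,
      Function.update_self, Real.log_mul h1.ne' (by positivity)]
    simp only [cutGram]
    ring
  -- the comparison function is the log-determinant without column `k`, corrected by the typical
  -- size of the increment which that column causes
  have hmain := efronStein_of_resample (columnLaw N) (n := K)
    (f := fun h => logDet x (chan h))
    (g := fun k h => logDet x (chan (Function.update h k 0))
      + Real.log (1 + ntr K (cutGram x h k)))
    ((continuous_logDet hx).comp continuous_chan).measurable (memLp_logDet hx) (fun k => by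
      have h1 := (continuous_ntr_cut (N := N) hx k).measurable
      have h2 := (((continuous_logDet (N := N) hx).comp continuous_chan).comp
        (continuous_cut k)).measurable
      exact h2.add (by fun_prop)) (fun k h y => by simp [cutGram_update])
    (b := 2 * fourthMoment * N / (K ^ 2 * x ^ 2))
    (fun k h => by
      simp only [hupd]
      exact integrable_log_sub_sq K (boundedBelow_cutGram hx h k))
    (fun k h => by
      simp only [hupd]
      exact integral_log_sub_sq_le K (boundedBelow_cutGram hx h k))
  refine hmain.trans (le_of_eq ?_)
  field_simp

/-- Differentiation of the mean log-determinant under the integral sign. -/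
lemma hasDerivAt_meanLogDet {x : ℝ} (hx : 0 < x) (hK : 0 < K) :
    HasDerivAt (meanLogDet N K) (K * meanNtr N K x - N / x) x := by
  have hK' : (0 : ℝ) < K := by exact_mod_cast hK
  have hd := hasDerivAt_integral_of_dominated_loc_of_deriv_le (μ := colsLaw N K) (x₀ := x)
    (F := fun z h => logDet z (chan h)) (F' := fun z h => (trace (regGram z (chan h))⁻¹).re - N / z)
    (s := Set.Ioi (x / 2)) (bound := fun _ => N / (x / 2))
    (Ioi_mem_nhds (by linarith))
    (by
      filter_upwards [lt_mem_nhds hx] with z hz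
      exact ((continuous_logDet hz).comp continuous_chan).aestronglyMeasurable)
    ((memLp_logDet hx).integrable (by norm_num))
    (by
      have h1 := (continuous_regGram_inv (N := N) (K := K) hx).comp continuous_chan
      exact ((Complex.continuous_re.comp (Continuous.matrix_trace h1)).sub
        continuous_const).aestronglyMeasurable)
    (Eventually.of_forall fun h z hz => by
      have hz' : x / 2 < z := hz
      have hz0 : 0 < z := by linarith
      have hP := boundedBelow_regGram hz0 (chan h)
      have h1 := hP.trace_inv_le
      have h2 := trace_re_nonneg hP.inv_posSemidef
      rw [Fintype.card_fin] at h1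
      have h3 : (N : ℝ) / z ≤ N / (x / 2) := by gcongr
      rw [Real.norm_eq_abs, abs_le]
      constructor <;> linarith)
    (integrable_const _)
    (Eventually.of_forall fun h z (hz : x / 2 < z) => by
      exact hasDerivAt_logDet (by linarith) (chan h))
  have h2 : ∫ h, ((trace (regGram x (chan h))⁻¹).re - N / x) ∂(colsLaw N K)
      = K * meanNtr N K x - N / x := by
    have h3 : ∀ h : Fin K → Fin N → ℂ, (trace (regGram x (chan h))⁻¹).re
        = K * ntr K (regGram x (chan h)) := fun h => by unfold ntr; field_simp
    simp only [h3]
    rw [integral_sub (((memLp_ntr hx).integrable (by norm_num)).const_mul _) (integrable_const _),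
      integral_const_mul]
    simp [meanNtr]
  rw [← h2]
  exact hd.2

lemma meanLogDet_nonneg {x : ℝ} (hx : 0 < x) : 0 ≤ meanLogDet N K x :=
  integral_nonneg fun _ => logDet_nonneg hx _

lemma meanLogDet_le {x : ℝ} (hx : 0 < x) (hK : 0 < K) : meanLogDet N K x ≤ N / x := by
  refine (integral_mono ((memLp_logDet hx).integrable (by norm_num))
    ((memLp_trace_gram.integrable (by norm_num)).div_const x) fun _ => logDet_le hx _).trans ?_
  rw [integral_div, integral_trace_gram hK]

end Fluctuations

/-! ### The limiting equation and the asymptotic capacity -/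

section Limit

/-- `δ₀` is the nonnegative solution of `x t + t / (1 + t) = c`. -/
lemma delta0_spec {c x : ℝ} (hc : 0 < c) (hx : 0 < x) :
    0 ≤ delta0 c x ∧ x * delta0 c x + phi (delta0 c x) = c := by
  set s := Real.sqrt ((1 - c + x) ^ 2 + 4 * c * x) with hs
  have hs2 : s ^ 2 = (1 - c + x) ^ 2 + 4 * c * x := Real.sq_sqrt (by positivity)
  have hs0 : 0 ≤ s := Real.sqrt_nonneg _
  have hδ : delta0 c x = (c - 1 - x + s) / (2 * x) := by
    unfold delta0; rw [← hs]; field_simp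
  have hge : 1 - c + x ≤ s := by
    refine le_trans (le_abs_self _) (abs_le_of_sq_le_sq ?_ hs0)
    rw [hs2]; nlinarith [mul_pos hc hx]
  have h0 : 0 ≤ delta0 c x := by
    rw [hδ]; exact div_nonneg (by linarith) (by linarith)
  refine ⟨h0, ?_⟩
  have hquad : x * delta0 c x ^ 2 + (x + 1 - c) * delta0 c x - c = 0 := by
    rw [hδ]; field_simp; nlinarith
  unfold phi
  field_simp
  nlinarith

lemma delta0_nonneg {c x : ℝ} (hc : 0 < c) (hx : 0 < x) : 0 ≤ delta0 c x := (delta0_spec hc hx).1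

/-- The capacity as a function of `x = σ²`. -/
def capFun (c x : ℝ) : ℝ :=
  Real.log (1 + delta0 c x) + c * Real.log (1 + 1 / (x * (1 + delta0 c x)))
    - delta0 c x / (1 + delta0 c x)

lemma abs_capFun_le {c x : ℝ} (hc : 0 < c) (hx : 0 < x) : |capFun c x| ≤ 2 * c / x := by
  obtain ⟨h0, h1⟩ := delta0_spec hc hx
  unfold capFun
  set d := delta0 c x
  have hphi : 0 ≤ d / (1 + d) := by positivity
  have hd : d ≤ c / x := by
    rw [le_div_iff₀ hx]; unfold phi at h1; linarith
  have hphi' : d / (1 + d) ≤ d := div_le_self h0 (by linarith)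
  have hl1 : Real.log (1 + d) ≤ d := by
    have := Real.log_le_sub_one_of_pos (by positivity : 0 < 1 + d); linarith
  have hl1' : 0 ≤ Real.log (1 + d) := Real.log_nonneg (by linarith)
  have hq : 0 < 1 / (x * (1 + d)) := by positivity
  have hq' : 1 / (x * (1 + d)) ≤ 1 / x := by
    rw [div_le_div_iff₀ (by positivity) hx]; nlinarith
  have hl2 : Real.log (1 + 1 / (x * (1 + d))) ≤ 1 / x := by
    have := Real.log_le_sub_one_of_pos (by positivity : 0 < 1 + 1 / (x * (1 + d))); linarith
  have hl2' : 0 ≤ Real.log (1 + 1 / (x * (1 + d))) := Real.log_nonneg (by linarith)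
  have h3 : c * Real.log (1 + 1 / (x * (1 + d))) ≤ c / x := by
    rw [div_eq_mul_one_div c x]; exact mul_le_mul_of_nonneg_left hl2 hc.le
  have h4 : 0 ≤ c * Real.log (1 + 1 / (x * (1 + d))) := by positivity
  have h5 : 2 * c / x = c / x + c / x := by ring
  rw [h5, abs_le]
  constructor <;> linarith

/-- The envelope property: `δ₀` is a stationary point of the expression defining the capacity, so
that only the explicit dependence on `x` contributes to the derivative. -/
lemma hasDerivAt_capFun {c x : ℝ} (hc : 0 < c) (hx : 0 < x) :
    HasDerivAt (capFun c) (-(gamma0 c x / x)) x := by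
  obtain ⟨h0, h1⟩ := delta0_spec hc hx
  have hdiff : DifferentiableAt ℝ (delta0 c) x := by
    have hpos : (1 - c + x) ^ 2 + 4 * c * x ≠ 0 := by positivity
    have hx2 : 2 * x ≠ 0 := by positivity
    unfold delta0
    fun_prop (disch := assumption)
  obtain ⟨d', hd⟩ : ∃ d', HasDerivAt (delta0 c) d' x := ⟨_, hdiff.hasDerivAt⟩
  set d := delta0 c x with hdx
  have hd1 : 0 < 1 + d := by linarith
  have e1 : HasDerivAt (fun z => 1 + delta0 c z) d' x := hd.const_add 1
  have e2 := e1.log hd1.ne'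
  have e3 : HasDerivAt (fun z => z * (1 + delta0 c z)) (1 * (1 + d) + x * d') x :=
    (hasDerivAt_id x).mul e1
  have e4 : HasDerivAt (fun z => 1 + 1 / (z * (1 + delta0 c z)))
      (-(1 * (1 + d) + x * d') / (x * (1 + d)) ^ 2) x := by
    have := (e3.fun_inv (by positivity)).const_add 1
    simpa only [one_div] using this
  have e5 := (e4.log (by positivity)).const_mul c
  have e6 := hd.fun_div e1 hd1.ne'
  refine ((e2.add e5).sub e6).congr_deriv ?_
  have hc' : c = x * d + d / (1 + d) := by unfold phi at h1; exact h1.symm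
  have hne : x * (1 + d) + 1 ≠ 0 := by positivity
  unfold gamma0
  rw [← hdx, hc']
  field_simp
  ring

/-- A function on `[x₀, ∞)` with derivative at least `-F / x ^ 2` and with nonpositive limit at
infinity is at most `F / x₀` at `x₀`: subtracting `F / x` makes it monotone. -/
lemma le_of_hasDerivAt_le {g g' : ℝ → ℝ} {x₀ F D : ℝ} (hx₀ : 0 < x₀)
    (hg : ∀ x, x₀ ≤ x → HasDerivAt g (g' x) x) (hg' : ∀ x, x₀ ≤ x → -(F / x ^ 2) ≤ g' x)
    (hD : ∀ x, x₀ ≤ x → g x ≤ D / x) (hF : 0 ≤ F) : g x₀ ≤ F / x₀ := by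
  have hder : ∀ x, x₀ ≤ x → HasDerivAt (fun z => g z - F / z) (g' x + F / x ^ 2) x := by
    intro x hx
    have hx0 : x ≠ 0 := (hx₀.trans_le hx).ne'
    have h1 : HasDerivAt (fun z : ℝ => F / z) (F * -(x ^ 2)⁻¹) x := (hasDerivAt_inv hx0).const_mul F
    refine ((hg x hx).sub h1).congr_deriv ?_
    ring
  have hmono : MonotoneOn (fun z => g z - F / z) (Set.Ici x₀) := by
    refine monotoneOn_of_deriv_nonneg (convex_Ici x₀)
      (fun x hx => (hder x hx).continuousAt.continuousWithinAt)
      (fun x hx => ?_) fun x hx => ?_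
    · rw [interior_Ici] at hx
      exact (hder x (le_of_lt hx)).differentiableAt.differentiableWithinAt
    · rw [interior_Ici] at hx
      rw [(hder x (le_of_lt hx)).deriv]
      linarith [hg' x (le_of_lt hx)]
  have hlim : Tendsto (fun x : ℝ => D / x) atTop (nhds 0) := tendsto_const_nhds.div_atTop tendsto_id
  have : g x₀ - F / x₀ ≤ 0 := by
    refine ge_of_tendsto hlim ?_
    filter_upwards [eventually_ge_atTop x₀] with x hx
    have h1 := hmono (Set.mem_Ici.2 le_rfl) (Set.mem_Ici.2 hx) hx
    have h2 : 0 ≤ F / x := div_nonneg hF (hx₀.le.trans hx)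
    simp only at h1
    linarith [hD x hx]
  linarith

end Limit

/-! ### Convergence to the limit at rate `1 / K` -/

section Rate

/-- The constant in the approximate equation for the mean resolvent trace. -/
def eqConst (R x₀ : ℝ) : ℝ :=
  2 * fourthMoment * R / x₀ + 1 + 8 * fourthMoment * R / x₀ ^ 3

/-- The constant in the distance between the mean resolvent trace and its limit. -/
def traceConst (R ρ x₀ : ℝ) : ℝ := ρ + eqConst R x₀ / x₀

variable {N K : ℕ} {c R ρ x₀ x : ℝ}

lemma eqConst_nonneg (hx₀ : 0 < x₀) (hR : (N : ℝ) / K ≤ R) : 0 ≤ eqConst R x₀ := by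
  have hR0 : 0 ≤ R := le_trans (by positivity) hR
  have := fourthMoment_nonneg
  unfold eqConst; positivity

lemma abs_meanNtr_equation_le' (hx₀ : 0 < x₀) (hx : x₀ ≤ x) (hK : 0 < K) (hR : (N : ℝ) / K ≤ R) :
    |N / K - x * meanNtr N K x - phi (meanNtr N K x)| ≤ eqConst R x₀ / (K * x) := by
  have hx' : 0 < x := hx₀.trans_le hx
  have hK1 : (1 : ℝ) ≤ K := by exact_mod_cast hK
  have hK' : (0 : ℝ) < K := by linarith
  have hm := fourthMoment_nonneg
  have hR0 : 0 ≤ R := le_trans (by positivity) hR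
  refine (abs_meanNtr_equation_le hx' hK).trans ?_
  have hr0 : (0 : ℝ) ≤ N / K := by positivity
  have h1 : 2 * fourthMoment * N / (K ^ 2 * x ^ 2) ≤ 2 * fourthMoment * R / x₀ / (K * x) := by
    have e : 2 * fourthMoment * N / (K ^ 2 * x ^ 2) = 2 * fourthMoment * (N / K) / x / (K * x) := by
      field_simp
    rw [e]; gcongr
  have h2 : 8 * fourthMoment * N / (K ^ 3 * x ^ 4)
      ≤ 8 * fourthMoment * R / x₀ ^ 3 / (K * x) := by
    have e : 8 * fourthMoment * N / (K ^ 3 * x ^ 4)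
        = 8 * fourthMoment * (N / K) / (K * x ^ 3) / (K * x) := by field_simp
    rw [e]
    have : x₀ ^ 3 ≤ K * x ^ 3 := by
      have : x₀ ^ 3 ≤ x ^ 3 := by gcongr
      nlinarith [pow_pos hx' 3]
    gcongr
  have e : eqConst R x₀ / (K * x) = 2 * fourthMoment * R / x₀ / (K * x) + 1 / (K * x)
      + 8 * fourthMoment * R / x₀ ^ 3 / (K * x) := by unfold eqConst; ring
  rw [e]; linarith

/-- Stability of the limiting equation: both summands of `x t + t / (1 + t)` increase with `t`. -/
lemma abs_meanNtr_sub_le (hc : 0 < c) (hx₀ : 0 < x₀) (hx : x₀ ≤ x) (hK : 0 < K)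
    (hR : (N : ℝ) / K ≤ R) (hρ : K * |(N : ℝ) / K - c| ≤ ρ) :
    |meanNtr N K x - delta0 c x| ≤ traceConst R ρ x₀ / (K * x) := by
  have hx' : 0 < x := hx₀.trans_le hx
  have hK' : (0 : ℝ) < K := by exact_mod_cast hK
  obtain ⟨hd0, hd⟩ := delta0_spec hc hx'
  have hE := abs_meanNtr_equation_le' hx₀ hx hK hR
  have hE0 := eqConst_nonneg hx₀ hR
  have hτ : 0 ≤ meanNtr N K x :=
    integral_nonneg fun h => ntr_nonneg K (boundedBelow_regGram hx' (chan h))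
  set τ := meanNtr N K x
  set d := delta0 c x
  have h1 : (τ - d) * (x + 1 / ((1 + τ) * (1 + d)))
      = (N / K - c) - (N / K - x * τ - phi τ) := by
    have := phi_sub_phi hτ hd0
    rw [mul_add, mul_one_div, ← this]; linarith
  have h2 : |τ - d| * x ≤ |(N : ℝ) / K - c| + |N / K - x * τ - phi τ| := by
    have hq : 0 ≤ 1 / ((1 + τ) * (1 + d)) := by positivity
    calc |τ - d| * x ≤ |τ - d| * (x + 1 / ((1 + τ) * (1 + d))) := by gcongr; linarith
      _ = |(τ - d) * (x + 1 / ((1 + τ) * (1 + d)))| := by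
          rw [abs_mul, abs_of_nonneg (by positivity : 0 ≤ x + 1 / ((1 + τ) * (1 + d)))]
      _ ≤ _ := by rw [h1]; exact abs_sub _ _
  have h3 : |(N : ℝ) / K - c| ≤ ρ / K := by rw [le_div_iff₀ hK']; linarith
  have h4 : eqConst R x₀ / (K * x) ≤ eqConst R x₀ / x₀ / K := by
    rw [div_div, mul_comm x₀]; gcongr
  rw [← div_div, le_div_iff₀ hx']
  unfold traceConst
  rw [add_div]
  linarith

/-- The mean of `tr B / K`, where `B` is `bMat`, is `γ₀` up to `O(1 / K)`. -/
lemma abs_meanTrace_sub_gamma0_le (hc : 0 < c) (hx₀ : 0 < x₀) (hx : x₀ ≤ x) (hK : 0 < K)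
    (hR : (N : ℝ) / K ≤ R) (hρ : K * |(N : ℝ) / K - c| ≤ ρ) :
    |N / K - x * meanNtr N K x - gamma0 c x| ≤ (eqConst R x₀ + traceConst R ρ x₀) / (K * x) := by
  have hx' : 0 < x := hx₀.trans_le hx
  have hτ : 0 ≤ meanNtr N K x :=
    integral_nonneg fun h => ntr_nonneg K (boundedBelow_regGram hx' (chan h))
  have h1 := abs_meanNtr_equation_le' hx₀ hx hK hR
  have h2 := abs_meanNtr_sub_le hc hx₀ hx hK hR hρ
  have h3 := abs_phi_sub_phi_le hτ (delta0_nonneg hc hx')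
  have e : N / K - x * meanNtr N K x - gamma0 c x
      = (N / K - x * meanNtr N K x - phi (meanNtr N K x))
        + (phi (meanNtr N K x) - phi (delta0 c x)) := by
    unfold gamma0; rw [← phi]; ring
  rw [e, add_div]
  exact (abs_add_le _ _).trans (by linarith)

/-- The bias of the log-determinant is bounded: the derivatives of `meanLogDet` and of
`K * capFun` differ by `O(x⁻²)`, uniformly in `K`, and both functions vanish at infinity. -/
lemma abs_meanLogDet_sub_le (hc : 0 < c) (hx₀ : 0 < x₀) (hK : 0 < K)
    (hR : (N : ℝ) / K ≤ R) (hρ : K * |(N : ℝ) / K - c| ≤ ρ) :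
    |meanLogDet N K x₀ - K * capFun c x₀| ≤ (eqConst R x₀ + traceConst R ρ x₀) / x₀ := by
  have hK' : (0 : ℝ) < K := by exact_mod_cast hK
  set F := eqConst R x₀ + traceConst R ρ x₀ with hF
  have hρ0 : 0 ≤ ρ := le_trans (by positivity) hρ
  have hF0 : 0 ≤ F := by
    have := eqConst_nonneg hx₀ hR
    rw [hF]; unfold traceConst; positivity
  have hder : ∀ x, x₀ ≤ x → HasDerivAt (fun z => meanLogDet N K z - K * capFun c z)
      (-(K / x * (N / K - x * meanNtr N K x - gamma0 c x))) x := by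
    intro x hx
    have hx' : 0 < x := hx₀.trans_le hx
    refine ((hasDerivAt_meanLogDet hx' hK).sub ((hasDerivAt_capFun hc hx').const_mul _)).congr_deriv
      ?_
    field_simp
    ring
  have hbd : ∀ x, x₀ ≤ x →
      |-(K / x * (N / K - x * meanNtr N K x - gamma0 c x))| ≤ F / x ^ 2 := by
    intro x hx
    have hx' : 0 < x := hx₀.trans_le hx
    rw [abs_neg, abs_mul, abs_of_pos (by positivity : (0 : ℝ) < K / x)]
    calc _ ≤ K / x * (F / (K * x)) := by
          gcongr; exact abs_meanTrace_sub_gamma0_le hc hx₀ hx hK hR hρ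
      _ = F / x ^ 2 := by field_simp
  -- this bound grows with `K`, and serves only to locate the limit at infinity
  have hD : ∀ x, x₀ ≤ x → |meanLogDet N K x - K * capFun c x| ≤ (N + K * (2 * c)) / x := by
    intro x hx
    have hx' : 0 < x := hx₀.trans_le hx
    have h1 := meanLogDet_nonneg (N := N) (K := K) hx'
    have h2 := meanLogDet_le (N := N) hx' hK
    have h3 := mul_le_mul_of_nonneg_left (abs_capFun_le hc hx') hK'.le
    have h4 : (N + K * (2 * c)) / x = N / x + K * (2 * c / x) := by ring
    rw [h4]
    refine (abs_sub _ _).trans ?_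
    rw [abs_of_nonneg h1, abs_mul, abs_of_pos hK']
    linarith
  refine abs_le'.2 ⟨?_, ?_⟩
  · exact le_of_hasDerivAt_le hx₀ hder (fun x hx => (abs_le.1 (hbd x hx)).1)
      (fun x hx => (le_abs_self _).trans (hD x hx)) hF0
  · refine le_of_hasDerivAt_le (g := fun z => -(meanLogDet N K z - K * capFun c z)) hx₀
      (fun x hx => (hder x hx).neg) (fun x hx => ?_)
      (fun x hx => (neg_le_abs _).trans (hD x hx)) hF0
    have := (abs_le.1 (hbd x hx)).2
    linarith

/-- The constant in the mean square distance of the log-determinant from `K` times the capacity. -/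
def logDetConst (R ρ x₀ : ℝ) : ℝ :=
  2 * fourthMoment * R / x₀ ^ 2 + ((eqConst R x₀ + traceConst R ρ x₀) / x₀) ^ 2

lemma integral_logDet_sub_sq_le (hc : 0 < c) (hx₀ : 0 < x₀) (hK : 0 < K)
    (hR : (N : ℝ) / K ≤ R) (hρ : K * |(N : ℝ) / K - c| ≤ ρ) :
    ∫ h, (logDet x₀ (chan h) - K * capFun c x₀) ^ 2 ∂(colsLaw N K) ≤ logDetConst R ρ x₀ := by
  have hm := fourthMoment_nonneg
  rw [integral_sub_sq (memLp_logDet hx₀)]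
  refine add_le_add ((variance_logDet_le hx₀ hK).trans ?_) ?_
  · have e : 2 * fourthMoment * N / (K * x₀ ^ 2) = 2 * fourthMoment * (N / K) / x₀ ^ 2 := by
      field_simp
    rw [e]; gcongr
  · exact sq_le_sq' (abs_le.1 (abs_meanLogDet_sub_le hc hx₀ hK hR hρ)).1
      (abs_le.1 (abs_meanLogDet_sub_le hc hx₀ hK hR hρ)).2

/-- The constant in the mean square distance of the resolvent trace from its limit. -/
def ntrConst (R ρ x₀ : ℝ) : ℝ :=
  8 * fourthMoment * R / x₀ ^ 4 + (traceConst R ρ x₀ / x₀) ^ 2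

lemma integral_ntr_sub_sq_le (hc : 0 < c) (hx₀ : 0 < x₀) (hK : 0 < K)
    (hR : (N : ℝ) / K ≤ R) (hρ : K * |(N : ℝ) / K - c| ≤ ρ) :
    ∫ h, (ntr K (regGram x₀ (chan h)) - delta0 c x₀) ^ 2 ∂(colsLaw N K)
      ≤ ntrConst R ρ x₀ / K ^ 2 := by
  have hm := fourthMoment_nonneg
  have hK' : (0 : ℝ) < K := by exact_mod_cast hK
  rw [integral_sub_sq (memLp_ntr hx₀), ntrConst, add_div]
  refine add_le_add ((variance_ntr_le hx₀ hK).trans ?_) ?_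
  · have e : 8 * fourthMoment * N / (K ^ 3 * x₀ ^ 4)
        = 8 * fourthMoment * (N / K) / x₀ ^ 4 / K ^ 2 := by field_simp
    rw [e]; gcongr
  · have h1 := abs_meanNtr_sub_le hc hx₀ le_rfl hK hR hρ
    have e : (traceConst R ρ x₀ / x₀) ^ 2 / (K : ℝ) ^ 2 = (traceConst R ρ x₀ / (K * x₀)) ^ 2 := by
      rw [← div_pow, div_div, mul_comm x₀]
    rw [e]
    exact sq_le_sq' (abs_le.1 h1).1 (abs_le.1 h1).2

end Rate

/-! ### The matrix `Hᴴ (H Hᴴ / K + x)⁻¹ H / K` is close to a multiple of the identity -/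

section BMatrix

variable {N K : ℕ} {c R ρ x : ℝ}

lemma gram_chan_perm (h : Fin K → Fin N → ℂ) (e : Fin K ≃ Fin K) :
    gram (chan fun k => h (e k)) = gram (chan h) := by
  rw [gram_chan, gram_chan]
  exact Equiv.sum_comp e fun k => vecMulVec (((√K)⁻¹ : ℝ) • h k) (star (((√K)⁻¹ : ℝ) • h k))

lemma bMat_perm (x : ℝ) (h : Fin K → Fin N → ℂ) (e : Fin K ≃ Fin K) (i j : Fin K) :
    bMat x (chan fun k => h (e k)) i j = bMat x (chan h) (e i) (e j) := by
  rw [bMat_apply, bMat_apply, regGram, gram_chan_perm, ← regGram]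

lemma gram_chan_flip (h : Fin K → Fin N → ℂ) (m : Fin K) :
    gram (chan fun k => if k = m then -h k else h k) = gram (chan h) := by
  rw [gram_chan, gram_chan]
  refine Finset.sum_congr rfl fun k _ => ?_
  split_ifs
  · rw [smul_neg, star_neg, neg_vecMulVec, vecMulVec_neg, neg_neg]
  · rfl

lemma bMat_flip (x : ℝ) (h : Fin K → Fin N → ℂ) (m i j : Fin K) :
    bMat x (chan fun k => if k = m then -h k else h k) i j
      = (if i = m then -1 else 1) * (if j = m then -1 else 1) * bMat x (chan h) i j := by
  rw [bMat_apply, bMat_apply, regGram, gram_chan_flip, ← regGram]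
  by_cases hi : i = m <;> by_cases hj : j = m <;>
    simp [hi, hj, mulVec_neg, dotProduct_neg, neg_dotProduct]

/-- The entries of the deviation of `bMat` from the multiple `γ₀` of the identity. -/
def bDev (c x : ℝ) (i j : Fin K) (h : Fin K → Fin N → ℂ) : ℂ :=
  bMat x (chan h) i j - if i = j then (gamma0 c x : ℂ) else 0

lemma bDev_flip (c x : ℝ) (m : Fin K) (h : Fin K → Fin N → ℂ) (i j : Fin K) :
    bDev c x i j (fun i => if i = m then -h i else h i)
      = (if i = m then -1 else 1) * (if j = m then -1 else 1) * bDev c x i j h := by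
  unfold bDev
  rw [bMat_flip, mul_sub]
  congr 1
  by_cases hij : i = j
  · subst hij
    by_cases hi : i = m <;> simp [hi]
  · simp [hij]

lemma bDev_perm (c x : ℝ) (h : Fin K → Fin N → ℂ) (e : Fin K ≃ Fin K) (i j : Fin K) :
    bDev c x i j (fun k => h (e k)) = bDev c x (e i) (e j) h := by
  unfold bDev
  rw [bMat_perm]
  simp

lemma continuous_bDev (hx : 0 < x) (i j : Fin K) :
    Continuous fun h : Fin K → Fin N → ℂ => bDev c x i j h := by
  unfold bDev
  exact (((continuous_bMat hx).comp continuous_chan).matrix_elem i j).sub continuous_const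

lemma memLp_bDev (hx : 0 < x) (i j : Fin K) :
    MemLp (bDev (N := N) c x i j) 2 (colsLaw N K) := by
  refine MemLp.of_bound (continuous_bDev hx i j).aestronglyMeasurable (1 + |gamma0 c x|)
    (Eventually.of_forall fun h => ?_)
  refine (norm_sub_le _ _).trans (add_le_add (norm_bMat_le hx _ i j) ?_)
  split_ifs <;> simp

/-- The real value of a diagonal entry of `bDev`. -/
def bDiag (c x : ℝ) (k : Fin K) (h : Fin K → Fin N → ℂ) : ℝ :=
  phi (colForm K (cutGram x h k) (h k)) - gamma0 c x

lemma bDev_diag (hx : 0 < x) (k : Fin K) (h : Fin K → Fin N → ℂ) :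
    bDev c x k k h = (bDiag c x k h : ℂ) := by
  rw [bDev, bDiag, bMat_diag hx, if_pos rfl, Complex.ofReal_sub]

lemma memLp_bDiag (hx : 0 < x) (k : Fin K) : MemLp (bDiag (N := N) c x k) 2 (colsLaw N K) := by
  have h1 : MemLp (fun h : Fin K → Fin N → ℂ => (bDev c x k k h).re) 2 (colsLaw N K) :=
    (memLp_bDev hx k k).re
  simpa only [bDev_diag hx, Complex.ofReal_re] using h1

/-- The constant in the second moments of the diagonal entries of `bDev`. -/
def diagConst (R ρ x : ℝ) : ℝ :=
  3 * (2 * fourthMoment * R / x ^ 2 + 1 / x ^ 2 + ntrConst R ρ x)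

lemma integral_bDiag_sq_le (hc : 0 < c) (hx : 0 < x) (hK : 0 < K)
    (hR : (N : ℝ) / K ≤ R) (hρ : K * |(N : ℝ) / K - c| ≤ ρ) (k : Fin K) :
    ∫ h, bDiag c x k h ^ 2 ∂(colsLaw N K) ≤ diagConst R ρ x / K := by
  have hm := fourthMoment_nonneg
  have hK1 : (1 : ℝ) ≤ K := by exact_mod_cast hK
  have hK' : (0 : ℝ) < K := by linarith
  have hsm : Measurable fun h : Fin K → Fin N → ℂ =>
      (colForm K (cutGram x h k) (h k) - ntr K (cutGram x h k)) ^ 2 :=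
    ((continuous_colForm_cut hx k).sub (continuous_ntr_cut hx k)).measurable.pow_const 2
  have hsb : ∀ h : Fin K → Fin N → ℂ,
      ∫ y, (colForm K (cutGram x (Function.update h k y) k) (Function.update h k y k)
        - ntr K (cutGram x (Function.update h k y) k)) ^ 2 ∂(columnLaw N)
      ≤ 2 * fourthMoment * N / (K ^ 2 * x ^ 2) := fun h => by
    simp only [cutGram_update, Function.update_self]
    exact integral_colForm_sub_sq_le K (boundedBelow_cutGram hx h k)
  have hsi : Integrable (fun h : Fin K → Fin N → ℂ =>
      (colForm K (cutGram x h k) (h k) - ntr K (cutGram x h k)) ^ 2) (colsLaw N K) := by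
    refine integrable_of_resample k hsm (fun h => sq_nonneg _) (fun h => ?_) hsb
    simp only [cutGram_update, Function.update_self]
    exact integrable_colForm_sub_sq K _ _
  have hs := integral_le_of_resample k hsi hsb
  have ht := integral_ntr_sub_sq_le hc hx hK hR hρ
  have hti : Integrable (fun h : Fin K → Fin N → ℂ =>
      (ntr K (regGram x (chan h)) - delta0 c x) ^ 2) (colsLaw N K) :=
    ((memLp_ntr hx).sub (memLp_const _)).integrable_sq
  -- pass from the column form to the trace without column `k`, to the full trace, and to `δ₀`
  have hpt : ∀ h : Fin K → Fin N → ℂ, bDiag c x k h ^ 2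
      ≤ 3 * ((colForm K (cutGram x h k) (h k) - ntr K (cutGram x h k)) ^ 2 + (1 / (K * x)) ^ 2
        + (ntr K (regGram x (chan h)) - delta0 c x) ^ 2) := by
    intro h
    have hP := boundedBelow_cutGram hx h k
    have h1 := abs_phi_sub_phi_le (colForm_nonneg K hP (h k)) (delta0_nonneg hc hx)
    have h2 := abs_ntr_sub_ntr_cut_le hx h k
    have h3 : (ntr K (cutGram x h k) - ntr K (regGram x (chan h))) ^ 2 ≤ (1 / (K * x)) ^ 2 :=
      sq_le_sq' (abs_le.1 h2).1 (abs_le.1 h2).2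
    have h4 : bDiag c x k h ^ 2 ≤ (colForm K (cutGram x h k) (h k) - delta0 c x) ^ 2 := by
      rw [bDiag, gamma0, ← phi]; exact sq_le_sq.2 h1
    set s := colForm K (cutGram x h k) (h k)
    set t := ntr K (cutGram x h k)
    set t' := ntr K (regGram x (chan h))
    nlinarith [sq_nonneg ((s - t) - (t - t')), sq_nonneg ((s - t) - (t' - delta0 c x)),
      sq_nonneg ((t - t') - (t' - delta0 c x))]
  have hi12 : Integrable (fun h : Fin K → Fin N → ℂ =>
      (colForm K (cutGram x h k) (h k) - ntr K (cutGram x h k)) ^ 2 + (1 / (K * x)) ^ 2)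
      (colsLaw N K) := hsi.add (integrable_const _)
  refine (integral_mono (memLp_bDiag hx k).integrable_sq ((hi12.add hti).const_mul 3) hpt).trans ?_
  rw [integral_const_mul, integral_add' hi12 hti, integral_add hsi (integrable_const _)]
  simp only [integral_const, probReal_univ, smul_eq_mul, one_mul]
  have e1 : 2 * fourthMoment * N / (K ^ 2 * x ^ 2) ≤ 2 * fourthMoment * R / x ^ 2 / K := by
    have e : 2 * fourthMoment * N / (K ^ 2 * x ^ 2) = 2 * fourthMoment * (N / K) / x ^ 2 / K := by
      field_simp
    rw [e]; gcongr
  have e2 : (1 / (K * x)) ^ 2 ≤ 1 / x ^ 2 / K := by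
    have e : (1 / (K * x)) ^ 2 = 1 / x ^ 2 / (K * K) := by field_simp
    rw [e]; gcongr; nlinarith
  have hT : 0 ≤ ntrConst R ρ x := by
    have hR0 : 0 ≤ R := le_trans (by positivity) hR
    unfold ntrConst; positivity
  have e3 : ntrConst R ρ x / (K : ℝ) ^ 2 ≤ ntrConst R ρ x / K := by
    gcongr; nlinarith
  have e4 : diagConst R ρ x / K
      = 3 * (2 * fourthMoment * R / x ^ 2 / K + 1 / x ^ 2 / K + ntrConst R ρ x / K) := by
    unfold diagConst; ring
  rw [e4]
  linarith

/-- The constant in the second moment of the trace of `bDev`. -/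
def traceSqConst (R ρ x : ℝ) : ℝ := 2 * ρ ^ 2 + 2 * x ^ 2 * ntrConst R ρ x

/-- The trace of `bDev` has fluctuations of order one, although it is a sum of `K` terms of order
`K ^ (-1 / 2)`: it is an affine function of the resolvent trace. -/
lemma sum_bDiag (hc : 0 < c) (hx : 0 < x) (hK : 0 < K) (h : Fin K → Fin N → ℂ) :
    ∑ k, bDiag c x k h
      = K * ((N / K - c) - x * (ntr K (regGram x (chan h)) - delta0 c x)) := by
  have hK' : (0 : ℝ) < K := by exact_mod_cast hK
  have h1 := sum_phi_eq hx h
  have h2 := (delta0_spec hc hx).2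
  rw [div_eq_iff hK'.ne'] at h1
  simp only [bDiag, Finset.sum_sub_distrib, h1, Finset.sum_const, Finset.card_univ,
    Fintype.card_fin, nsmul_eq_mul]
  unfold gamma0
  rw [← phi]
  have : phi (delta0 c x) = c - x * delta0 c x := by linarith
  rw [this]; ring

lemma integral_sum_bDiag_sq_le (hc : 0 < c) (hx : 0 < x) (hK : 0 < K)
    (hR : (N : ℝ) / K ≤ R) (hρ : K * |(N : ℝ) / K - c| ≤ ρ) :
    ∫ h, (∑ k, bDiag c x k h) ^ 2 ∂(colsLaw N K) ≤ traceSqConst R ρ x := by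
  have hK' : (0 : ℝ) < K := by exact_mod_cast hK
  have ht := integral_ntr_sub_sq_le hc hx hK hR hρ
  have hti : Integrable (fun h : Fin K → Fin N → ℂ =>
      (ntr K (regGram x (chan h)) - delta0 c x) ^ 2) (colsLaw N K) :=
    ((memLp_ntr hx).sub (memLp_const _)).integrable_sq
  have hpt : ∀ h : Fin K → Fin N → ℂ, (∑ k, bDiag c x k h) ^ 2
      ≤ 2 * ρ ^ 2 + 2 * K ^ 2 * x ^ 2 * (ntr K (regGram x (chan h)) - delta0 c x) ^ 2 := by
    intro h
    rw [sum_bDiag hc hx hK]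
    have h1 : (K * ((N : ℝ) / K - c)) ^ 2 ≤ ρ ^ 2 := by
      rw [← sq_abs, abs_mul, abs_of_pos hK']
      exact pow_le_pow_left₀ (by positivity) hρ 2
    set d := ntr K (regGram x (chan h)) - delta0 c x
    nlinarith [sq_nonneg (K * ((N : ℝ) / K - c) + K * (x * d))]
  have hi : Integrable (fun h : Fin K → Fin N → ℂ => (∑ k, bDiag c x k h) ^ 2) (colsLaw N K) :=
    (memLp_finsetSum Finset.univ fun k _ => memLp_bDiag (N := N) (c := c) hx k).integrable_sq
  refine (integral_mono hi ((integrable_const _).add (hti.const_mul _)) hpt).trans ?_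
  rw [integral_add' (integrable_const _) (hti.const_mul _),
    integral_const_mul (2 * (K : ℝ) ^ 2 * x ^ 2)]
  simp only [integral_const, probReal_univ, smul_eq_mul, one_mul]
  unfold traceSqConst
  have h3 : 2 * (K : ℝ) ^ 2 * x ^ 2 * (ntrConst R ρ x / K ^ 2) = 2 * x ^ 2 * ntrConst R ρ x := by
    field_simp
  have h4 := mul_le_mul_of_nonneg_left ht (by positivity : 0 ≤ 2 * (K : ℝ) ^ 2 * x ^ 2)
  linarith

/-- A permutation carrying one pair of distinct indices to another. -/
lemma exists_perm_pair {i j i' j' : Fin K} (hij : i ≠ j) (hij' : i' ≠ j') :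
    ∃ e : Fin K ≃ Fin K, e i = i' ∧ e j = j' := by
  refine ⟨(Equiv.swap i i').trans (Equiv.swap (Equiv.swap i i' j) j'), ?_, by simp⟩
  have h1 : i' ≠ Equiv.swap i i' j := by
    intro h
    have h2 := congrArg (Equiv.swap i i') h
    rw [Equiv.swap_apply_right, Equiv.swap_apply_self] at h2
    exact hij h2
  simp only [Equiv.trans_apply, Equiv.swap_apply_left]
  exact Equiv.swap_apply_of_ne_of_ne h1 hij'

/-- By exchangeability of the columns, the correlation of two diagonal entries is determined by the
second moments of the trace and of a single diagonal entry. -/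
lemma abs_integral_bDiag_mul_le (hc : 0 < c) (hx : 0 < x) (hK : 0 < K)
    (hR : (N : ℝ) / K ≤ R) (hρ : K * |(N : ℝ) / K - c| ≤ ρ) {i j : Fin K} (hij : i ≠ j) :
    |∫ h, bDiag c x i h * bDiag c x j h ∂(colsLaw N K)|
      ≤ 2 * (traceSqConst R ρ x + diagConst R ρ x) / K ^ 2 := by
  have hK' : (0 : ℝ) < K := by exact_mod_cast hK
  have hK2 : (2 : ℝ) ≤ K := by
    have := Fintype.one_lt_card_iff.2 ⟨i, j, hij⟩
    rw [Fintype.card_fin] at this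
    exact_mod_cast this
  set w := ∫ h, bDiag c x i h * bDiag c x j h ∂(colsLaw N K) with hw
  have hmi : ∀ k l : Fin K, Integrable (fun h => bDiag (N := N) c x k h * bDiag c x l h)
      (colsLaw N K) := fun k l => (memLp_bDiag hx k).integrable_mul (memLp_bDiag hx l)
  have hperm : ∀ k l : Fin K, k ≠ l →
      ∫ h, bDiag c x k h * bDiag c x l h ∂(colsLaw N K) = w := by
    intro k l hkl
    obtain ⟨e, rfl, rfl⟩ := exists_perm_pair hij hkl
    have hd : ∀ (k : Fin K) (h : Fin K → Fin N → ℂ),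
        bDiag c x (e k) h = bDiag c x k fun k => h (e k) := fun k h => by
      have := bDev_perm c x h e k k
      rw [bDev_diag hx, bDev_diag hx] at this
      exact_mod_cast this.symm
    simp only [hd]
    exact integral_comp_perm (columnLaw N) e fun h => bDiag c x i h * bDiag c x j h
  -- the second moment of the trace in terms of the common correlation `w`
  have hexp : ∫ h, (∑ k, bDiag c x k h) ^ 2 ∂(colsLaw N K)
      = ∑ k, ∫ h, bDiag c x k h ^ 2 ∂(colsLaw N K) + K * (K - 1) * w := by
    have h1 : ∀ h : Fin K → Fin N → ℂ,
        (∑ k, bDiag c x k h) ^ 2 = ∑ k, ∑ l, bDiag c x k h * bDiag c x l h := fun h => by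
      rw [sq, Finset.sum_mul_sum]
    simp only [h1]
    rw [integral_finsetSum _ fun k _ => integrable_finsetSum _ fun l _ => hmi k l]
    have h2 : ∀ k, ∫ h, ∑ l, bDiag c x k h * bDiag c x l h ∂(colsLaw N K)
        = ∫ h, bDiag c x k h ^ 2 ∂(colsLaw N K) + (K - 1) * w := by
      intro k
      rw [integral_finsetSum _ fun l _ => hmi k l, ← Finset.add_sum_erase _ _ (Finset.mem_univ k)]
      congr 1
      · simp only [sq]
      · rw [Finset.sum_congr rfl fun l hl => hperm k l (Finset.ne_of_mem_erase hl).symm]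
        rw [Finset.sum_const, Finset.card_erase_of_mem (Finset.mem_univ k), Finset.card_univ,
          Fintype.card_fin, nsmul_eq_mul, Nat.cast_sub hK, Nat.cast_one]
    rw [Finset.sum_congr rfl fun k _ => h2 k, Finset.sum_add_distrib, Finset.sum_const,
      Finset.card_univ, Fintype.card_fin, nsmul_eq_mul, mul_assoc]
  have hS := integral_sum_bDiag_sq_le hc hx hK hR hρ
  have hS0 : 0 ≤ ∫ h, (∑ k, bDiag c x k h) ^ 2 ∂(colsLaw N K) :=
    integral_nonneg fun h => sq_nonneg _
  have hV : ∑ k, ∫ h, bDiag c x k h ^ 2 ∂(colsLaw N K) ≤ diagConst R ρ x := by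
    refine (Finset.sum_le_sum fun k _ => integral_bDiag_sq_le hc hx hK hR hρ k).trans (le_of_eq ?_)
    rw [Finset.sum_const, Finset.card_univ, Fintype.card_fin, nsmul_eq_mul]
    field_simp
  have hV0 : 0 ≤ ∑ k, ∫ h, bDiag c x k h ^ 2 ∂(colsLaw N K) :=
    Finset.sum_nonneg fun k _ => integral_nonneg fun h => sq_nonneg _
  have hkk : (K : ℝ) ^ 2 / 2 ≤ K * (K - 1) := by nlinarith
  have hbound : |K * (K - 1) * w| ≤ traceSqConst R ρ x + diagConst R ρ x := by
    rw [abs_le]; constructor <;> linarith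
  rw [abs_mul, abs_of_nonneg (by nlinarith : (0 : ℝ) ≤ K * (K - 1))] at hbound
  rw [le_div_iff₀ (by positivity)]
  nlinarith [mul_le_mul_of_nonneg_right hkk (abs_nonneg w)]

/-- By exchangeability, the off-diagonal entries share the unit mass of a row. -/
lemma integral_norm_bDev_sq_le_of_ne (hx : 0 < x) (hK : 0 < K) {i j : Fin K} (hij : i ≠ j) :
    ∫ h, ‖bDev (N := N) c x i j h‖ ^ 2 ∂(colsLaw N K) ≤ 2 / K := by
  have hK' : (0 : ℝ) < K := by exact_mod_cast hK
  have hK2 : (2 : ℝ) ≤ K := by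
    have := Fintype.one_lt_card_iff.2 ⟨i, j, hij⟩
    rw [Fintype.card_fin] at this
    exact_mod_cast this
  set u := ∫ h, ‖bDev (N := N) c x i j h‖ ^ 2 ∂(colsLaw N K) with hu
  have hI : ∀ k, Integrable (fun h => ‖bDev (N := N) c x i k h‖ ^ 2) (colsLaw N K) := fun k =>
    (memLp_bDev hx i k).norm.integrable_sq
  have hperm : ∀ k, i ≠ k → ∫ h, ‖bDev (N := N) c x i k h‖ ^ 2 ∂(colsLaw N K) = u := by
    intro k hik
    obtain ⟨e, he1, he2⟩ := exists_perm_pair hij hik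
    have hd : ∀ h : Fin K → Fin N → ℂ, bDev c x i k h = bDev c x i j fun k => h (e k) := fun h => by
      rw [bDev_perm, he1, he2]
    simp only [hd]
    exact integral_comp_perm (columnLaw N) e fun h => ‖bDev c x i j h‖ ^ 2
  have hsum : ∑ k ∈ Finset.univ.erase i, ∫ h, ‖bDev (N := N) c x i k h‖ ^ 2 ∂(colsLaw N K) ≤ 1 := by
    rw [← integral_finsetSum _ fun k _ => hI k]
    calc _ ≤ ∫ _ : Fin K → Fin N → ℂ, (1 : ℝ) ∂(colsLaw N K) := by
          refine integral_mono (integrable_finsetSum _ fun k _ => hI k) (integrable_const _)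
            fun h => ?_
          refine le_trans ?_ (norm_bMat_row_le hx (chan h) i)
          rw [← Finset.add_sum_erase _ (fun j => ‖bMat x (chan h) i j‖ ^ 2) (Finset.mem_univ i)]
          refine le_trans (le_of_eq (Finset.sum_congr rfl fun k hk => ?_))
            (le_add_of_nonneg_left (by positivity))
          rw [bDev, if_neg (Finset.ne_of_mem_erase hk).symm, sub_zero]
      _ = 1 := by simp
  rw [Finset.sum_congr rfl fun k hk => hperm k (Finset.ne_of_mem_erase hk).symm, Finset.sum_const,
    Finset.card_erase_of_mem (Finset.mem_univ i), Finset.card_univ, Fintype.card_fin, nsmul_eq_mul,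
    Nat.cast_sub hK, Nat.cast_one] at hsum
  have hu0 : 0 ≤ u := integral_nonneg fun h => by positivity
  rw [le_div_iff₀ hK']
  nlinarith

/-- The constant in the mean square of `tr A (B - γ₀)`. -/
def bilinConst (R ρ x : ℝ) : ℝ :=
  2 * (diagConst R ρ x + 2) + 2 * (traceSqConst R ρ x + diagConst R ρ x)

lemma diagConst_nonneg (hR : (N : ℝ) / K ≤ R) : 0 ≤ diagConst R ρ x := by
  have hm := fourthMoment_nonneg
  have hR0 : 0 ≤ R := le_trans (by positivity) hR
  unfold diagConst ntrConst; positivity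

lemma traceSqConst_nonneg (hR : (N : ℝ) / K ≤ R) : 0 ≤ traceSqConst R ρ x := by
  have hm := fourthMoment_nonneg
  have hR0 : 0 ≤ R := le_trans (by positivity) hR
  unfold traceSqConst ntrConst; positivity

/-- The mean square of `tr A (B - γ₀)` is `O(tr A Aᴴ / K)`: the entries of `B - γ₀` have mean
squares of order `1 / K`, are sign-equivariant in the columns, and the correlations on the diagonal
are of order `1 / K ^ 2`. -/
lemma integral_norm_trace_mul_bDev_sq_le (hc : 0 < c) (hx : 0 < x) (hK : 0 < K)
    (hR : (N : ℝ) / K ≤ R) (hρ : K * |(N : ℝ) / K - c| ≤ ρ) (A : Matrix (Fin K) (Fin K) ℂ) :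
    ∫ h, ‖∑ i, ∑ j, A j i * bDev (N := N) c x i j h‖ ^ 2 ∂(colsLaw N K)
      ≤ bilinConst R ρ x * (frobSq A / K) := by
  have hK' : (0 : ℝ) < K := by exact_mod_cast hK
  have hV0 : 0 ≤ diagConst R ρ x := diagConst_nonneg hR
  have hS0 : 0 ≤ traceSqConst R ρ x := traceSqConst_nonneg hR
  set θ := 2 * (traceSqConst R ρ x + diagConst R ρ x) / (K : ℝ) ^ 2 with hθ
  have hθ0 : 0 ≤ θ := by positivity
  have hmain := integral_norm_sq_array_le (columnLaw_map_neg N) (ξ := bDev (N := N) (K := K) c x)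
    (bDev_flip c x) (memLp_bDev hx) (ρ := (diagConst R ρ x + 2) / K) (θ := θ) hθ0
    (fun i j => by
      by_cases hij : i = j
      · subst hij
        have h1 := integral_bDiag_sq_le hc hx hK hR hρ i
        have e : ∀ h, ‖bDev (N := N) c x i i h‖ ^ 2 = bDiag c x i h ^ 2 := fun h => by
          rw [bDev_diag hx, Complex.norm_real, Real.norm_eq_abs, sq_abs]
        simp only [e]
        refine h1.trans ?_
        gcongr; linarith
      · refine (integral_norm_bDev_sq_le_of_ne hx hK hij).trans ?_
        gcongr; linarith)
    (fun i k hik => by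
      have e : ∀ h, bDev (N := N) c x i i h * conj (bDev c x k k h)
          = ((bDiag c x i h * bDiag c x k h : ℝ) : ℂ) := fun h => by
        rw [bDev_diag hx, bDev_diag hx, Complex.conj_ofReal, Complex.ofReal_mul]
      simp only [e]
      rw [integral_complex_ofReal, Complex.norm_real, Real.norm_eq_abs]
      exact abs_integral_bDiag_mul_le hc hx hK hR hρ hik)
    (fun i j => A j i)
  refine hmain.trans ?_
  have hf : ∑ i, ∑ j, ‖A j i‖ ^ 2 = frobSq A := Finset.sum_comm
  have hdiag : (∑ i, ‖A i i‖) ^ 2 ≤ K * frobSq A := by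
    have h1 := sq_sum_le_card_mul_sum_sq (s := Finset.univ) (f := fun i => ‖A i i‖)
    rw [Finset.card_univ, Fintype.card_fin] at h1
    refine h1.trans (mul_le_mul_of_nonneg_left ?_ hK'.le)
    exact Finset.sum_le_sum fun i _ => Finset.single_le_sum (f := fun j => ‖A i j‖ ^ 2)
      (fun _ _ => by positivity) (Finset.mem_univ i)
  rw [hf]
  have h2 := mul_le_mul_of_nonneg_left hdiag hθ0
  have e : bilinConst R ρ x * (frobSq A / K)
      = 2 * ((diagConst R ρ x + 2) / K) * frobSq A + θ * (K * frobSq A) := by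
    rw [hθ]; unfold bilinConst; field_simp
  rw [e]; linarith

end BMatrix

/-! ### The noise contribution -/

section Noise

variable {n K N : ℕ} {σ : ℝ}

/-- The centred contribution of one noise column `v` to the trace in the information density, when
the received signal without noise is `a`. -/
def noiseTerm (σ : ℝ) (Q : Matrix (Fin N) (Fin N) ℂ) (a v : Fin N → ℂ) : ℝ :=
  2 * σ * (star v ⬝ᵥ Q *ᵥ a).re
    + ((quad (((σ ^ 2 : ℝ) : ℂ) • Q - 1) v).re - (trace (((σ ^ 2 : ℝ) : ℂ) • Q - 1)).re)

lemma memLp_noiseTerm (σ : ℝ) (Q : Matrix (Fin N) (Fin N) ℂ) (a : Fin N → ℂ) :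
    MemLp (noiseTerm σ Q a) 2 (columnLaw N) := by
  have h1 : MemLp (fun v : Fin N → ℂ => (star v ⬝ᵥ Q *ᵥ a).re) 2 (columnLaw N) :=
    (memLp_dotProduct (Q *ᵥ a)).re
  exact (h1.const_mul (2 * σ)).add ((memLp_re_quad _).sub (memLp_const _))

lemma integral_noiseTerm (σ : ℝ) (Q : Matrix (Fin N) (Fin N) ℂ) (a : Fin N → ℂ) :
    ∫ v, noiseTerm σ Q a v ∂(columnLaw N) = 0 := by
  have h1 : MemLp (fun v : Fin N → ℂ => (star v ⬝ᵥ Q *ᵥ a).re) 2 (columnLaw N) :=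
    (memLp_dotProduct (Q *ᵥ a)).re
  have h2 := (memLp_re_quad (((σ ^ 2 : ℝ) : ℂ) • Q - 1)).integrable (by norm_num)
  have h3 : ∫ v : Fin N → ℂ, (star v ⬝ᵥ Q *ᵥ a).re ∂(columnLaw N) = 0 := by
    have := integral_re ((memLp_dotProduct (Q *ᵥ a)).integrable (by norm_num))
    simp only [RCLike.re_to_complex] at this
    rw [this, integral_dotProduct, Complex.zero_re]
  have h4 : Integrable (fun v : Fin N → ℂ => (quad (((σ ^ 2 : ℝ) : ℂ) • Q - 1) v).re
      - (trace (((σ ^ 2 : ℝ) : ℂ) • Q - 1)).re) (columnLaw N) := h2.sub (integrable_const _)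
  unfold noiseTerm
  rw [integral_add ((h1.integrable (by norm_num)).const_mul _) h4, integral_const_mul, h3,
    integral_sub h2 (integrable_const _), integral_re_quad]
  simp

lemma sum_norm_mulVec_sq {Q : Matrix (Fin N) (Fin N) ℂ} (hQ : Q.IsHermitian) (a : Fin N → ℂ) :
    ∑ i, ‖(Q *ᵥ a) i‖ ^ 2 = (quad (Q * Q) a).re := by
  have h1 : quad (Q * Q) a = star (Q *ᵥ a) ⬝ᵥ (Q *ᵥ a) := by
    rw [quad, star_mulVec, hQ.eq, ← dotProduct_mulVec, mulVec_mulVec]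
  rw [h1, dotProduct, Complex.re_sum]
  refine Finset.sum_congr rfl fun i _ => ?_
  rw [Pi.star_apply, RCLike.star_def, Complex.conj_mul']
  norm_cast

/-- The linear part contributes `8 σ² aᴴ P⁻² a ≤ 8 aᴴ P⁻¹ a`, the quadratic part the squared
Frobenius norm of `σ² P⁻¹ - 1`. -/
lemma integral_noiseTerm_sq_le (hσ : 0 < σ) {P : Matrix (Fin N) (Fin N) ℂ}
    (hP : BoundedBelow (σ ^ 2) P) (a : Fin N → ℂ) :
    ∫ v, noiseTerm σ P⁻¹ a v ^ 2 ∂(columnLaw N)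
      ≤ 8 * (quad P⁻¹ a).re + 4 * fourthMoment * N := by
  have hm := fourthMoment_nonneg
  set D := ((σ ^ 2 : ℝ) : ℂ) • P⁻¹ - 1 with hD
  have h1 : Integrable (fun v : Fin N → ℂ => ‖star v ⬝ᵥ P⁻¹ *ᵥ a‖ ^ 2) (columnLaw N) :=
    (memLp_dotProduct (P⁻¹ *ᵥ a)).norm.integrable_sq
  have h2 : Integrable (fun v => ((quad D v).re - (trace D).re) ^ 2) (columnLaw N) :=
    ((memLp_re_quad D).sub (memLp_const _)).integrable_sq
  have hpt : ∀ v, noiseTerm σ P⁻¹ a v ^ 2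
      ≤ 8 * σ ^ 2 * ‖star v ⬝ᵥ P⁻¹ *ᵥ a‖ ^ 2 + 2 * ((quad D v).re - (trace D).re) ^ 2 := by
    intro v
    unfold noiseTerm
    rw [← hD]
    have h3 : (star v ⬝ᵥ P⁻¹ *ᵥ a).re ^ 2 ≤ ‖star v ⬝ᵥ P⁻¹ *ᵥ a‖ ^ 2 := by
      rw [← sq_abs]; exact pow_le_pow_left₀ (abs_nonneg _) (Complex.abs_re_le_norm _) 2
    have h4 := mul_le_mul_of_nonneg_left h3 (by positivity : 0 ≤ 8 * σ ^ 2)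
    set z := (star v ⬝ᵥ P⁻¹ *ᵥ a).re
    set q := (quad D v).re - (trace D).re
    nlinarith [sq_nonneg (2 * σ * z - q)]
  refine (integral_mono (memLp_noiseTerm σ P⁻¹ a).integrable_sq
    ((h1.const_mul _).add (h2.const_mul 2)) hpt).trans ?_
  rw [integral_add' (h1.const_mul _) (h2.const_mul 2), integral_const_mul, integral_const_mul,
    integral_norm_dotProduct_sq, sum_norm_mulVec_sq hP.inv_isHermitian]
  have h5 := integral_re_quad_sub_trace_sq_le D
  have h6 := hP.frobSq_one_sub_le
  rw [Fintype.card_fin, ← hD] at h6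
  have h7 := hP.quad_inv_sq_le a
  rw [le_div_iff₀ (by positivity)] at h7
  have h8 := mul_le_mul_of_nonneg_left h6 (by positivity : 0 ≤ 2 * fourthMoment)
  nlinarith

/-- Column `j` of the received signal without noise. -/
def signalCol (X : Matrix (Fin K) (Fin n) ℂ) (h : Fin K → Fin N → ℂ) (j : Fin n) : Fin N → ℂ :=
  fun i => ((1 / (Real.sqrt K : ℂ)) • (chan h * X)) i j

/-- The centred contribution of the noise to the trace in the information density. -/
def noiseSum (σ : ℝ) (X : Matrix (Fin K) (Fin n) ℂ) (h : Fin K → Fin N → ℂ)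
    (w : Fin n → Fin N → ℂ) : ℝ :=
  ∑ j, noiseTerm σ (regGram (σ ^ 2) (chan h))⁻¹ (signalCol X h j) (w j)

lemma trace_mul_mul_conjTranspose (Q : Matrix (Fin N) (Fin N) ℂ) (Y : Matrix (Fin N) (Fin n) ℂ) :
    trace (Q * (Y * Yᴴ)) = ∑ j, quad Q fun i => Y i j := by
  rw [← Matrix.mul_assoc, trace_mul_comm, ← Matrix.mul_assoc, trace]
  refine Finset.sum_congr rfl fun j _ => ?_
  rw [diag_apply, Matrix.mul_assoc]
  simp [quad, mul_apply, dotProduct, mulVec]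

lemma sum_quad_signalCol (x : ℝ) (X : Matrix (Fin K) (Fin n) ℂ) (h : Fin K → Fin N → ℂ) :
    ∑ j, quad (regGram x (chan h))⁻¹ (signalCol X h j) = trace (X * Xᴴ * bMat x (chan h)) := by
  have hs : (1 / (Real.sqrt K : ℂ)) * star (1 / (Real.sqrt K : ℂ)) = 1 / (K : ℂ) := by
    rw [RCLike.star_def, map_div₀, map_one, Complex.conj_ofReal, div_mul_div_comm, one_mul,
      ← Complex.ofReal_mul, Real.mul_self_sqrt (Nat.cast_nonneg _), Complex.ofReal_natCast]
  unfold signalCol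
  rw [← trace_mul_mul_conjTranspose, conjTranspose_smul, conjTranspose_mul, Matrix.smul_mul,
    Matrix.mul_smul, Matrix.mul_smul, Matrix.mul_smul, smul_smul, hs, bMat, Matrix.mul_smul,
    trace_smul, trace_smul]
  congr 1
  rw [trace_mul_comm (X * Xᴴ)]
  simp only [Matrix.mul_assoc]
  rw [trace_mul_comm (chan h)ᴴ]
  simp only [Matrix.mul_assoc]

/-- The matrix `bMat` is at most the identity. -/
lemma sum_quad_signalCol_le {x : ℝ} (hx : 0 < x) {X : Matrix (Fin K) (Fin n) ℂ}
    (hX : (trace (X * Xᴴ)).re ≤ n * K) (h : Fin K → Fin N → ℂ) :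
    ∑ j, (quad (regGram x (chan h))⁻¹ (signalCol X h j)).re ≤ n * K := by
  rw [← Complex.re_sum, sum_quad_signalCol]
  have h1 := trace_re_nonneg ((one_sub_bMat hx (chan h)).conjTranspose_mul_mul_same X)
  rw [Matrix.mul_sub, Matrix.sub_mul, Matrix.mul_one, trace_sub, Complex.sub_re, trace_mul_comm,
    trace_mul_cycle] at h1
  linarith

/-- Given the channel, the noise contribution is a sum of independent centred terms, so that the
Efron–Stein inequality bounds its second moment by the sum of theirs. -/
lemma integral_noiseSum_sq_le (hσ : 0 < σ) {X : Matrix (Fin K) (Fin n) ℂ}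
    (hX : (trace (X * Xᴴ)).re ≤ n * K) (h : Fin K → Fin N → ℂ) :
    MemLp (noiseSum σ X h) 2 (colsLaw N n) ∧
    ∫ w, noiseSum σ X h w ^ 2 ∂(colsLaw N n) ≤ 8 * (n * K) + 4 * fourthMoment * N * n := by
  have hP : BoundedBelow (σ ^ 2) (regGram (σ ^ 2) (chan h)) :=
    boundedBelow_regGram (by positivity) _
  set Q := (regGram (σ ^ 2) (chan h))⁻¹ with hQ
  have hmp : ∀ j : Fin n, MeasurePreserving (fun w : Fin n → Fin N → ℂ => w j) (colsLaw N n)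
    (columnLaw N) := fun j => measurePreserving_eval (fun _ : Fin n => columnLaw N) j
  have hL : ∀ j, MemLp (fun w : Fin n → Fin N → ℂ => noiseTerm σ Q (signalCol X h j) (w j)) 2
      (colsLaw N n) := fun j =>
    (memLp_noiseTerm σ Q (signalCol X h j)).comp_measurePreserving (hmp j)
  have hmap : ∀ (j : Fin n) (F : (Fin N → ℂ) → ℝ), AEStronglyMeasurable F (columnLaw N) →
      ∫ w, F (w j) ∂(colsLaw N n) = ∫ v, F v ∂(columnLaw N) := fun j F hF => by
    have := integral_map (f := F) (hmp j).measurable.aemeasurable (by rwa [(hmp j).map_eq])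
    rw [(hmp j).map_eq] at this
    exact this.symm
  have hS : MemLp (noiseSum σ X h) 2 (colsLaw N n) := memLp_finsetSum _ fun j _ => hL j
  refine ⟨hS, ?_⟩
  have hmean : ∫ w, noiseSum σ X h w ∂(colsLaw N n) = 0 := by
    unfold noiseSum
    rw [integral_finsetSum _ fun j _ => (hL j).integrable (by norm_num)]
    refine Finset.sum_eq_zero fun j _ => ?_
    rw [hmap j _ (memLp_noiseTerm _ _ _).aestronglyMeasurable, integral_noiseTerm]
  have hdiff : ∀ (j : Fin n) (w : Fin n → Fin N → ℂ), noiseSum σ X h w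
      - ∑ i ∈ Finset.univ.erase j, noiseTerm σ Q (signalCol X h i) (w i)
      = noiseTerm σ Q (signalCol X h j) (w j) := fun j w => by
    unfold noiseSum
    rw [← Finset.add_sum_erase _ _ (Finset.mem_univ j), add_sub_cancel_right]
  have hmain := efronStein (columnLaw N) n (noiseSum σ X h)
    (fun j w => ∑ i ∈ Finset.univ.erase j, noiseTerm σ Q (signalCol X h i) (w i)) hS
    (fun j => by simp only [hdiff]; exact hL j)
    (fun j w y => Finset.sum_congr rfl fun i hi => by
      rw [Function.update_of_ne (Finset.ne_of_mem_erase hi)])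
  simp only [hdiff] at hmain
  rw [show ∫ h', noiseSum σ X h h' ∂(Measure.pi fun _ : Fin n => columnLaw N) = 0 from hmean]
    at hmain
  simp only [sub_zero] at hmain
  refine hmain.trans ?_
  calc _ ≤ ∑ j, (8 * (quad Q (signalCol X h j)).re + 4 * fourthMoment * N) := by
        refine Finset.sum_le_sum fun j _ => ?_
        refine le_trans (le_of_eq ?_) (integral_noiseTerm_sq_le hσ hP (signalCol X h j))
        exact hmap j (fun v => noiseTerm σ Q (signalCol X h j) v ^ 2)
          (memLp_noiseTerm _ _ _).integrable_sq.aestronglyMeasurable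
    _ ≤ _ := by
        rw [Finset.sum_add_distrib, ← Finset.mul_sum, Finset.sum_const, Finset.card_univ,
          Fintype.card_fin, nsmul_eq_mul]
        have := sum_quad_signalCol_le (N := N) (by positivity : 0 < σ ^ 2) hX h
        nlinarith

lemma quad_add_smul_re {Q : Matrix (Fin N) (Fin N) ℂ} (hQ : Q.IsHermitian) (σ : ℝ)
    (a v : Fin N → ℂ) :
    (quad Q (a + (σ : ℂ) • v)).re
      = (quad Q a).re + 2 * σ * (star v ⬝ᵥ Q *ᵥ a).re + σ ^ 2 * (quad Q v).re := by
  have h1 : star a ⬝ᵥ Q *ᵥ v = conj (star v ⬝ᵥ Q *ᵥ a) := by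
    conv_lhs => rw [star_dotProduct, star_mulVec, hQ.eq, ← dotProduct_mulVec]
    rfl
  have h2 : star (a + (σ : ℂ) • v) = star a + (σ : ℂ) • star v := by
    rw [star_add, star_smul, RCLike.star_def, Complex.conj_ofReal]
  rw [quad, h2, mulVec_add, mulVec_smul, dotProduct_add, add_dotProduct, add_dotProduct,
    dotProduct_smul, dotProduct_smul, smul_dotProduct, smul_dotProduct, h1, ← quad, ← quad]
  simp only [smul_eq_mul, Complex.add_re, Complex.re_ofReal_mul, Complex.conj_re]
  ring

/-- The decomposition of the information density into the log-determinant, the noise contribution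
and a bilinear expression in the deviation of the input and the matrix `bMat`. -/
lemma infoDensity_eq (hσ : 0 < σ) (hn : 0 < n) (X : Matrix (Fin K) (Fin n) ℂ)
    (h : Fin K → Fin N → ℂ) (w : Fin n → Fin N → ℂ) :
    infoDensity σ X (chan h) (chan w)
      = 1 / K * logDet (σ ^ 2) (chan h) + 1 / (n * K) * (noiseSum σ X h w
        - n * (trace (deviation X * bMat (σ ^ 2) (chan h))).re) := by
  have hn' : (n : ℝ) ≠ 0 := by exact_mod_cast hn.ne'
  have hx : 0 < σ ^ 2 := by positivity
  have hP := boundedBelow_regGram hx (chan h)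
  have hreg : gram (chan h) + ((σ : ℂ) ^ 2) • (1 : Matrix (Fin N) (Fin N) ℂ)
      = regGram (σ ^ 2) (chan h) := by unfold regGram; push_cast; rfl
  have hlog : Real.log (det (1 + (1 / (σ : ℂ) ^ 2) • gram (chan h))).re
      = logDet (σ ^ 2) (chan h) := by unfold logDet; push_cast; rfl
  have hcol : ∀ j, (fun i => output σ X (chan h) (chan w) i j)
      = signalCol X h j + (σ : ℂ) • w j := by
    intro j; ext i; simp [output, signalCol, chan_apply]
  have hW : trace (chan w * (chan w)ᴴ) = ∑ j, quad (1 : Matrix (Fin N) (Fin N) ℂ) (w j) := by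
    have := trace_mul_mul_conjTranspose (1 : Matrix (Fin N) (Fin N) ℂ) (chan w)
    rw [Matrix.one_mul] at this
    exact this
  have hdev : X * Xᴴ = (n : ℂ) • (1 - deviation X) := by
    have : (n : ℂ) ≠ 0 := by exact_mod_cast hn.ne'
    rw [deviation, sub_sub_cancel, smul_smul, mul_one_div_cancel this, one_smul]
  -- the signal part is `tr (X Xᴴ B)`, and its value at `X Xᴴ = n` cancels the mean of the noise
  have hsig : ∑ j, (quad (regGram (σ ^ 2) (chan h))⁻¹ (signalCol X h j)).re
      = n * (N - σ ^ 2 * (trace (regGram (σ ^ 2) (chan h))⁻¹).re)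
        - n * (trace (deviation X * bMat (σ ^ 2) (chan h))).re := by
    have h1 : (trace (bMat (σ ^ 2) (chan h))).re
        = N - σ ^ 2 * (trace (regGram (σ ^ 2) (chan h))⁻¹).re := by
      rw [trace_bMat hx, Complex.sub_re, Complex.re_ofReal_mul, Complex.natCast_re]
    rw [← Complex.re_sum, sum_quad_signalCol, hdev, Matrix.smul_mul, trace_smul, smul_eq_mul,
      ← Complex.ofReal_natCast, Complex.re_ofReal_mul, Matrix.sub_mul, Matrix.one_mul, trace_sub,
      Complex.sub_re, h1]
    ring
  have hmain : (trace ((regGram (σ ^ 2) (chan h))⁻¹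
        * (output σ X (chan h) (chan w) * (output σ X (chan h) (chan w))ᴴ)
        - chan w * (chan w)ᴴ)).re
      = noiseSum σ X h w - n * (trace (deviation X * bMat (σ ^ 2) (chan h))).re := by
    rw [trace_sub, Complex.sub_re, trace_mul_mul_conjTranspose, hW, Complex.re_sum, Complex.re_sum]
    simp only [hcol, quad_add_smul_re hP.inv_isHermitian, noiseSum, noiseTerm, quad_sub, quad_smul,
      trace_sub, trace_smul, smul_eq_mul, Complex.sub_re, Complex.re_ofReal_mul, trace_one,
      Fintype.card_fin, Complex.natCast_re, Finset.sum_add_distrib, Finset.sum_sub_distrib,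
      Finset.sum_const, Finset.card_univ, nsmul_eq_mul, hsig]
    ring
  unfold infoDensity
  rw [hreg, hlog, hmain]

lemma trace_mul_bMat_sub (c x : ℝ) (A : Matrix (Fin K) (Fin K) ℂ) (h : Fin K → Fin N → ℂ) :
    trace (A * bMat x (chan h)) - gamma0 c x * trace A = ∑ i, ∑ j, A j i * bDev c x i j h := by
  simp only [bDev, mul_sub, Finset.sum_sub_distrib]
  congr 1
  · rw [Finset.sum_comm]
    simp only [trace, diag_apply, mul_apply]
  · simp [trace, Finset.mul_sum, mul_comm]

/-- The centred information density as a function of the columns of channel and noise. -/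
lemma centredDensity_eq (c : ℝ) (hσ : 0 < σ) (hn : 0 < n) (hK : 0 < K)
    (X : Matrix (Fin K) (Fin n) ℂ) (h : Fin K → Fin N → ℂ) (w : Fin n → Fin N → ℂ) :
    Real.sqrt ((n : ℝ) * K) * (infoDensity σ X (chan h) (chan w) - capacity c σ
      + zeta0 c σ * (1 / (K : ℝ) * (trace (deviation X)).re))
      = Real.sqrt ((n : ℝ) * K) * (1 / K * (logDet (σ ^ 2) (chan h) - K * capFun c (σ ^ 2))
        + 1 / (n * K) * noiseSum σ X h w
        - 1 / K * (∑ i, ∑ j, deviation X j i * bDev c (σ ^ 2) i j h).re) := by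
  have hn' : (n : ℝ) ≠ 0 := by exact_mod_cast hn.ne'
  have hK' : (K : ℝ) ≠ 0 := by exact_mod_cast hK.ne'
  have hcap : capacity c σ = capFun c (σ ^ 2) := rfl
  rw [infoDensity_eq hσ hn, ← trace_mul_bMat_sub, Complex.sub_re, Complex.re_ofReal_mul, hcap,
    zeta0]
  congr 1
  field_simp
  ring

end Noise

/-! ### The second moment of the centred information density -/

section SecondMoment

variable {n K N : ℕ} {σ c R S ρ : ℝ}

lemma continuous_noiseSum (hσ : 0 < σ) (X : Matrix (Fin K) (Fin n) ℂ) :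
    Continuous fun p : (Fin K → Fin N → ℂ) × (Fin n → Fin N → ℂ) => noiseSum σ X p.1 p.2 := by
  have hQ : Continuous fun p : (Fin K → Fin N → ℂ) × (Fin n → Fin N → ℂ) =>
      (regGram (σ ^ 2) (chan p.1))⁻¹ :=
    (continuous_regGram_inv (by positivity : 0 < σ ^ 2)).comp (continuous_chan.comp continuous_fst)
  have ha : ∀ j, Continuous fun p : (Fin K → Fin N → ℂ) × (Fin n → Fin N → ℂ) =>
      signalCol X p.1 j := fun j => by
    have h0 : Continuous fun p : (Fin K → Fin N → ℂ) × (Fin n → Fin N → ℂ) => chan p.1 * X :=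
      (continuous_chan.comp continuous_fst).matrix_mul continuous_const
    have h1 := h0.const_smul (1 / (Real.sqrt K : ℂ))
    exact continuous_pi fun i => h1.matrix_elem i j
  have hw : ∀ j : Fin n, Continuous fun p : (Fin K → Fin N → ℂ) × (Fin n → Fin N → ℂ) => p.2 j :=
    fun j => (continuous_apply j).comp continuous_snd
  have hD := (hQ.const_smul ((σ ^ 2 : ℝ) : ℂ)).sub
    (continuous_const (y := (1 : Matrix (Fin N) (Fin N) ℂ)))
  unfold noiseSum noiseTerm quad
  refine continuous_finsetSum _ fun j _ => Continuous.add ?_ (Continuous.sub ?_ ?_)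
  · exact continuous_const.mul
      (Complex.continuous_re.comp ((hw j).star.dotProduct (hQ.matrix_mulVec (ha j))))
  · exact Complex.continuous_re.comp ((hw j).star.dotProduct (hD.matrix_mulVec (hw j)))
  · exact Complex.continuous_re.comp hD.matrix_trace

lemma integrable_noiseSum_sq (hσ : 0 < σ) {X : Matrix (Fin K) (Fin n) ℂ}
    (hX : (trace (X * Xᴴ)).re ≤ n * K) :
    Integrable (fun p => noiseSum (N := N) σ X p.1 p.2 ^ 2)
      ((colsLaw N K).prod (colsLaw N n)) ∧
    ∫ p, noiseSum (N := N) σ X p.1 p.2 ^ 2 ∂((colsLaw N K).prod (colsLaw N n))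
      ≤ 8 * (n * K) + 4 * fourthMoment * N * n := by
  have hmeas : AEStronglyMeasurable (fun p => noiseSum (N := N) σ X p.1 p.2 ^ 2)
      ((colsLaw N K).prod (colsLaw N n)) :=
    ((continuous_noiseSum hσ X).pow 2).aestronglyMeasurable
  have hb := fun h => (integral_noiseSum_sq_le (N := N) hσ hX h).2
  have hnorm : ∀ h : Fin K → Fin N → ℂ, ∀ w, ‖noiseSum σ X h w ^ 2‖ = noiseSum σ X h w ^ 2 :=
    fun h w => Real.norm_of_nonneg (sq_nonneg _)
  have hint : Integrable (fun h : Fin K → Fin N → ℂ => ∫ w, noiseSum σ X h w ^ 2 ∂(colsLaw N n))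
      (colsLaw N K) := by
    refine Integrable.of_bound hmeas.integral_prod_right' (8 * (n * K) + 4 * fourthMoment * N * n)
      (Eventually.of_forall fun h => ?_)
    rw [Real.norm_of_nonneg (integral_nonneg fun w => sq_nonneg _)]
    exact hb h
  have hprod : Integrable (fun p => noiseSum (N := N) σ X p.1 p.2 ^ 2)
      ((colsLaw N K).prod (colsLaw N n)) := by
    refine (integrable_prod_iff hmeas).2 ⟨Eventually.of_forall fun h =>
      (integral_noiseSum_sq_le hσ hX h).1.integrable_sq, ?_⟩
    simp only [hnorm]
    exact hint
  refine ⟨hprod, ?_⟩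
  rw [integral_prod _ hprod]
  refine (integral_mono hint (integrable_const _) hb).trans (le_of_eq ?_)
  simp

/-- The constant in the bound for the second moment of the centred information density. -/
def momentConst (R S ρ x : ℝ) : ℝ :=
  3 * (S * logDetConst R ρ x + 8 + 4 * fourthMoment * R + S * bilinConst R ρ x)

lemma deviation_isHermitian (X : Matrix (Fin K) (Fin n) ℂ) : (deviation X).IsHermitian := by
  refine isHermitian_one.sub ?_
  rw [IsHermitian, conjTranspose_smul, conjTranspose_mul, conjTranspose_conjTranspose]
  simp

/-- Up to transposition of the arrays of entries, the channel law is the law of independent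
columns. -/
lemma measurePreserving_transpose (n K N : ℕ) :
    MeasurePreserving (fun p : (Fin N → Fin K → ℂ) × (Fin N → Fin n → ℂ) =>
        ((fun k i => p.1 i k, fun j i => p.2 i j) : (Fin K → Fin N → ℂ) × (Fin n → Fin N → ℂ)))
      (channelLaw n K N) ((colsLaw N K).prod (colsLaw N n)) :=
  (measurePreserving_swap_pi complexNormal).prod (measurePreserving_swap_pi complexNormal)

/-- The second moment of the centred information density, with a constant that depends on the
dimensions only through bounds on the ratios. -/
lemma integral_centredDensity_sq_le (hσ : 0 < σ) (hc : 0 < c) (hn : 0 < n) (hK : 0 < K)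
    (hR : (N : ℝ) / K ≤ R) (hS : (n : ℝ) / K ≤ S) (hρ : K * |(N : ℝ) / K - c| ≤ ρ)
    {X : Matrix (Fin K) (Fin n) ℂ} (hX : X ∈ inputSet n K) :
    Integrable (fun p => |centredDensity c σ X p| ^ 2) (channelLaw n K N) ∧
      ∫ p, |centredDensity c σ X p| ^ 2 ∂(channelLaw n K N)
        ≤ momentConst R S ρ (σ ^ 2) * (1 + 1 / (K : ℝ) * (trace (deviation X ^ 2)).re) := by
  have hx : 0 < σ ^ 2 := by positivity
  have hn' : (0 : ℝ) < n := by exact_mod_cast hn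
  have hK' : (0 : ℝ) < K := by exact_mod_cast hK
  have hm := fourthMoment_nonneg
  have hX' : (trace (X * Xᴴ)).re ≤ n * K := by
    have h1 : 1 / ((n : ℝ) * K) * (trace (X * Xᴴ)).re ≤ 1 := hX
    rwa [one_div_mul_eq_div, div_le_one (by positivity)] at h1
  have hF : (trace (deviation X ^ 2)).re = frobSq (deviation X) := by
    rw [sq, frobSq_eq_trace (deviation_isHermitian X)]
  set a : (Fin K → Fin N → ℂ) → ℝ := fun h => logDet (σ ^ 2) (chan h) - K * capFun c (σ ^ 2)
    with ha
  set b : (Fin K → Fin N → ℂ) → ℂ := fun h => ∑ i, ∑ j, deviation X j i * bDev c (σ ^ 2) i j h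
    with hb
  set f : (Fin K → Fin N → ℂ) × (Fin n → Fin N → ℂ) → ℝ := fun p =>
    Real.sqrt ((n : ℝ) * K) * (1 / K * a p.1 + 1 / (n * K) * noiseSum σ X p.1 p.2
      - 1 / K * (b p.1).re) with hf
  -- the three mean squares are estimated separately
  set g : (Fin K → Fin N → ℂ) × (Fin n → Fin N → ℂ) → ℝ := fun p =>
    3 * (n / K) * a p.1 ^ 2 + 3 / (n * K) * noiseSum σ X p.1 p.2 ^ 2
      + 3 * (n / K) * ‖b p.1‖ ^ 2 with hg
  have ha2 : MemLp a 2 (colsLaw N K) := (memLp_logDet hx).sub (memLp_const _)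
  have hb2 : MemLp b 2 (colsLaw N K) := memLp_finsetSum _ fun i _ => memLp_finsetSum _ fun j _ =>
    (memLp_bDev hx i j).const_mul _
  have hfeq : (fun p => |centredDensity (N := N) c σ X p| ^ 2)
      = fun p => f (fun k i => p.1 i k, fun j i => p.2 i j) ^ 2 := by
    funext p
    rw [sq_abs]
    exact congrArg (· ^ 2) (centredDensity_eq c hσ hn hK X (fun k i => p.1 i k) fun j i => p.2 i j)
  have hfg : ∀ p, f p ^ 2 ≤ g p := fun p => by
    have h1 : (b p.1).re ^ 2 ≤ ‖b p.1‖ ^ 2 := by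
      rw [← sq_abs]; exact pow_le_pow_left₀ (abs_nonneg _) (Complex.abs_re_le_norm _) 2
    have h2 : ∀ u v w : ℝ, (u + v - w) ^ 2 ≤ 3 * (u ^ 2 + v ^ 2 + w ^ 2) := fun u v w => by
      nlinarith [sq_nonneg (u - v), sq_nonneg (u + w), sq_nonneg (v + w)]
    calc f p ^ 2 = n * K * (1 / K * a p.1 + 1 / (n * K) * noiseSum σ X p.1 p.2
          - 1 / K * (b p.1).re) ^ 2 := by
          simp only [hf]; rw [mul_pow, Real.sq_sqrt (by positivity)]
      _ ≤ n * K * (3 * ((1 / K * a p.1) ^ 2 + (1 / (n * K) * noiseSum σ X p.1 p.2) ^ 2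
          + (1 / K * (b p.1).re) ^ 2)) := mul_le_mul_of_nonneg_left (h2 _ _ _) (by positivity)
      _ = 3 * (n / K) * a p.1 ^ 2 + 3 / (n * K) * noiseSum σ X p.1 p.2 ^ 2
          + 3 * (n / K) * (b p.1).re ^ 2 := by field_simp
      _ ≤ g p := by simp only [hg]; gcongr
  obtain ⟨hs1, hs2⟩ := integrable_noiseSum_sq (N := N) hσ hX'
  have ia : Integrable (fun p : (Fin K → Fin N → ℂ) × (Fin n → Fin N → ℂ) =>
      3 * (n / K) * a p.1 ^ 2) ((colsLaw N K).prod (colsLaw N n)) :=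
    (ha2.integrable_sq.comp_fst _).const_mul _
  have is : Integrable (fun p => 3 / (n * K) * noiseSum (N := N) σ X p.1 p.2 ^ 2)
      ((colsLaw N K).prod (colsLaw N n)) := hs1.const_mul _
  have ib : Integrable (fun p : (Fin K → Fin N → ℂ) × (Fin n → Fin N → ℂ) =>
      3 * (n / K) * ‖b p.1‖ ^ 2) ((colsLaw N K).prod (colsLaw N n)) :=
    (hb2.norm.integrable_sq.comp_fst _).const_mul _
  have ias : Integrable (fun p : (Fin K → Fin N → ℂ) × (Fin n → Fin N → ℂ) =>
      3 * (n / K) * a p.1 ^ 2 + 3 / (n * K) * noiseSum σ X p.1 p.2 ^ 2)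
      ((colsLaw N K).prod (colsLaw N n)) := ia.add is
  have ig : Integrable g ((colsLaw N K).prod (colsLaw N n)) := ias.add ib
  have hfm : AEStronglyMeasurable f ((colsLaw N K).prod (colsLaw N n)) := by
    have h1 := (ha2.aestronglyMeasurable.comp_fst (ν := colsLaw N n)).const_mul (1 / (K : ℝ))
    have h2 := (continuous_noiseSum (N := N) hσ X).aestronglyMeasurable
      (μ := (colsLaw N K).prod (colsLaw N n)) |>.const_mul (1 / ((n : ℝ) * K))
    have h3 := (hb2.re.aestronglyMeasurable.comp_fst (ν := colsLaw N n)).const_mul (1 / (K : ℝ))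
    exact ((h1.add h2).sub h3).const_mul _
  have if2 : Integrable (fun p => f p ^ 2) ((colsLaw N K).prod (colsLaw N n)) :=
    ig.mono' (hfm.pow 2) (Eventually.of_forall fun p => by
      rw [Real.norm_of_nonneg (sq_nonneg _)]; exact hfg p)
  have hT := measurePreserving_transpose n K N
  rw [hfeq]
  refine ⟨hT.integrable_comp_of_integrable if2, ?_⟩
  have htrans : ∫ p, f (fun k i => p.1 i k, fun j i => p.2 i j) ^ 2 ∂(channelLaw n K N)
      = ∫ p, f p ^ 2 ∂((colsLaw N K).prod (colsLaw N n)) := by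
    have h1 := integral_map (f := fun p => f p ^ 2) hT.measurable.aemeasurable
      (by rw [hT.map_eq]; exact if2.aestronglyMeasurable)
    rw [hT.map_eq] at h1
    exact h1.symm
  rw [htrans]
  refine (integral_mono if2 ig hfg).trans ?_
  have hla := integral_logDet_sub_sq_le hc hx hK hR hρ
  have hlb := integral_norm_trace_mul_bDev_sq_le (N := N) hc hx hK hR hρ (deviation X)
  have hL0 : 0 ≤ logDetConst R ρ (σ ^ 2) := le_trans (integral_nonneg fun _ => sq_nonneg _) hla
  have hB0 : 0 ≤ bilinConst R ρ (σ ^ 2) := by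
    have h1 := diagConst_nonneg (ρ := ρ) (x := σ ^ 2) hR
    have h2 := traceSqConst_nonneg (ρ := ρ) (x := σ ^ 2) hR
    unfold bilinConst; positivity
  have hF0 : 0 ≤ frobSq (deviation X) / K := div_nonneg (frobSq_nonneg _) hK'.le
  have hS0 : 0 ≤ S := le_trans (by positivity) hS
  have hR0 : 0 ≤ R := le_trans (by positivity) hR
  have eg : ∫ p, g p ∂((colsLaw N K).prod (colsLaw N n))
      = 3 * (n / K) * ∫ h, a h ^ 2 ∂(colsLaw N K)
        + 3 / (n * K) * ∫ p, noiseSum (N := N) σ X p.1 p.2 ^ 2 ∂((colsLaw N K).prod (colsLaw N n))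
        + 3 * (n / K) * ∫ h, ‖b h‖ ^ 2 ∂(colsLaw N K) := by
    simp only [hg]
    rw [integral_add ias ib, integral_add ia is,
      integral_const_mul, integral_const_mul, integral_const_mul,
      integral_fun_fst (fun h => a h ^ 2), integral_fun_fst (fun h => ‖b h‖ ^ 2)]
    simp
  rw [eg, hF, one_div_mul_eq_div]
  have t1 : 3 * (n / K) * ∫ h, a h ^ 2 ∂(colsLaw N K) ≤ 3 * (S * logDetConst R ρ (σ ^ 2)) := by
    rw [mul_assoc]
    exact mul_le_mul_of_nonneg_left
      (mul_le_mul hS hla (integral_nonneg fun _ => sq_nonneg _) hS0) (by norm_num)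
  have t2 : 3 / (n * K) * ∫ p, noiseSum (N := N) σ X p.1 p.2 ^ 2
      ∂((colsLaw N K).prod (colsLaw N n)) ≤ 3 * (8 + 4 * fourthMoment * R) := by
    calc _ ≤ 3 / (n * K) * (8 * (n * K) + 4 * fourthMoment * N * n) :=
          mul_le_mul_of_nonneg_left hs2 (by positivity)
      _ = 3 * (8 + 4 * fourthMoment * (N / K)) := by field_simp
      _ ≤ _ := by gcongr
  have t3 : 3 * (n / K) * ∫ h, ‖b h‖ ^ 2 ∂(colsLaw N K)
      ≤ 3 * (S * bilinConst R ρ (σ ^ 2)) * (frobSq (deviation X) / K) := by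
    rw [mul_assoc, mul_assoc, mul_assoc]
    exact mul_le_mul_of_nonneg_left
      (mul_le_mul hS hlb (integral_nonneg fun _ => sq_nonneg _) hS0) (by norm_num)
  unfold momentConst
  have u1 := mul_nonneg hS0 hL0
  have u2 := mul_nonneg hS0 hB0
  have u3 := mul_nonneg hm hR0
  nlinarith [mul_nonneg u1 hF0, mul_nonneg u3 hF0]

end SecondMoment

/-! ### Uniform bounds along the growth regime -/

namespace GrowthRegime

variable {β c : ℝ} {n K N : ℕ → ℕ}

lemma tendsto_inv_sq (h : GrowthRegime β c n K N) :
    Tendsto (fun j => ((n j : ℝ) ^ 2)⁻¹) atTop (nhds 0) :=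
  tendsto_inv_atTop_zero.comp ((tendsto_pow_atTop two_ne_zero).comp
    (tendsto_natCast_atTop_atTop.comp h.tendsto_n))

lemma tendsto_ratio_n (h : GrowthRegime β c n K N) :
    Tendsto (fun j => (n j : ℝ) / K j) atTop (nhds β) := by
  simpa using (h.ratio_n.trans_tendsto h.tendsto_inv_sq).add_const β

lemma tendsto_ratio_N (h : GrowthRegime β c n K N) :
    Tendsto (fun j => (N j : ℝ) / K j) atTop (nhds c) := by
  simpa using (h.ratio_N.trans_tendsto h.tendsto_inv_sq).add_const c

/-- The deviation of `N / K` from its limit is negligible at the scale `1 / K`. -/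
lemma tendsto_K_mul (hβ : 0 < β) (h : GrowthRegime β c n K N) :
    Tendsto (fun j => K j * |(N j : ℝ) / K j - c|) atTop (nhds 0) := by
  have h1 : Tendsto (fun j => ((N j : ℝ) / K j - c) / ((n j : ℝ) ^ 2)⁻¹) atTop (nhds 0) :=
    h.ratio_N.tendsto_div_nhds_zero
  have h2 : Tendsto (fun j => ((n j : ℝ) / K j)⁻¹) atTop (nhds β⁻¹) :=
    h.tendsto_ratio_n.inv₀ hβ.ne'
  have h3 : Tendsto (fun j => ((n j : ℝ))⁻¹) atTop (nhds 0) :=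
    tendsto_inv_atTop_zero.comp (tendsto_natCast_atTop_atTop.comp h.tendsto_n)
  have h4 := (h2.mul h3).mul h1.abs
  simp only [abs_zero, mul_zero] at h4
  refine h4.congr fun j => ?_
  have hn : (0 : ℝ) < n j := by exact_mod_cast h.n_pos j
  rw [abs_div, abs_of_pos (by positivity : 0 < ((n j : ℝ) ^ 2)⁻¹)]
  field_simp

end GrowthRegime

end

end MIMO

theorem mainTheorem6 (σ β c : ℝ) (hσ : 0 < σ) (hβ : 0 < β) (hc : 0 < c)
    (n K N : ℕ → ℕ) (hreg : MIMO.GrowthRegime β c n K N) :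
    ∃ M : ℝ, ∀ (j : ℕ) (X : Matrix (Fin (K j)) (Fin (n j)) ℂ), X ∈ MIMO.inputSet (n j) (K j) →
      Integrable (fun p => |MIMO.centredDensity c σ X p| ^ 2)
          (MIMO.channelLaw (n j) (K j) (N j)) ∧
        ∫ p, |MIMO.centredDensity c σ X p| ^ 2 ∂(MIMO.channelLaw (n j) (K j) (N j))
          ≤ M * (1 + 1 / (K j : ℝ) * (Matrix.trace (MIMO.deviation X ^ 2)).re) := by
  obtain ⟨S, hS⟩ := hreg.tendsto_ratio_n.bddAbove_range
  obtain ⟨R, hR⟩ := hreg.tendsto_ratio_N.bddAbove_range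
  obtain ⟨ρ, hρ⟩ := (hreg.tendsto_K_mul hβ).bddAbove_range
  exact ⟨MIMO.momentConst R S ρ (σ ^ 2), fun j X hX =>
    MIMO.integral_centredDensity_sq_le hσ hc (hreg.n_pos j) (hreg.K_pos j) (hR ⟨j, rfl⟩)
      (hS ⟨j, rfl⟩) (hρ ⟨j, rfl⟩) hX⟩
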